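/- **Proposition 6.1 (random bound in $Y$).** *Setting.* Use $\hat f(\xi)=(2\pi)^{-5/2}\int_{\mathbb R^5} f(x)e^{-ix\cdot\xi}\,dx$, $\langle\xi\rangle=(1+|\xi|^2)^{1/2}$, $\widehat{\langle\nabla\rangle^{\sigma}f}=\langle\xi\rangle^{\sigma}\hat f$, $\widehat{e^{it\Delta}f}=e^{-it|\xi|^2}\hat f$ for tempered distributions on $\mathbb R^5$, and $\|f\|_{H^s}=\|\langle\xi\rangle^s\hat f\|_{L^2}$. Let $s\in\mathbb R$ and let $a\in\mathbb N$ satisfy $a>\max\{4-2s,\,5-4s,\,-\tfrac12 s,\,3\}$. For $N\in\{1,2,4,8,\dots\}$ put $O_N=\{\xi\in\mathbb R^5:|\xi_i|\le N,\ 1\le i\le 5\}$ and $Q_N=O_{2N}\setminus O_N$, and let $\mathcal Q$ consist of $O_1$ and, for every such $N$, of all open dyadic cubes $\prod_{i=1}^5\big(m_iN^{-a},(m_i+1)N^{-a}\big)$, $m\in\mathbb Z^5$, contained in $Q_N$. For $Q\in\mathcal Q$ let $2Q$ be the cube with the same centre and twice the diameter. Let $\phi_Q\in C_c^\infty(\mathbb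 R^5)$, $\phi_Q\ge 0$, with $\phi_Q=1$ on $Q$ and $\phi_Q=0$ outside $2Q$, put $\psi_Q=\phi_Q/\sum_{Q'\in\mathcal Q}\phi_{Q'}$ and $\widehat{\Box_Q f}=\psi_Q\hat f$. Let $(g_Q)_{Q\in\mathcal Q}$ be independent mean-zero complex Gaussian random variables on a probability space $(\Omega,\mathcal A,\mathbb P)$ with $\mathbb E|g_Q|^2\le V$ for all $Q$ (a complex Gaussian being a random variable whose real and imaginary parts are jointly Gaussian; $V=1$ for standard complex Gaussians). The narrowed Wiener randomization of $f\in H^s(\mathbb R^5)$ is $$f^\omega=\sum_{Q\in\mathcal Q}g_Q(\omega)\,\Box_Q f .$$ For a function $u$ on $\mathbb R\times\mathbb R^5$ let $$\|u\|_{Y(\mathbb R)}=\|\langle\nabla\rangle^{s+\frac a2}u\|_{L^2_tL^5_x}+\|u\|_{L^4_tL^5_x}+\|u\|_{L^4_tL^4_x}+\|u\|_{L^6_tL^3_x}\in[0,\infty],$$ with $t\in\mathbb R$, $x\in\mathbb R^5$. *Statement.* There are constants $C,c>0$, depending only on $s$, $a$ and $V$, such that for all such $(\phi_Q)$, $(\Omega,\mathcal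 A,\mathbb P)$ and $(g_Q)$ and every $f\in H^s(\mathbb R^5)$ the following holds. For almost every $\omega$ the series defining $f^\omega$ converges unconditionally in the space of tempered distributions (with the topology of pointwise convergence on Schwartz functions); for every $\lambda>0$ $$\mathbb P\big(\{\omega\in\Omega:\|e^{it\Delta}f^\omega\|_{Y(\mathbb R)}>\lambda\}\big)\le C\exp\!\big(-c\,\lambda^2\,\|f\|_{H^s(\mathbb R^5)}^{-2}\big)$$ (the right-hand side is $0$ if $f=0$); and in particular $\|e^{it\Delta}f^\omega\|_{Y(\mathbb R)}<\infty$ for almost every $\omega\in\Omega$. -/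

import Mathlib

open MeasureTheory ProbabilityTheory FourierTransform
open scoped ENNReal SchwartzMap

noncomputable section

namespace NarrowedWiener

/-- Euclidean space of dimension five. -/
abbrev R5 := EuclideanSpace ℝ (Fin 5)

/-! ### The rescaled cube decomposition of frequency space -/

/-- The box `O_N`. -/
def boxO (N : ℝ) : Set R5 := {ξ | ∀ i, |ξ i| ≤ N}

/-- The shell `Q_N = O_{2N} \ O_N`. -/
def shell (N : ℝ) : Set R5 := boxO (2 * N) \ boxO N

/-- The (open) dyadic cube with side length `h` and lower corner `h m`, `m ∈ ℤ⁵`. -/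
def gridCube (h : ℝ) (m : Fin 5 → ℤ) : Set R5 :=
  {ξ | ∀ i, (m i : ℝ) * h < ξ i ∧ ξ i < ((m i : ℝ) + 1) * h}

/-- The side length `N ^ (-a)` of the cubes in the shell `Q_N`, where `N = 2 ^ k`. -/
def side (a k : ℕ) : ℝ := (((2 : ℝ) ^ k) ^ a)⁻¹

/-- The labels `(k, m)` of all dyadic cubes of side length `N ^ (-a)`, `N = 2 ^ k`, that are
contained in the shell `Q_N`. Different labels give different cubes. -/
def ShellCubes (a : ℕ) : Set (ℕ × (Fin 5 → ℤ)) :=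
  {p | gridCube (side a p.1) p.2 ⊆ shell ((2 : ℝ) ^ p.1)}

/-- Labels for the family of all cubes: `none` is the central cube `O_1`, and `some p` is a cube
in one of the shells. -/
abbrev CubeIndex (a : ℕ) := Option (ShellCubes a)

/-- The cube with a given label. -/
def cube {a : ℕ} : CubeIndex a → Set R5
  | none => boxO 1
  | some p => gridCube (side a p.1.1) p.1.2

/-- The centre of the cube with a given label. -/
def cubeCenter {a : ℕ} : CubeIndex a → R5
  | none => 0
  | some p => WithLp.toLp 2 fun i => ((p.1.2 i : ℝ) + 1 / 2) * side a p.1.1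

/-- The cube with the same centre and twice the diameter. -/
def doubleCube {a : ℕ} (j : CubeIndex a) : Set R5 :=
  {ξ | cubeCenter j + (1 / 2 : ℝ) • (ξ - cubeCenter j) ∈ cube j}

/-- A family of smooth bump functions `φ_j` with `φ_j = 1` on `Q_j` and `φ_j = 0` outside `2 Q_j`
(so each of them has compact support). -/
structure IsBumpFamily (a : ℕ) (φ : CubeIndex a → R5 → ℝ) : Prop where
  smooth : ∀ j, ContDiff ℝ (⊤ : ℕ∞) (φ j)
  nonneg : ∀ j ξ, 0 ≤ φ j ξ
  eq_one : ∀ j, ∀ ξ ∈ cube j, φ j ξ = 1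
  eq_zero : ∀ j, ∀ ξ ∉ doubleCube j, φ j ξ = 0

/-- The partition of unity `ψ_j = φ_j / ∑_k φ_k`; the sum is locally finite. -/
def psi {a : ℕ} (φ : CubeIndex a → R5 → ℝ) (j : CubeIndex a) (ξ : R5) : ℝ :=
  φ j ξ / ∑' k, φ k ξ

/-! ### Fourier multipliers and norms of tempered distributions -/

/-- The Fourier multiplier `f ↦ ℱ⁻¹ (m ℱ f)` for the Fourier transform with kernel
`exp (-i x · ξ)`. Mathlib's transform has the kernel `exp (-2 π i x · η)`, so that `ξ = 2 π η`. -/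
def multiplier (m : R5 → ℂ) : 𝓢'(R5, ℂ) →L[ℂ] 𝓢'(R5, ℂ) :=
  TemperedDistribution.fourierMultiplierCLM ℂ fun η => m ((2 * Real.pi) • η)

/-- The symbol `⟨ξ⟩ ^ σ = (1 + |ξ|²) ^ (σ / 2)`. -/
def bracketPow (σ : ℝ) (ξ : R5) : ℂ := (((1 + ‖ξ‖ ^ 2) ^ (σ / 2) : ℝ) : ℂ)

/-- The operator `⟨∇⟩ ^ σ`. -/
def japanese (σ : ℝ) : 𝓢'(R5, ℂ) →L[ℂ] 𝓢'(R5, ℂ) := multiplier (bracketPow σ)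

/-- The free Schrödinger evolution `exp (i t Δ)`, with symbol `exp (-i t |ξ|²)`. -/
def freeEvolution (t : ℝ) : 𝓢'(R5, ℂ) →L[ℂ] 𝓢'(R5, ℂ) :=
  multiplier fun ξ => Complex.exp (-Complex.I * t * (‖ξ‖ ^ 2 : ℝ))

/-- The `L^r` norm of a tempered distribution: the norm of the function that represents it, and
`∞` if it is not represented by a function in `L^r`. -/
def distNorm (r : ℝ≥0∞) (T : 𝓢'(R5, ℂ)) : ℝ≥0∞ :=
  ⨅ (h : R5 → ℂ) (_ : MemLp h r volume) (_ : ∀ θ : 𝓢(R5, ℂ), T θ = ∫ x, θ x * h x),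
    eLpNorm h r volume

/-- The norm of `H^s(ℝ⁵)`, namely the `L²` norm of `⟨ξ⟩ ^ s f̂(ξ)` for
`f̂(ξ) = (2 π) ^ (-5/2) ∫ f(x) exp (-i x · ξ) dx`. With `ξ = 2 π η` and Mathlib's transform
`𝓕 f`, it is the `L²` norm of `⟨2 π η⟩ ^ s 𝓕 f(η)`: the powers of `2 π` cancel. -/
def sobolevNorm (s : ℝ) (f : 𝓢'(R5, ℂ)) : ℝ≥0∞ :=
  distNorm 2 (TemperedDistribution.smulLeftCLM ℂ
    (fun η : R5 => bracketPow s ((2 * Real.pi) • η)) (𝓕 f))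

/-- The norm of `L^q(ℝ; L^r(ℝ⁵))`, for a finite exponent `q`. -/
def mixedNorm (q : ℝ) (r : ℝ≥0∞) (u : ℝ → 𝓢'(R5, ℂ)) : ℝ≥0∞ :=
  (∫⁻ t : ℝ, distNorm r (u t) ^ q) ^ (1 / q)

/-- The norm of `Y(ℝ)`. -/
def normY (s : ℝ) (a : ℕ) (u : ℝ → 𝓢'(R5, ℂ)) : ℝ≥0∞ :=
  mixedNorm 2 5 (fun t => japanese (s + (a : ℝ) / 2) (u t)) + mixedNorm 4 5 u
    + mixedNorm 4 4 u + mixedNorm 6 3 u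

/-! ### The randomization -/

/-- The frequency projection `□_j f = ℱ⁻¹ (ψ_j ℱ f)`. -/
def boxProj {a : ℕ} (φ : CubeIndex a → R5 → ℝ) (j : CubeIndex a) :
    𝓢'(R5, ℂ) →L[ℂ] 𝓢'(R5, ℂ) :=
  multiplier fun ξ => (psi φ j ξ : ℂ)

/-- The randomization `∑_j z_j □_j f` for the values `z_j = g_j(ω)`, a sum in the space of tempered
distributions. -/
def randomize {a : ℕ} (φ : CubeIndex a → R5 → ℝ) (z : CubeIndex a → ℂ) (f : 𝓢'(R5, ℂ)) :
    𝓢'(R5, ℂ) :=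
  ∑' j, z j • boxProj φ j f

end NarrowedWiener

end

open MeasureTheory ProbabilityTheory FourierTransform
open scoped ENNReal SchwartzMap

noncomputable section

/-! Narrow cubes trade size for derivatives. A free solution whose frequencies lie in a ball of
radius `ρ ≤ 1` obeys an $L^2_tL^5_x$ Strichartz bound with constant of order $ρ^{1/2}$: in dimension
five this norm sits half a derivative above the admissible pair $(2,10/3)$, and Galilean invariance
makes the position of the ball irrelevant. A cube in $Q_N$ has $ρ=N^{-a}$, so the gain $N^{-a/2}$
pays for $\langle\nabla\rangle^{a/2}$. The pairs $(4,5)$, $(4,4)$, $(6,3)$ scale like $1$, $3/4$,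
$1/2$ derivatives, hence also gain at least $ρ^{1/2}$; since $s+a/2\ge 0$, they need no more
derivatives than the first norm. This deterministic part is `exists_mixedPow_evol_le`, resting on
the $TT^*$ argument of `setLIntegral_normFive_sq_le` and on the dispersive bound
`lintegral_locProp_pow_five_le`.

Independent Gaussians then turn sums over cubes into square functions. The $2n$-th moment of $\sum
g_jz_j$ is at most $4\,n!\,(16V\sum|z_j|^2)^n$ (`lintegral_gaussian_sum_pow_le`). For $2n\ge 6\ge
q,r$, Minkowski's inequality moves the norm of $L^{2n}(Ω)$ inside the mixed norm, and a second use
in $L^{q/2}$ and $L^{r/2}$ leaves the $\ell^2$ sum of the deterministic bounds. As $\sum_jψ_j=1$ and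
$ψ_j^2\leψ_j$, that sum is at most a multiple of $\|f\|_{H^s}^2$. Moments of size $n!\,Q^n$ give
Gaussian tails (`measure_gt_le_of_moments`).

The limit distribution is handled through a majorant. The cubes are exhausted by finite sets whose
successive blocks carry mass at most $4^{-k}$ of the total, and the sum over $k$ of the absolute
values of the block sums is bounded in place of the series (`measure_mixedPow_block_gt_le`,
`distNorm_le_blocks`). Neither measurability of the norm of the limit nor almost sure convergence in
the mixed norm is then needed. -/

namespace NarrowedWiener

/-! ### Minkowski's integral inequality for nonnegative functions. -/

section Minkowski

variable {α β : Type*} [MeasurableSpace α] [MeasurableSpace β] {μ : Measure α} {ν : Measure β}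

/-- Hölder for the factorization $f=(f\,w^{(1-p)/p})\cdot w^{(p-1)/p}$. When `w y` bounds the $L^p$
norm of a slice, Tonelli makes the first factor integrate to $\int w$ as well, so Minkowski's
inequality follows without duality. -/
lemma lintegral_le_weighted {f w : β → ℝ≥0∞} (hf : AEMeasurable f ν) (hw : AEMeasurable w ν)
    (hwt : ∀ᵐ y ∂ν, w y ≠ ∞) {p : ℝ} (hp : 1 ≤ p) (h0 : ∀ᵐ y ∂ν, w y = 0 → f y = 0) :
    (∫⁻ y, f y ∂ν) ^ p ≤ (∫⁻ y, f y ^ p * w y ^ (1 - p) ∂ν) * (∫⁻ y, w y ∂ν) ^ (p - 1) := by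
  have hp0 : 0 < p := by linarith
  have h1 : ∫⁻ y, f y ∂ν ≤
      ∫⁻ y, (f y ^ p * w y ^ (1 - p)) ^ (1 / p) * w y ^ (1 - 1 / p) ∂ν := by
    refine lintegral_mono_ae ?_
    filter_upwards [hwt, h0] with y hy hy0
    by_cases hw0 : w y = 0
    · simp [hy0 hw0]
    · rw [ENNReal.mul_rpow_of_nonneg _ _ (by positivity), ← ENNReal.rpow_mul, ← ENNReal.rpow_mul,
        mul_assoc, ← ENNReal.rpow_add _ _ hw0 hy, mul_one_div_cancel hp0.ne']
      have : (1 - p) * (1 / p) + (1 - 1 / p) = 0 := by field_simp; ring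
      rw [this]
      simp
  have h2 := ENNReal.lintegral_mul_norm_pow_le (μ := ν) (f := fun y => f y ^ p * w y ^ (1 - p))
    (g := w) (p := 1 / p) (q := 1 - 1 / p) (by fun_prop) hw (by positivity)
    (by rw [sub_nonneg, div_le_one hp0]; exact hp) (by ring)
  calc (∫⁻ y, f y ∂ν) ^ p
      ≤ ((∫⁻ y, f y ^ p * w y ^ (1 - p) ∂ν) ^ (1 / p) * (∫⁻ y, w y ∂ν) ^ (1 - 1 / p)) ^ p :=
        ENNReal.rpow_le_rpow (h1.trans h2) hp0.le
    _ = _ := by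
        rw [ENNReal.mul_rpow_of_nonneg _ _ hp0.le, ← ENNReal.rpow_mul, ← ENNReal.rpow_mul,
          one_div_mul_cancel hp0.ne', ENNReal.rpow_one]
        congr 2
        field_simp

/-- A form of Minkowski's integral inequality. -/
lemma lintegral_lintegral_rpow_le [SFinite μ] [SFinite ν] {f : α → β → ℝ≥0∞}
    (hf : Measurable (Function.uncurry f)) {w : β → ℝ≥0∞} (hw : Measurable w) {p : ℝ} (hp : 1 ≤ p)
    {D : ℝ≥0∞} (hD : D ≠ 0) (h : ∀ᵐ y ∂ν, ∫⁻ x, f x y ^ p ∂μ ≤ D * w y ^ p) :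
    ∫⁻ x, (∫⁻ y, f x y ∂ν) ^ p ∂μ ≤ D * (∫⁻ y, w y ∂ν) ^ p := by
  have hp0 : 0 < p := by linarith
  by_cases hwt : ∫⁻ y, w y ∂ν = ∞
  · rw [hwt, ENNReal.top_rpow_of_pos hp0, ENNReal.mul_top hD]
    exact le_top
  have hwt' : ∀ᵐ y ∂ν, w y ≠ ∞ := by
    filter_upwards [ae_lt_top hw hwt] with y hy using hy.ne
  -- Where `w` vanishes the slice of `f` vanishes almost everywhere. Exchanging the quantifiers by
  -- Fubini makes the possibly infinite factor `w y ^ (1 - p)` harmless.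
  have hnull : ∀ᵐ x ∂μ, ∀ᵐ y ∂ν, w y = 0 → f x y = 0 := by
    have hset : MeasurableSet {z : α × β | w z.2 = 0 → f z.1 z.2 = 0} := by
      have h1 : MeasurableSet {z : α × β | w z.2 = 0} :=
        (hw.comp measurable_snd) (measurableSet_singleton 0)
      have h2 : MeasurableSet {z : α × β | f z.1 z.2 = 0} := hf (measurableSet_singleton 0)
      exact h1.imp h2
    rw [Measure.ae_ae_comm hset]
    filter_upwards [h] with y hy
    by_cases hy0 : w y = 0
    · rw [hy0, ENNReal.zero_rpow_of_pos hp0, mul_zero, nonpos_iff_eq_zero,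
        lintegral_eq_zero_iff (by fun_prop)] at hy
      filter_upwards [hy] with x hx _
      simpa [hp0, hp0.not_gt] using hx
    · exact Filter.Eventually.of_forall fun x h => absurd h hy0
  calc ∫⁻ x, (∫⁻ y, f x y ∂ν) ^ p ∂μ
      ≤ ∫⁻ x, (∫⁻ y, f x y ^ p * w y ^ (1 - p) ∂ν) * (∫⁻ y, w y ∂ν) ^ (p - 1) ∂μ := by
        refine lintegral_mono_ae ?_
        filter_upwards [hnull] with x hx
        exact lintegral_le_weighted (by fun_prop) (by fun_prop) hwt' hp hx
    _ = (∫⁻ y, (∫⁻ x, f x y ^ p ∂μ) * w y ^ (1 - p) ∂ν) * (∫⁻ y, w y ∂ν) ^ (p - 1) := by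
        rw [lintegral_mul_const _ (by fun_prop), lintegral_lintegral_swap (by fun_prop)]
        congr 1
        refine lintegral_congr fun y => ?_
        rw [lintegral_mul_const _ (by fun_prop)]
    _ ≤ (∫⁻ y, D * w y ∂ν) * (∫⁻ y, w y ∂ν) ^ (p - 1) := by
        gcongr ?_ * _
        refine lintegral_mono_ae ?_
        filter_upwards [h, hwt'] with y hy hyt
        by_cases hy0 : w y = 0
        · rw [hy0, ENNReal.zero_rpow_of_pos hp0, mul_zero, nonpos_iff_eq_zero] at hy
          simp [hy]
        calc _ ≤ D * w y ^ p * w y ^ (1 - p) := by gcongr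
          _ = D * w y := by
            rw [mul_assoc, ← ENNReal.rpow_add _ _ hy0 hyt]; simp
    _ = D * (∫⁻ y, w y ∂ν) ^ p := by
        rw [lintegral_const_mul _ hw, mul_assoc]
        congr 1
        by_cases hz : ∫⁻ y, w y ∂ν = 0
        · rw [hz, ENNReal.zero_rpow_of_pos hp0]; simp
        · conv_lhs => rw [← ENNReal.rpow_one (∫⁻ y, w y ∂ν)]
          rw [← ENNReal.rpow_mul, ← ENNReal.rpow_add _ _ hz hwt]
          simp

/-- The triangle inequality in `L^p` for countable sums. -/
lemma lintegral_tsum_rpow_le [SFinite μ] {ι : Type*} [Countable ι] {f : ι → α → ℝ≥0∞}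
    (hf : ∀ i, Measurable (f i)) {p : ℝ} (hp : 1 ≤ p) {D : ℝ≥0∞} (hD : D ≠ 0) {w : ι → ℝ≥0∞}
    (h : ∀ i, ∫⁻ x, f i x ^ p ∂μ ≤ D * w i ^ p) :
    ∫⁻ x, (∑' i, f i x) ^ p ∂μ ≤ D * (∑' i, w i) ^ p := by
  let _ : MeasurableSpace ι := ⊤
  have : DiscreteMeasurableSpace ι := ⟨fun _ => trivial⟩
  have key := lintegral_lintegral_rpow_le (μ := μ) (ν := (Measure.count : Measure ι))
    (f := fun x i => f i x) (measurable_from_prod_countable_left hf) (w := w)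
    (measurable_of_countable w) hp hD (Filter.Eventually.of_forall h)
  simpa [lintegral_count] using key

end Minkowski

/-! ### Mixed norms of functions -/

section Mixed

variable {α β Ω : Type*} [MeasurableSpace α] [MeasurableSpace β] [MeasurableSpace Ω]
  {μ : Measure α} {ν : Measure β} {P : Measure Ω}

/-- The `q`-th power of the norm of `L^q(μ; L^r(ν))` of a nonnegative function. -/
def mixedPow (μ : Measure α) (ν : Measure β) (q r : ℝ) (u : α → β → ℝ≥0∞) : ℝ≥0∞ :=
  ∫⁻ t, (∫⁻ x, u t x ^ r ∂ν) ^ (q / r) ∂μ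

/-- Minkowski for the squares, in $L^{r/2}$ and then in $L^{q/2}$, which is where `2 ≤ q` and `2 ≤
r` enter. It reduces a square function to an $\ell^2$ sum of individual norms. -/
lemma mixedPow_sqrt_tsum_le [SFinite μ] [SFinite ν] {ι : Type*} [Countable ι]
    {u : ι → α → β → ℝ≥0∞} (hu : ∀ i, Measurable (Function.uncurry (u i))) {q r : ℝ}
    (hq : 2 ≤ q) (hr : 2 ≤ r) (c : ι → ℝ≥0∞) :
    mixedPow μ ν q r (fun t x => (∑' i, c i * u i t x ^ (2 : ℝ)) ^ (1 / 2 : ℝ)) ≤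
      (∑' i, c i * mixedPow μ ν q r (u i) ^ (2 / q)) ^ (q / 2) := by
  have hr0 : 0 < r := by linarith
  have hq0 : 0 < q := by linarith
  unfold mixedPow
  have inner (t : α) : ∫⁻ x, ((∑' i, c i * u i t x ^ (2 : ℝ)) ^ (1 / 2 : ℝ)) ^ r ∂ν ≤
      (∑' i, c i * (∫⁻ x, u i t x ^ r ∂ν) ^ (2 / r)) ^ (r / 2) := by
    have := lintegral_tsum_rpow_le (μ := ν) (f := fun i x => c i * u i t x ^ (2 : ℝ))
      (fun i => by have := hu i; fun_prop) (p := r / 2) (by linarith) one_ne_zero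
      (w := fun i => c i * (∫⁻ x, u i t x ^ r ∂ν) ^ (2 / r)) (fun i => by
        simp only [one_mul]
        rw [ENNReal.mul_rpow_of_nonneg _ _ (by positivity), ← ENNReal.rpow_mul,
          div_mul_div_cancel₀ hr0.ne', div_self two_ne_zero, ENNReal.rpow_one]
        rw [← lintegral_const_mul _ (by have := hu i; fun_prop)]
        refine lintegral_mono fun x => ?_
        rw [ENNReal.mul_rpow_of_nonneg _ _ (by positivity), ← ENNReal.rpow_mul,
          mul_div_cancel₀ _ two_ne_zero])
    simpa only [← ENNReal.rpow_mul, one_div_mul_eq_div, one_mul] using this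
  calc _ ≤ ∫⁻ t, (∑' i, c i * (∫⁻ x, u i t x ^ r ∂ν) ^ (2 / r)) ^ (q / 2) ∂μ := by
        refine lintegral_mono fun t => ?_
        refine (ENNReal.rpow_le_rpow (inner t) (by positivity)).trans_eq ?_
        rw [← ENNReal.rpow_mul]
        congr 1
        field_simp
    _ ≤ _ := by
      have := lintegral_tsum_rpow_le (μ := μ)
        (f := fun i t => c i * (∫⁻ x, u i t x ^ r ∂ν) ^ (2 / r))
        (fun i => by have := hu i; fun_prop)
        (p := q / 2) (by linarith) one_ne_zero
        (w := fun i => c i * (∫⁻ t, (∫⁻ x, u i t x ^ r ∂ν) ^ (q / r) ∂μ) ^ (2 / q)) (fun i => by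
          simp only [one_mul]
          rw [ENNReal.mul_rpow_of_nonneg _ _ (by positivity), ← ENNReal.rpow_mul,
            div_mul_div_cancel₀ hq0.ne', div_self two_ne_zero, ENNReal.rpow_one]
          rw [← lintegral_const_mul _ (by have := hu i; fun_prop)]
          refine lintegral_mono fun x => ?_
          rw [ENNReal.mul_rpow_of_nonneg _ _ (by positivity), ← ENNReal.rpow_mul]
          refine le_of_eq ?_
          congr 2
          field_simp)
      simpa only [one_mul] using this

/-- Two applications of Minkowski bring the norm of $L^p(Ω)$ inside, as `p` exceeds both exponents.
Keeping `p`-th powers instead of norms lets the moment constant `D` pass through unchanged. -/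
lemma lintegral_mixedPow_rpow_le [SFinite μ] [SFinite ν] [SFinite P] {S : Ω → α → β → ℝ≥0∞}
    (hS : Measurable fun z : Ω × α × β => S z.1 z.2.1 z.2.2) {W : α → β → ℝ≥0∞}
    (hW : Measurable (Function.uncurry W)) {q r p : ℝ} (hq : 0 < q) (hr : 0 < r) (hqp : q ≤ p)
    (hrp : r ≤ p) {D : ℝ≥0∞} (hD : D ≠ 0) (h : ∀ t x, ∫⁻ ω, S ω t x ^ p ∂P ≤ D * W t x ^ p) :
    ∫⁻ ω, mixedPow μ ν q r (S ω) ^ (p / q) ∂P ≤ D * mixedPow μ ν q r W ^ (p / q) := by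
  unfold mixedPow
  refine lintegral_lintegral_rpow_le (f := fun ω t => (∫⁻ x, S ω t x ^ r ∂ν) ^ (q / r)) ?_ ?_
    ((one_le_div hq).2 hqp) hD (Filter.Eventually.of_forall fun t => ?_)
  · have : Measurable fun z : (Ω × α) × β => S z.1.1 z.1.2 z.2 ^ r :=
      (hS.comp (by fun_prop : Measurable fun z : (Ω × α) × β => (z.1.1, z.1.2, z.2))).pow_const r
    exact this.lintegral_prod_right'.pow_const _
  · fun_prop
  · simp only [← ENNReal.rpow_mul]
    have e : q / r * (p / q) = p / r := by field_simp
    rw [e]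
    refine lintegral_lintegral_rpow_le (f := fun ω x => S ω t x ^ r) ?_ ?_
      ((one_le_div hr).2 hrp) hD (Filter.Eventually.of_forall fun x => ?_)
    · exact (hS.comp (by fun_prop : Measurable fun z : Ω × β => (z.1, t, z.2))).pow_const r
    · fun_prop
    · simp only [← ENNReal.rpow_mul, mul_div_cancel₀ p hr.ne']
      exact h t x

end Mixed

/-! ### Marcinkiewicz interpolation. -/

section Interpolation

variable {X Y : Type*} [MeasurableSpace X] [MeasurableSpace Y] {μ : Measure X} {ν : Measure Y}

/-- After exchanging the integrals the constraint reads $v\le R=2Kg^{-1/4}$, so the inner integral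
is at most $4R^2\cdot R\cdot g^2=32K^3g^{5/4}$. -/
lemma lintegral_level_sets_le [SFinite μ] {g : X → ℝ} (hg : Measurable g) (hg0 : ∀ x, 0 ≤ g x)
    {K : ℝ} (hK : 0 < K) :
    ∫⁻ v in Set.Ioi (0 : ℝ), ENNReal.ofReal (4 * v ^ 2) *
        ∫⁻ x in {x | g x ≤ (2 * K / v) ^ 4}, ENNReal.ofReal (g x) ^ 2 ∂μ ≤
      ENNReal.ofReal (32 * K ^ 3) * ∫⁻ x, ENNReal.ofReal (g x ^ (5 / 4 : ℝ)) ∂μ := by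
  set E : Set (ℝ × X) := {z | g z.2 ≤ (2 * K / z.1) ^ 4} with hE
  have hEm : MeasurableSet E := measurableSet_le (by fun_prop) (by fun_prop)
  have e1 (v : ℝ) : ∫⁻ x in {x | g x ≤ (2 * K / v) ^ 4}, ENNReal.ofReal (g x) ^ 2 ∂μ =
      ∫⁻ x, E.indicator (fun z => ENNReal.ofReal (g z.2) ^ 2) (v, x) ∂μ := by
    rw [← lintegral_indicator (measurableSet_le (by fun_prop) (by fun_prop))]
    rfl
  have hm : Measurable (E.indicator (fun z : ℝ × X => ENNReal.ofReal (g z.2) ^ 2)) :=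
    Measurable.indicator (by fun_prop) hEm
  calc _ = ∫⁻ v in Set.Ioi (0 : ℝ), (∫⁻ x, ENNReal.ofReal (4 * v ^ 2) *
        E.indicator (fun z => ENNReal.ofReal (g z.2) ^ 2) (v, x) ∂μ) := by
        refine lintegral_congr fun v => ?_
        rw [e1, lintegral_const_mul _ (by fun_prop)]
    _ = ∫⁻ x, (∫⁻ v in Set.Ioi (0 : ℝ), ENNReal.ofReal (4 * v ^ 2) *
        E.indicator (fun z => ENNReal.ofReal (g z.2) ^ 2) (v, x)) ∂μ := by
        rw [lintegral_lintegral_swap]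
        exact (Measurable.mul (by fun_prop) hm).aemeasurable
    _ ≤ ∫⁻ x, ENNReal.ofReal (32 * K ^ 3) * ENNReal.ofReal (g x ^ (5 / 4 : ℝ)) ∂μ := by
        refine lintegral_mono fun x => ?_
        rcases (hg0 x).eq_or_lt with h0 | h0
        · refine le_of_eq_of_le ?_ zero_le
          rw [lintegral_eq_zero_iff (by fun_prop)]
          refine Filter.Eventually.of_forall fun v => ?_
          by_cases hv : (v, x) ∈ E <;> simp [hv, ← h0]
        · set R : ℝ := 2 * K * g x ^ (-(1 / 4) : ℝ) with hR
          have hR0 : 0 < R := by positivity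
          calc _ ≤ ∫⁻ v in Set.Ioi (0 : ℝ), (Set.Ioc 0 R).indicator
                (fun _ => ENNReal.ofReal (4 * R ^ 2) * ENNReal.ofReal (g x) ^ 2) v := by
                refine setLIntegral_mono' measurableSet_Ioi fun v (hv : 0 < v) => ?_
                by_cases hvE : (v, x) ∈ E
                · have hvR : v ≤ R := by
                    have h1 : g x ≤ (2 * K / v) ^ 4 := hvE
                    have h2 : g x ^ (1 / 4 : ℝ) ≤ 2 * K / v := by
                      calc g x ^ (1 / 4 : ℝ) ≤ ((2 * K / v) ^ 4) ^ (1 / 4 : ℝ) := by gcongr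
                        _ = 2 * K / v := by
                          rw [← Real.rpow_natCast, ← Real.rpow_mul (by positivity)]
                          norm_num
                    rw [hR, Real.rpow_neg h0.le]
                    rw [le_div_iff₀ hv] at h2
                    rw [← div_eq_mul_inv, le_div_iff₀ (by positivity)]
                    linarith
                  rw [Set.indicator_of_mem hvE, Set.indicator_of_mem (show v ∈ Set.Ioc 0 R from ⟨hv, hvR⟩)]
                  gcongr
                · rw [Set.indicator_of_notMem hvE]
                  simp
            _ ≤ ∫⁻ v, (Set.Ioc 0 R).indicator
                (fun _ => ENNReal.ofReal (4 * R ^ 2) * ENNReal.ofReal (g x) ^ 2) v :=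
                setLIntegral_le_lintegral _ _
            _ = _ := by
                rw [lintegral_indicator_const measurableSet_Ioc, Real.volume_Ioc,
                  ← ENNReal.ofReal_pow (hg0 x), ← ENNReal.ofReal_mul (by positivity),
                  ← ENNReal.ofReal_mul (by positivity), ← ENNReal.ofReal_mul (by positivity)]
                congr 1
                have : R ^ 3 * g x ^ 2 = (2 * K) ^ 3 * g x ^ (5 / 4 : ℝ) := by
                  rw [hR, mul_pow, ← Real.rpow_natCast (g x ^ _), ← Real.rpow_mul h0.le,
                    mul_assoc, ← Real.rpow_natCast (g x) 2, ← Real.rpow_add h0]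
                  norm_num
                linear_combination 4 * this
    _ = _ := by rw [lintegral_const_mul _ (by fun_prop)]

/-- Marcinkiewicz interpolation between `L¹ → L^∞` and `L² → L²`, at `L^{5/4} → L⁵`. -/
lemma lintegral_pow_five_le [SFinite μ] {g : X → ℝ} (hg : Measurable g) (hg0 : ∀ x, 0 ≤ g x)
    {h : Y → ℝ} (hh : AEMeasurable h ν) (hh0 : ∀ y, 0 ≤ h y) {A N K : ℝ} (hA : 0 ≤ A)
    (hN : ∫⁻ x, ENNReal.ofReal (g x ^ (5 / 4 : ℝ)) ∂μ = ENNReal.ofReal N)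
    (hK : 0 < K) (hAN : A * N ≤ K)
    (hs : ∀ l : ℝ, 0 < l → ∃ h₁ h₂ : Y → ℝ≥0∞, AEMeasurable h₂ ν ∧
      (∀ y, ENNReal.ofReal (h y) ≤ h₁ y + h₂ y) ∧
      (∀ y, h₁ y ≤ ENNReal.ofReal A * ∫⁻ x in {x | l < g x}, ENNReal.ofReal (g x) ∂μ) ∧
      ∫⁻ y, h₂ y ^ 2 ∂ν ≤ ∫⁻ x in {x | g x ≤ l}, ENNReal.ofReal (g x) ^ 2 ∂μ) :
    ∫⁻ y, ENNReal.ofReal (h y ^ (5 : ℝ)) ∂ν ≤ ENNReal.ofReal (160 * K ^ 3 * N) := by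
  rw [lintegral_rpow_eq_lintegral_meas_lt_mul ν (Filter.Eventually.of_forall hh0) hh (by norm_num)]
  have key : ∀ v ∈ Set.Ioi (0 : ℝ), ν {a | v < h a} * ENNReal.ofReal (v ^ ((5 : ℝ) - 1)) ≤
      ENNReal.ofReal (4 * v ^ 2) *
        ∫⁻ x in {x | g x ≤ (2 * K / v) ^ 4}, ENNReal.ofReal (g x) ^ 2 ∂μ := by
    intro v hv
    have hv0 : 0 < v := hv
    -- With this cut, $g\le g^{5/4}\,v/(2K)$ on $\{g>l\}$, so the large part contributes at most
    -- $ANv/(2K)\le v/2$ to `h`. The level `v` is thus exceeded only where the small part is at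
    -- least `v / 2`, and Chebyshev applies there in $L^2$.
    set l : ℝ := (2 * K / v) ^ 4 with hl
    have hl0 : 0 < l := by positivity
    obtain ⟨h₁, h₂, hm, hle, hb1, hb2⟩ := hs l hl0
    have h1 : ∀ y, h₁ y ≤ ENNReal.ofReal (v / 2) := by
      intro y
      have : ∫⁻ x in {x | l < g x}, ENNReal.ofReal (g x) ∂μ ≤
          ENNReal.ofReal (v / (2 * K)) * ENNReal.ofReal N := by
        rw [← hN, ← lintegral_const_mul _ (by fun_prop)]
        refine (setLIntegral_mono' (measurableSet_lt measurable_const hg) fun x hx => ?_).trans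
          (setLIntegral_le_lintegral _ _)
        have hx' : l < g x := hx
        have hgx : 0 < g x := hl0.trans hx'
        rw [← ENNReal.ofReal_mul (by positivity)]
        refine ENNReal.ofReal_le_ofReal ?_
        have e : g x ^ (5 / 4 : ℝ) = g x * g x ^ (1 / 4 : ℝ) := by
          rw [← Real.rpow_one_add' hgx.le (by norm_num)]; norm_num
        have e2 : 2 * K / v ≤ g x ^ (1 / 4 : ℝ) := by
          calc 2 * K / v = l ^ (1 / 4 : ℝ) := by
                rw [hl, ← Real.rpow_natCast, ← Real.rpow_mul (by positivity)]
                norm_num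
            _ ≤ _ := by gcongr
        rw [e]
        calc g x = v / (2 * K) * (g x * (2 * K / v)) := by field_simp
          _ ≤ _ := by gcongr
      refine (hb1 y).trans ((mul_le_mul_right this _).trans ?_)
      rw [← ENNReal.ofReal_mul (by positivity), ← ENNReal.ofReal_mul hA]
      refine ENNReal.ofReal_le_ofReal ?_
      calc A * (v / (2 * K) * N) = (A * N) * (v / (2 * K)) := by ring
        _ ≤ K * (v / (2 * K)) := by gcongr
        _ = v / 2 := by field_simp
    have hsub : {a | v < h a} ⊆ {a | ENNReal.ofReal ((v / 2) ^ 2) ≤ h₂ a ^ 2} := by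
      intro a (ha : v < h a)
      have h3 : ENNReal.ofReal v ≤ ENNReal.ofReal (v / 2) + h₂ a :=
        (ENNReal.ofReal_le_ofReal ha.le).trans ((hle a).trans (by gcongr; exact h1 a))
      have h4 : ENNReal.ofReal (v / 2) ≤ h₂ a := by
        have : ENNReal.ofReal v = ENNReal.ofReal (v / 2) + ENNReal.ofReal (v / 2) := by
          rw [← ENNReal.ofReal_add (by positivity) (by positivity)]; simp
        rw [this] at h3
        exact (ENNReal.add_le_add_iff_left ENNReal.ofReal_ne_top).1 h3
      show ENNReal.ofReal ((v / 2) ^ 2) ≤ h₂ a ^ 2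
      rw [ENNReal.ofReal_pow (by positivity)]
      gcongr
    have hcheb := mul_meas_ge_le_lintegral₀ (μ := ν) (f := fun y => h₂ y ^ 2) (by fun_prop)
      (ENNReal.ofReal ((v / 2) ^ 2))
    calc _ ≤ ν {a | ENNReal.ofReal ((v / 2) ^ 2) ≤ h₂ a ^ 2} * ENNReal.ofReal (v ^ ((5 : ℝ) - 1)) := by
          gcongr
      _ = ENNReal.ofReal (4 * v ^ 2) * (ENNReal.ofReal ((v / 2) ^ 2) *
            ν {a | ENNReal.ofReal ((v / 2) ^ 2) ≤ h₂ a ^ 2}) := by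
          rw [← mul_assoc, ← ENNReal.ofReal_mul (by positivity), mul_comm]
          congr 2
          norm_num
          ring
      _ ≤ _ := by gcongr; exact hcheb.trans hb2
  -- The `5` comes from the layer-cake formula, and $160=5\cdot 32$.
  calc _ ≤ ENNReal.ofReal 5 * (ENNReal.ofReal (32 * K ^ 3) * ENNReal.ofReal N) := by
        gcongr
        refine (setLIntegral_mono' measurableSet_Ioi key).trans ?_
        rw [← hN]
        exact lintegral_level_sets_le hg hg0 hK
    _ = _ := by
        rw [← ENNReal.ofReal_mul (by positivity), ← ENNReal.ofReal_mul (by positivity)]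
        congr 1
        ring

end Interpolation

/-! ### The Fourier transform of integrable functions -/

section Fourier

lemma continuous_fourier {f : R5 → ℂ} (hf : Integrable f) : Continuous (𝓕 f) :=
  VectorFourier.fourierIntegral_continuous Real.continuous_fourierChar
    (by simpa using continuous_inner) hf

lemma continuous_fourierInv {f : R5 → ℂ} (hf : Integrable f) : Continuous (𝓕⁻ f) := by
  have : 𝓕⁻ f = fun x => 𝓕 f (-x) := by
    ext x; exact Real.fourierInv_eq_fourier_neg f x
  rw [this]
  exact (continuous_fourier hf).comp continuous_neg

lemma norm_fourier_le (f : R5 → ℂ) (x : R5) : ‖𝓕 f x‖ ≤ ∫ y, ‖f y‖ :=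
  VectorFourier.norm_fourierIntegral_le_integral_norm _ _ _ _ _

lemma norm_fourierInv_le (f : R5 → ℂ) (x : R5) : ‖𝓕⁻ f x‖ ≤ ∫ y, ‖f y‖ := by
  rw [Real.fourierInv_eq_fourier_neg]; exact norm_fourier_le f _

lemma integral_fourier_mul {f g : R5 → ℂ} (hf : Integrable f) (hg : Integrable g) :
    ∫ x, 𝓕 f x * g x = ∫ x, f x * 𝓕 g x := by
  have := VectorFourier.integral_fourierIntegral_smul_eq_flip (L := innerₗ R5)
    (μ := volume) (ν := volume) Real.continuous_fourierChar
    (by simpa using continuous_inner) hf hg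
  rw [flip_innerₗ] at this
  exact this

lemma integral_fourierInv_mul {f g : R5 → ℂ} (hf : Integrable f) (hg : Integrable g) :
    ∫ x, 𝓕⁻ f x * g x = ∫ x, f x * 𝓕⁻ g x := by
  have h1 : ∀ x, 𝓕⁻ f x = 𝓕 (fun y => f (-y)) x := fun x => by
    rw [Real.fourierInv_eq_fourier_comp_neg]
  have h2 : ∀ x, 𝓕⁻ g x = 𝓕 g (-x) := fun x => Real.fourierInv_eq_fourier_neg g x
  simp_rw [h1, h2]
  rw [integral_fourier_mul hf.comp_neg hg, ← integral_neg_eq_self]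
  simp

/-- Plancherel's theorem for functions in `L¹ ∩ L²`. -/
lemma eLpNorm_fourier {f : R5 → ℂ} (hf : Integrable f) (hf2 : MemLp f 2) :
    eLpNorm (𝓕 f) 2 volume = eLpNorm f 2 volume := by
  -- The Fourier integral and the $L^2$ extension pair equally with test functions, hence agree
  -- almost everywhere; Plancherel is known for the latter.
  have hae : 𝓕 f =ᵐ[volume] (𝓕 (hf2.toLp f) : Lp ℂ 2 (volume : Measure R5)) := by
    refine ae_eq_of_integral_contDiff_smul_eq (continuous_fourier hf).locallyIntegrable
      ((Lp.memLp _).locallyIntegrable (by norm_num)) fun g hg hgc => ?_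
    have hg1 : HasCompactSupport (Complex.ofRealCLM ∘ g) := hgc.comp_left rfl
    have hg2 : ContDiff ℝ (⊤ : ℕ∞) (Complex.ofRealCLM ∘ g) := by fun_prop
    set G : 𝓢(R5, ℂ) := hg1.toSchwartzMap hg2
    have hG : ∀ x, G x = (g x : ℂ) := fun x => rfl
    have e1 : ∫ x, G x * (𝓕 (hf2.toLp f) : Lp ℂ 2 (volume : Measure R5)) x =
        ∫ x, 𝓕 (G : R5 → ℂ) x * f x := by
      have := congrArg (fun T : 𝓢'(R5, ℂ) => T G) (Lp.fourier_toTemperedDistribution_eq (hf2.toLp f))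
      simp only [TemperedDistribution.fourier_apply, Lp.toTemperedDistribution_apply,
        smul_eq_mul] at this
      rw [← this, SchwartzMap.fourier_coe]
      refine integral_congr_ae ?_
      filter_upwards [hf2.coeFn_toLp] with x hx
      rw [hx]
    simp_rw [Complex.real_smul, ← hG]
    rw [e1, integral_fourier_mul G.integrable hf]
  rw [eLpNorm_congr_ae hae]
  have := Lp.norm_fourier_eq (hf2.toLp f)
  rw [Lp.norm_def, Lp.norm_def, ENNReal.toReal_eq_toReal_iff' (Lp.eLpNorm_ne_top _)
    (Lp.eLpNorm_ne_top _)] at this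
  rw [this]
  exact eLpNorm_congr_ae hf2.coeFn_toLp

lemma eLpNorm_fourierInv {f : R5 → ℂ} (hf : Integrable f) (hf2 : MemLp f 2) :
    eLpNorm (𝓕⁻ f) 2 volume = eLpNorm f 2 volume := by
  have : 𝓕⁻ f = 𝓕 f ∘ Neg.neg := by
    ext x; exact Real.fourierInv_eq_fourier_neg f x
  rw [this, eLpNorm_comp_measurePreserving (continuous_fourier hf).aestronglyMeasurable
    (Measure.measurePreserving_neg volume), eLpNorm_fourier hf hf2]

end Fourier

/-! ### The dispersive estimate for the frequency-localized propagator. -/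

/-- The symbol of the free evolution in the variable of Mathlib's Fourier transform. -/
def schr (t : ℝ) (η : R5) : ℂ := Complex.exp (-Complex.I * t * (‖(2 * Real.pi) • η‖ ^ 2 : ℝ))

lemma norm_schr (t : ℝ) (η : R5) : ‖schr t η‖ = 1 := by
  have : -Complex.I * t * (‖(2 * Real.pi) • η‖ ^ 2 : ℝ) =
      ((-(t * ‖(2 * Real.pi) • η‖ ^ 2) : ℝ) : ℂ) * Complex.I := by push_cast; ring
  rw [schr, this, Complex.norm_exp_ofReal_mul_I]

/-- This group law makes the $TT^*$ kernel depend on `t - s` alone. -/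
lemma schr_mul_conj (t s : ℝ) (η : R5) :
    schr t η * (starRingEnd ℂ) (schr s η) = schr (t - s) η := by
  rw [schr, schr, schr, ← Complex.exp_conj, ← Complex.exp_add]
  congr 1
  simp only [map_mul, map_neg, Complex.conj_I, Complex.conj_ofReal]
  push_cast
  ring

lemma continuous_schr : Continuous fun z : ℝ × R5 => schr z.1 z.2 := by
  unfold schr; fun_prop

@[fun_prop]
lemma measurable_schr {α : Type*} [MeasurableSpace α] {f : α → ℝ} {g : α → R5} (hf : Measurable f)
    (hg : Measurable g) : Measurable fun a => schr (f a) (g a) :=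
  continuous_schr.measurable.comp (hf.prodMk hg)

/-- A Gaussian weight of width `ρ`. -/
def gaussWeight (η₀ : R5) (ρ : ℝ) (η : R5) : ℝ := Real.exp (-(‖η - η₀‖ ^ 2 / ρ ^ 2))

lemma gaussWeight_pos (η₀ : R5) (ρ : ℝ) (η : R5) : 0 < gaussWeight η₀ ρ η := Real.exp_pos _

lemma gaussWeight_le_one (η₀ : R5) (ρ : ℝ) (η : R5) : gaussWeight η₀ ρ η ≤ 1 :=
  Real.exp_le_one_iff.2 (by rw [neg_nonpos]; positivity)

lemma continuous_gaussWeight (η₀ : R5) (ρ : ℝ) : Continuous (gaussWeight η₀ ρ) := by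
  unfold gaussWeight; fun_prop

lemma integrable_gaussWeight (η₀ : R5) {ρ : ℝ} (hρ : 0 < ρ) : Integrable (gaussWeight η₀ ρ) := by
  have h := (GaussianFourier.integrable_cexp_neg_mul_sq_norm_add (b := ((1 / ρ ^ 2 : ℝ) : ℂ)) (V := R5)
    (by rw [Complex.ofReal_re]; positivity) 0 0).norm.comp_sub_right η₀
  refine h.congr (Filter.Eventually.of_forall fun η => ?_)
  simp only [gaussWeight, Complex.norm_exp]
  congr 1
  simp [← Complex.ofReal_pow]
  ring

/-- The parameter of the Gaussian integral for the localized Schrödinger kernel. -/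
def kerParam (ρ τ : ℝ) : ℂ := ((1 / ρ ^ 2 : ℝ) : ℂ) + ((4 * Real.pi ^ 2 * τ : ℝ) : ℂ) * Complex.I

lemma kerParam_re (ρ τ : ℝ) : (kerParam ρ τ).re = 1 / ρ ^ 2 := by
  rw [kerParam, Complex.add_re, Complex.ofReal_re, Complex.re_ofReal_mul]; simp

lemma kerParam_ne_zero {ρ : ℝ} (hρ : 0 < ρ) (τ : ℝ) : kerParam ρ τ ≠ 0 := by
  intro h
  have := congrArg Complex.re h
  rw [kerParam_re] at this
  have : 0 < 1 / ρ ^ 2 := by positivity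
  simp_all

/-- A Gaussian cutoff makes the kernel an explicit Gaussian integral. Moving the centre to the
origin costs a unimodular factor and a translation of `x` (Galilean invariance), so the bound is
uniform in `η₀` and `x`. -/
lemma norm_integral_kernel_le (η₀ : R5) {ρ : ℝ} (hρ : 0 < ρ) (τ : ℝ) (x : R5) :
    ‖𝓕 (fun η => (gaussWeight η₀ ρ η : ℂ) * schr τ η) x‖ ≤
      (Real.pi / ‖kerParam ρ τ‖) ^ (5 / 2 : ℝ) := by
  have hb : 0 < (kerParam ρ τ).re := by rw [kerParam_re]; positivity
  have hb0 := kerParam_ne_zero hρ τ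
  set b := kerParam ρ τ with hbdef
  set w : R5 := -(x + (4 * Real.pi * τ) • η₀) with hw
  set c₀ : ℂ := Complex.exp ((-(4 * Real.pi ^ 2 * τ * ‖η₀‖ ^ 2 + 2 * Real.pi * inner ℝ x η₀) : ℝ) * Complex.I)
    with hc₀
  have e : 𝓕 (fun η => (gaussWeight η₀ ρ η : ℂ) * schr τ η) x =
      c₀ * ∫ v : R5, Complex.exp (-b * ‖v‖ ^ 2 + (2 * Real.pi * Complex.I) * (inner ℝ w v : ℝ)) := by
    rw [Real.fourier_eq', ← integral_add_right_eq_self _ η₀, ← integral_const_mul]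
    refine integral_congr_ae (Filter.Eventually.of_forall fun v => ?_)
    simp only [smul_eq_mul, gaussWeight, schr, hc₀, Complex.ofReal_exp]
    rw [← Complex.exp_add, ← Complex.exp_add, ← Complex.exp_add]
    congr 1
    have h1 : ‖(2 * Real.pi) • (v + η₀)‖ ^ 2 =
        4 * Real.pi ^ 2 * (‖v‖ ^ 2 + 2 * inner ℝ η₀ v + ‖η₀‖ ^ 2) := by
      rw [norm_smul, mul_pow, norm_add_sq_real, real_inner_comm]
      simp only [Real.norm_eq_abs, sq_abs]; ring
    have h2 : inner ℝ w v = -(inner ℝ x v + 4 * Real.pi * τ * inner ℝ η₀ v) := by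
      rw [hw, inner_neg_left, inner_add_left, inner_smul_left]; simp
    have h3 : inner ℝ (v + η₀) x = inner ℝ x v + inner ℝ x η₀ := by
      rw [inner_add_left, real_inner_comm, real_inner_comm x η₀]
    rw [h1, h2, h3, hbdef, kerParam, add_sub_cancel_right]
    push_cast
    ring
  rw [e, GaussianFourier.integral_cexp_neg_mul_sq_norm_add hb, norm_mul, hc₀,
    Complex.norm_exp_ofReal_mul_I, one_mul, norm_mul]
  have h5 : ((Module.finrank ℝ R5 : ℂ) / 2) = ((5 / 2 : ℝ) : ℂ) := by simp
  have hz : (Real.pi : ℂ) / b ≠ 0 := div_ne_zero (by exact_mod_cast Real.pi_ne_zero) hb0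
  rw [h5, Complex.norm_cpow_of_ne_zero hz]
  simp only [Complex.ofReal_re, Complex.ofReal_im, mul_zero, Real.exp_zero, div_one, norm_div,
    Complex.norm_real, Real.norm_eq_abs, abs_of_pos Real.pi_pos]
  -- The remaining exponential has exponent $-π^2|w|^2/b$, whose real part is nonpositive because
  -- $\operatorname{Re} b>0$.
  refine mul_le_of_le_one_right (by positivity) ?_
  rw [Complex.norm_exp]
  refine Real.exp_le_one_iff.2 ?_
  have : (2 * Real.pi * Complex.I) ^ 2 * (‖w‖ : ℂ) ^ 2 / (4 * b) =
      ((-(Real.pi ^ 2 * ‖w‖ ^ 2) : ℝ) : ℂ) * b⁻¹ := by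
    rw [mul_pow, Complex.I_sq]; push_cast; field_simp; ring
  rw [this, Complex.re_ofReal_mul, Complex.inv_re]
  have : 0 ≤ Real.pi ^ 2 * ‖w‖ ^ 2 * (b.re / Complex.normSq b) :=
    mul_nonneg (by positivity) (div_nonneg hb.le (Complex.normSq_nonneg _))
  linarith

/-- The frequency-localized propagator. -/
def locProp (η₀ : R5) (ρ τ : ℝ) (g : R5 → ℂ) : R5 → ℂ :=
  𝓕 (fun η => (gaussWeight η₀ ρ η : ℂ) * schr τ η * 𝓕⁻ g η)

lemma integrable_symbol (η₀ : R5) {ρ : ℝ} (hρ : 0 < ρ) (τ : ℝ) :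
    Integrable fun η => (gaussWeight η₀ ρ η : ℂ) * schr τ η :=
  (integrable_gaussWeight η₀ hρ).ofReal.mul_bdd (c := 1)
    (by fun_prop : Measurable (schr τ)).aestronglyMeasurable
    (Filter.Eventually.of_forall fun η => (norm_schr τ η).le)

lemma norm_symbol_le (η₀ : R5) (ρ τ : ℝ) (η : R5) :
    ‖(gaussWeight η₀ ρ η : ℂ) * schr τ η‖ ≤ 1 := by
  rw [norm_mul, norm_schr, mul_one, Complex.norm_real, Real.norm_of_nonneg (gaussWeight_pos _ _ _).le]
  exact gaussWeight_le_one _ _ _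

lemma integrable_symbol_mul (η₀ : R5) {ρ : ℝ} (hρ : 0 < ρ) (τ : ℝ) {g : R5 → ℂ}
    (hg : Integrable g) :
    Integrable fun η => (gaussWeight η₀ ρ η : ℂ) * schr τ η * 𝓕⁻ g η :=
  (integrable_symbol η₀ hρ τ).mul_bdd (continuous_fourierInv hg).aestronglyMeasurable
    (Filter.Eventually.of_forall fun η => norm_fourierInv_le g η)

/-- The $L^1\to L^\infty$ endpoint. The propagator is convolution with the kernel: the character at
`y` is absorbed into the symbol, and the inverse transform is moved from `g` to it. -/
lemma norm_locProp_le (η₀ : R5) {ρ : ℝ} (hρ : 0 < ρ) (τ : ℝ) {g : R5 → ℂ} (hg : Integrable g)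
    (y : R5) :
    ‖locProp η₀ ρ τ g y‖ ≤ (Real.pi / ‖kerParam ρ τ‖) ^ (5 / 2 : ℝ) * ∫ x, ‖g x‖ := by
  set m : R5 → ℂ := fun η => (gaussWeight η₀ ρ η : ℂ) * schr τ η with hm
  have hmi : Integrable m := integrable_symbol η₀ hρ τ
  set my : R5 → ℂ := fun η => (Real.fourierChar (-inner ℝ η y) : ℂ) * m η with hmy
  have hmyi : Integrable my := hmi.bdd_mul (c := 1)
    (by fun_prop : Continuous fun η : R5 => (Real.fourierChar (-inner ℝ η y) : ℂ)).aestronglyMeasurable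
    (Filter.Eventually.of_forall fun η => (Circle.norm_coe _).le)
  have h1 : locProp η₀ ρ τ g y = ∫ x, 𝓕⁻ my x * g x := by
    rw [integral_fourierInv_mul hmyi hg, locProp, Real.fourier_eq]
    refine integral_congr_ae (Filter.Eventually.of_forall fun η => ?_)
    simp only [hmy, hm, Circle.smul_def, smul_eq_mul]
    ring
  have h2 (x : R5) : 𝓕⁻ my x = 𝓕 m (y - x) := by
    rw [Real.fourierInv_eq, Real.fourier_eq]
    refine integral_congr_ae (Filter.Eventually.of_forall fun η => ?_)
    simp only [hmy, Circle.smul_def, smul_eq_mul]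
    rw [← mul_assoc, ← Circle.coe_mul, ← AddChar.map_add_eq_mul, inner_sub_right]
    congr 3
    ring
  rw [h1, ← integral_const_mul]
  refine norm_integral_le_of_norm_le (hg.norm.const_mul _) (Filter.Eventually.of_forall fun x => ?_)
  rw [norm_mul, h2]
  gcongr
  exact norm_integral_kernel_le η₀ hρ τ _

lemma memLp_fourierInv {g : R5 → ℂ} (hg : Integrable g) (hg2 : MemLp g 2) :
    MemLp (𝓕⁻ g) 2 volume :=
  ⟨(continuous_fourierInv hg).aestronglyMeasurable, by
    rw [eLpNorm_fourierInv hg hg2]; exact hg2.2⟩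

/-- The $L^2\to L^2$ endpoint: Plancherel, with a symbol of modulus at most one. -/
lemma eLpNorm_locProp_le (η₀ : R5) {ρ : ℝ} (hρ : 0 < ρ) (τ : ℝ) {g : R5 → ℂ} (hg : Integrable g)
    (hg2 : MemLp g 2) : eLpNorm (locProp η₀ ρ τ g) 2 volume ≤ eLpNorm g 2 volume := by
  have hi := integrable_symbol_mul η₀ hρ τ hg
  have hb : ∀ η, ‖(gaussWeight η₀ ρ η : ℂ) * schr τ η * 𝓕⁻ g η‖ ≤ ‖𝓕⁻ g η‖ := fun η => by
    rw [norm_mul]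
    exact mul_le_of_le_one_left (norm_nonneg _) (norm_symbol_le η₀ ρ τ η)
  have h2 : MemLp (fun η => (gaussWeight η₀ ρ η : ℂ) * schr τ η * 𝓕⁻ g η) 2 volume :=
    (memLp_fourierInv hg hg2).mono hi.aestronglyMeasurable (Filter.Eventually.of_forall hb)
  rw [locProp, eLpNorm_fourier hi h2, ← eLpNorm_fourierInv hg hg2]
  exact eLpNorm_mono hb

lemma fourier_add_apply {f g : R5 → ℂ} (hf : Integrable f) (hg : Integrable g) (y : R5) :
    𝓕 (fun x => f x + g x) y = 𝓕 f y + 𝓕 g y := by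
  simp_rw [Real.fourier_eq, smul_add]
  exact integral_add ((Real.fourierIntegral_convergent_iff y).2 hf)
    ((Real.fourierIntegral_convergent_iff y).2 hg)

lemma locProp_add (η₀ : R5) {ρ : ℝ} (hρ : 0 < ρ) (τ : ℝ) {g g' : R5 → ℂ} (hg : Integrable g)
    (hg' : Integrable g') (y : R5) :
    locProp η₀ ρ τ (fun x => g x + g' x) y = locProp η₀ ρ τ g y + locProp η₀ ρ τ g' y := by
  have h1 : 𝓕⁻ (fun x => g x + g' x) = fun η => 𝓕⁻ g η + 𝓕⁻ g' η := by
    ext η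
    simp_rw [Real.fourierInv_eq_fourier_neg]
    exact fourier_add_apply hg hg' (-η)
  unfold locProp
  rw [h1]
  simp_rw [mul_add]
  exact fourier_add_apply (integrable_symbol_mul η₀ hρ τ hg) (integrable_symbol_mul η₀ hρ τ hg') y

lemma lintegral_enorm_sq_eq {α : Type*} [MeasurableSpace α] (μ : Measure α) (f : α → ℂ) :
    ∫⁻ x, ‖f x‖ₑ ^ 2 ∂μ = eLpNorm f 2 μ ^ 2 := by
  have := eLpNorm_nnreal_pow_eq_lintegral (μ := μ) (f := f) (p := 2) (by norm_num)
  simpa using this.symm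

/-- The dispersive estimate `L^{5/4} → L⁵` for the localized propagator. -/
lemma lintegral_locProp_pow_five_le (η₀ : R5) {ρ : ℝ} (hρ : 0 < ρ) (τ : ℝ) {g : R5 → ℂ}
    (hgm : Measurable g) (hg : Integrable g) (hg2 : MemLp g 2) {N : ℝ} (hN0 : 0 < N)
    (hN : ∫⁻ x, ENNReal.ofReal (‖g x‖ ^ (5 / 4 : ℝ)) = ENNReal.ofReal N) :
    ∫⁻ y, ENNReal.ofReal (‖locProp η₀ ρ τ g y‖ ^ (5 : ℝ)) ≤
      ENNReal.ofReal (160 * ((Real.pi / ‖kerParam ρ τ‖) ^ (5 / 2 : ℝ) * N) ^ 3 * N) := by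
  have hA : 0 < (Real.pi / ‖kerParam ρ τ‖) ^ (5 / 2 : ℝ) := by
    have := kerParam_ne_zero hρ τ
    have := Real.pi_pos
    positivity
  refine lintegral_pow_five_le hgm.norm (fun x => norm_nonneg _)
    (continuous_fourier (integrable_symbol_mul η₀ hρ τ hg)).measurable.norm.aemeasurable
    (fun y => norm_nonneg _) hA.le hN (mul_pos hA hN0) le_rfl fun l hl => ?_
  have hs1 : MeasurableSet {x | l < ‖g x‖} := measurableSet_lt measurable_const hgm.norm
  have hs2 : MeasurableSet {x | ‖g x‖ ≤ l} := measurableSet_le hgm.norm measurable_const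
  set g₁ := {x | l < ‖g x‖}.indicator g with hg₁
  set g₂ := {x | ‖g x‖ ≤ l}.indicator g with hg₂
  have hg1i : Integrable g₁ := hg.indicator hs1
  have hg2i : Integrable g₂ := hg.indicator hs2
  have hsum : g = fun x => g₁ x + g₂ x := by
    ext x
    by_cases hx : l < ‖g x‖
    · simp [hg₁, hg₂, hx]
    · simp [hg₁, hg₂, hx, not_lt.1 hx]
  refine ⟨fun y => ENNReal.ofReal ‖locProp η₀ ρ τ g₁ y‖, fun y => ENNReal.ofReal ‖locProp η₀ ρ τ g₂ y‖,
    (continuous_fourier (integrable_symbol_mul η₀ hρ τ hg2i)).measurable.norm.ennreal_ofReal.aemeasurable,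
    fun y => ?_, fun y => ?_, ?_⟩
  · rw [← ENNReal.ofReal_add (norm_nonneg _) (norm_nonneg _)]
    refine ENNReal.ofReal_le_ofReal ?_
    have : locProp η₀ ρ τ g y = locProp η₀ ρ τ g₁ y + locProp η₀ ρ τ g₂ y := by
      rw [← locProp_add η₀ hρ τ hg1i hg2i, ← hsum]
    exact (congrArg norm this).trans_le (norm_add_le _ _)
  · refine (ENNReal.ofReal_le_ofReal (norm_locProp_le η₀ hρ τ hg1i y)).trans_eq ?_
    rw [ENNReal.ofReal_mul hA.le, ofReal_integral_eq_lintegral_ofReal hg1i.norm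
      (Filter.Eventually.of_forall fun x => norm_nonneg _), ← lintegral_indicator hs1]
    congr 1
    refine lintegral_congr fun x => ?_
    by_cases hx : l < ‖g x‖ <;> simp [hg₁, hx]
  · have h := eLpNorm_locProp_le η₀ hρ τ hg2i (hg2.indicator hs2)
    simp_rw [ofReal_norm]
    rw [lintegral_enorm_sq_eq]
    refine (pow_le_pow_left₀ zero_le h 2).trans_eq ?_
    rw [← lintegral_enorm_sq_eq, ← lintegral_indicator hs2]
    refine lintegral_congr fun x => ?_
    by_cases hx : ‖g x‖ ≤ l <;> simp [hg₂, hx]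

/-- The bilinear form of the dispersive estimate. -/
lemma norm_integral_symbol_mul_le (η₀ : R5) {ρ : ℝ} (hρ : 0 < ρ) (τ : ℝ) {g g' : R5 → ℂ}
    (hgm : Measurable g) (hg : Integrable g) (hg2 : MemLp g 2) (hgm' : Measurable g')
    (hg' : Integrable g') {N N' : ℝ} (hN0 : 0 < N)
    (hN : ∫⁻ x, ENNReal.ofReal (‖g x‖ ^ (5 / 4 : ℝ)) = ENNReal.ofReal N)
    (hN0' : 0 < N')
    (hN' : ∫⁻ x, ENNReal.ofReal (‖g' x‖ ^ (5 / 4 : ℝ)) = ENNReal.ofReal N') :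
    ‖∫ η, (gaussWeight η₀ ρ η : ℂ) * schr τ η * 𝓕⁻ g η * (starRingEnd ℂ) (𝓕⁻ g' η)‖ ≤
      160 ^ (1 / 5 : ℝ) * (Real.pi / ‖kerParam ρ τ‖) ^ (3 / 2 : ℝ) * N ^ (4 / 5 : ℝ) *
        N' ^ (4 / 5 : ℝ) := by
  set A := (Real.pi / ‖kerParam ρ τ‖) with hA
  have hA0 : 0 ≤ A := by have := Real.pi_pos; positivity
  have hconj (η : R5) : (starRingEnd ℂ) (𝓕⁻ g' η) = 𝓕 (fun x => (starRingEnd ℂ) (g' x)) η := by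
    rw [Real.fourierInv_eq, Real.fourier_eq, ← integral_conj]
    refine integral_congr_ae (Filter.Eventually.of_forall fun x => ?_)
    simp only [Circle.smul_def, smul_eq_mul, map_mul]
    rw [← Circle.coe_inv_eq_conj, AddChar.map_neg_eq_inv]
  have hci : Integrable fun x => (starRingEnd ℂ) (g' x) :=
    (LinearIsometryEquiv.integrable_comp_iff Complex.conjLIE).2 hg'
  have e1 : ∫ η, (gaussWeight η₀ ρ η : ℂ) * schr τ η * 𝓕⁻ g η * (starRingEnd ℂ) (𝓕⁻ g' η) =
      ∫ y, locProp η₀ ρ τ g y * (starRingEnd ℂ) (g' y) := by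
    rw [locProp, integral_fourier_mul (integrable_symbol_mul η₀ hρ τ hg) hci]
    simp_rw [hconj]
  rw [e1, ← ENNReal.ofReal_le_ofReal_iff (by positivity), ofReal_norm]
  refine (enorm_integral_le_lintegral_enorm _).trans ?_
  have hm := (continuous_fourier (integrable_symbol_mul η₀ hρ τ hg)).measurable
  have hol := ENNReal.lintegral_mul_le_Lp_mul_Lq volume (p := 5) (q := 5 / 4)
    (by constructor <;> norm_num) (f := fun y => ‖locProp η₀ ρ τ g y‖ₑ) (g := fun y => ‖g' y‖ₑ)
    hm.enorm.aemeasurable hgm'.enorm.aemeasurable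
  have e2 : ∀ (f : R5 → ℂ) {p : ℝ}, 0 ≤ p → ∫⁻ y, ‖f y‖ₑ ^ p =
      ∫⁻ y, ENNReal.ofReal (‖f y‖ ^ p) := fun f p hp => by
    refine lintegral_congr fun y => ?_
    rw [← ENNReal.ofReal_rpow_of_nonneg (norm_nonneg _) hp, ofReal_norm]
  rw [e2 _ (by norm_num), e2 _ (by norm_num), hN'] at hol
  have h5 := lintegral_locProp_pow_five_le η₀ hρ τ hgm hg hg2 hN0 hN
  calc _ = ∫⁻ y, ‖locProp η₀ ρ τ g y‖ₑ * ‖g' y‖ₑ := by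
        refine lintegral_congr fun y => ?_
        rw [enorm_mul, RCLike.enorm_conj]
    _ ≤ _ := hol
    _ ≤ ENNReal.ofReal (160 * (A ^ (5 / 2 : ℝ) * N) ^ 3 * N) ^ (1 / 5 : ℝ) *
        ENNReal.ofReal N' ^ (1 / (5 / 4) : ℝ) := by
        gcongr
    _ = _ := by
        rw [ENNReal.ofReal_rpow_of_nonneg (by positivity) (by norm_num),
          ENNReal.ofReal_rpow_of_nonneg (by positivity) (by norm_num),
          ← ENNReal.ofReal_mul (by positivity)]
        congr 2
        · rw [mul_assoc, mul_pow, mul_assoc, ← pow_succ, Real.mul_rpow (by positivity) (by positivity),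
            Real.mul_rpow (by positivity) (by positivity), ← Real.rpow_natCast, ← Real.rpow_natCast,
            ← Real.rpow_mul hA0, ← Real.rpow_mul (by positivity), ← Real.rpow_mul (by positivity)]
          norm_num
          ring
        · norm_num

lemma measurable_fourierInv_param {α : Type*} [MeasurableSpace α] {f : α → R5 → ℂ}
    (hf : Measurable (Function.uncurry f)) : Measurable fun z : α × R5 => 𝓕⁻ (f z.1) z.2 := by
  simp_rw [Real.fourierInv_eq]
  have h0 : Continuous fun r : ℝ => (Real.fourierChar r : ℂ) := by fun_prop
  have hi : Measurable fun z : (α × R5) × R5 => inner ℝ z.2 z.1.2 := by fun_prop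
  have h1 : Measurable fun z : (α × R5) × R5 => (Real.fourierChar (inner ℝ z.2 z.1.2) : ℂ) :=
    h0.measurable.comp hi
  have h2 : Measurable fun z : (α × R5) × R5 => f z.1.1 z.2 :=
    hf.comp (by fun_prop : Measurable fun z : (α × R5) × R5 => (z.1.1, z.2))
  exact ((h1.mul h2).stronglyMeasurable.integral_prod_right').measurable

/-! ### Free solutions given by their Fourier data. -/

/-- The solution of the free Schrödinger equation whose Fourier transform at time `0` is `F`. -/
def evol (F : R5 → ℂ) (t : ℝ) (x : R5) : ℂ := 𝓕⁻ (fun η => schr t η * F η) x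

lemma measurable_evol {F : R5 → ℂ} (hF : Measurable F) :
    Measurable fun z : ℝ × R5 => evol F z.1 z.2 :=
  measurable_fourierInv_param (f := fun t η => schr t η * F η)
    (by unfold Function.uncurry; fun_prop)

lemma integrable_schr_mul {F : R5 → ℂ} (hF : Integrable F) (t : ℝ) :
    Integrable fun η => schr t η * F η :=
  hF.bdd_mul (c := 1) (by fun_prop : Measurable (schr t)).aestronglyMeasurable
    (Filter.Eventually.of_forall fun η => (norm_schr t η).le)

lemma norm_evol_le (F : R5 → ℂ) (t : ℝ) (x : R5) : ‖evol F t x‖ ≤ ∫ η, ‖F η‖ := by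
  refine (norm_fourierInv_le _ x).trans_eq ?_
  simp [norm_schr]

lemma lintegral_evol_sq {F : R5 → ℂ} (hF : Integrable F) (hF2 : MemLp F 2) (t : ℝ) :
    ∫⁻ x, ‖evol F t x‖ₑ ^ 2 = ∫⁻ η, ‖F η‖ₑ ^ 2 := by
  have e : ∀ η, ‖schr t η * F η‖ = ‖F η‖ := fun η => by rw [norm_mul, norm_schr, one_mul]
  have h2 : MemLp (fun η => schr t η * F η) 2 volume :=
    hF2.mono (integrable_schr_mul hF t).aestronglyMeasurable
      (Filter.Eventually.of_forall fun η => (e η).le)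
  rw [lintegral_enorm_sq_eq, lintegral_enorm_sq_eq]
  unfold evol
  rw [eLpNorm_fourierInv (integrable_schr_mul hF t) h2,
    eLpNorm_congr_norm_ae (Filter.Eventually.of_forall e)]

/-! ### The `TT*` argument -/

/-- The square of the time integral is written as a double integral and Fubini puts the frequency
integral inside. The bound `B` and the finite measure of `I` serve only integrability and do not
enter the estimate. -/
lemma lintegral_weight_mul_sq_le {A : ℝ → R5 → ℂ} (hA : Measurable (Function.uncurry A))
    {I : Set ℝ} (hI : MeasurableSet I) (hIf : volume I ≠ ∞) {B : ℝ} (hB : ∀ t η, ‖A t η‖ ≤ B)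
    (hA0 : ∀ t ∉ I, ∀ η, A t η = 0) {w : R5 → ℝ} (hw : Integrable w) (hw0 : ∀ η, 0 ≤ w η)
    {κ : ℝ → ℝ → ℝ≥0∞}
    (hκ : ∀ t s, ‖∫ η, (w η : ℂ) * (A t η * (starRingEnd ℂ) (A s η))‖ₑ ≤ κ t s) :
    ∫⁻ η, ENNReal.ofReal (w η) * ‖∫ t, A t η‖ₑ ^ 2 ≤ ∫⁻ z : ℝ × ℝ, κ z.1 z.2 := by
  have hB0 : 0 ≤ B := (norm_nonneg _).trans (hB 0 0)
  have hind : Integrable (I.indicator fun _ => B) := by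
    rw [integrable_indicator_iff hI]; exact integrableOn_const hIf
  have hAle : ∀ t η, ‖A t η‖ ≤ I.indicator (fun _ => B) t := fun t η => by
    by_cases ht : t ∈ I
    · simpa [ht] using hB t η
    · simp [ht, hA0 t ht η]
  have hind0 : ∀ t, 0 ≤ I.indicator (fun _ => B) t := Set.indicator_nonneg fun _ _ => hB0
  have hsq (η : R5) : ((‖∫ t, A t η‖ ^ 2 : ℝ) : ℂ) =
      ∫ z : ℝ × ℝ, A z.1 η * (starRingEnd ℂ) (A z.2 η) := by
    rw [Measure.volume_eq_prod, integral_prod_mul (fun t => A t η) (fun s => (starRingEnd ℂ) (A s η)),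
      integral_conj, Complex.mul_conj, Complex.normSq_eq_norm_sq]
  have hmΦ : Measurable fun z : R5 × ℝ × ℝ => A z.2.1 z.1 * (starRingEnd ℂ) (A z.2.2 z.1) := by
    have h1 : Measurable fun z : R5 × ℝ × ℝ => A z.2.1 z.1 :=
      hA.comp (by fun_prop : Measurable fun z : R5 × ℝ × ℝ => (z.2.1, z.1))
    have h2 : Measurable fun z : R5 × ℝ × ℝ => A z.2.2 z.1 :=
      hA.comp (by fun_prop : Measurable fun z : R5 × ℝ × ℝ => (z.2.2, z.1))
    exact h1.mul (Complex.continuous_conj.measurable.comp h2)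
  have hΦ : Integrable (fun z : R5 × ℝ × ℝ =>
      (w z.1 : ℂ) * (A z.2.1 z.1 * (starRingEnd ℂ) (A z.2.2 z.1))) (volume.prod volume) := by
    refine (hw.mul_prod (hind.mul_prod hind)).mono' ?_ (Filter.Eventually.of_forall fun z => ?_)
    · exact (hw.ofReal (𝕜 := ℂ)).aestronglyMeasurable.comp_fst.mul hmΦ.aestronglyMeasurable
    · rw [norm_mul, norm_mul, Complex.norm_real, Real.norm_of_nonneg (hw0 _), RCLike.norm_conj]
      gcongr
      · exact hw0 _
      · exact hind0 _
      · exact hAle _ _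
      · exact hAle _ _
  have hmA : StronglyMeasurable fun η => ∫ t, A t η :=
    (hA.comp measurable_swap).stronglyMeasurable.integral_prod_right'
  have hJ : Integrable fun η => w η * ‖∫ t, A t η‖ ^ 2 := by
    refine hw.mul_bdd (c := (∫ t, I.indicator (fun _ => B) t) ^ 2)
      ((hmA.norm.measurable.pow_const 2).aestronglyMeasurable)
      (Filter.Eventually.of_forall fun η => ?_)
    rw [norm_pow, norm_norm]
    gcongr
    exact norm_integral_le_of_norm_le hind (Filter.Eventually.of_forall fun t => hAle t η)
  calc ∫⁻ η, ENNReal.ofReal (w η) * ‖∫ t, A t η‖ₑ ^ 2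
      = ∫⁻ η, ENNReal.ofReal (w η * ‖∫ t, A t η‖ ^ 2) := by
        refine lintegral_congr fun η => ?_
        rw [ENNReal.ofReal_mul (hw0 η), ENNReal.ofReal_pow (norm_nonneg _), ofReal_norm]
    _ = ENNReal.ofReal (∫ η, w η * ‖∫ t, A t η‖ ^ 2) :=
        (ofReal_integral_eq_lintegral_ofReal hJ
          (Filter.Eventually.of_forall fun η => mul_nonneg (hw0 η) (by positivity))).symm
    _ = ‖((∫ η, w η * ‖∫ t, A t η‖ ^ 2 : ℝ) : ℂ)‖ₑ := by
        rw [← ofReal_norm, Complex.norm_real, Real.norm_of_nonneg]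
        exact integral_nonneg fun η => mul_nonneg (hw0 η) (by positivity)
    _ = ‖∫ z : ℝ × ℝ, ∫ η, (w η : ℂ) * (A z.1 η * (starRingEnd ℂ) (A z.2 η))‖ₑ := by
        rw [← integral_complex_ofReal, ← integral_integral_swap hΦ]
        congr 1
        refine integral_congr_ae (Filter.Eventually.of_forall fun η => ?_)
        simp only [Complex.ofReal_mul]
        rw [hsq, integral_const_mul]
    _ ≤ ∫⁻ z : ℝ × ℝ, ‖∫ η, (w η : ℂ) * (A z.1 η * (starRingEnd ℂ) (A z.2 η))‖ₑ :=
        enorm_integral_le_lintegral_enorm _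
    _ ≤ _ := lintegral_mono fun z => hκ z.1 z.2

/-- Schur's test in its simplest form: $n(t)n(s)\le n(t)^2+n(s)^2$, after which translation
invariance integrates out one variable. It replaces Young's inequality at the price of the factor 2.
-/
lemma lintegral_convolution_form_le {k n : ℝ → ℝ≥0∞} (hk : Measurable k) (hn : Measurable n) :
    ∫⁻ z : ℝ × ℝ, k (z.1 - z.2) * (n z.1 * n z.2) ≤ 2 * (∫⁻ t, k t) * ∫⁻ t, n t ^ 2 := by
  have hle : ∀ a b : ℝ≥0∞, a * b ≤ a ^ 2 + b ^ 2 := fun a b => by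
    rcases le_total a b with h | h
    · calc a * b ≤ b * b := by gcongr
        _ ≤ _ := by rw [← sq]; exact le_add_self
    · calc a * b ≤ a * a := by gcongr
        _ ≤ _ := by rw [← sq]; exact le_self_add
  have h1 : ∫⁻ z : ℝ × ℝ, k (z.1 - z.2) * n z.1 ^ 2 = (∫⁻ t, k t) * ∫⁻ t, n t ^ 2 := by
    rw [Measure.volume_eq_prod, lintegral_prod _ (by fun_prop)]
    simp only
    rw [← lintegral_const_mul _ (by fun_prop)]
    refine lintegral_congr fun t => ?_
    rw [lintegral_mul_const _ (by fun_prop), lintegral_sub_left_eq_self k t]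
  have h2 : ∫⁻ z : ℝ × ℝ, k (z.1 - z.2) * n z.2 ^ 2 = (∫⁻ t, k t) * ∫⁻ t, n t ^ 2 := by
    rw [Measure.volume_eq_prod, lintegral_prod_symm' _ (by fun_prop)]
    simp only
    rw [← lintegral_const_mul _ (by fun_prop)]
    refine lintegral_congr fun t => ?_
    rw [lintegral_mul_const _ (by fun_prop), lintegral_sub_right_eq_self k t]
  calc _ ≤ ∫⁻ z : ℝ × ℝ, (k (z.1 - z.2) * n z.1 ^ 2 + k (z.1 - z.2) * n z.2 ^ 2) := by
        refine lintegral_mono fun z => ?_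
        rw [← mul_add]
        gcongr
        exact hle _ _
    _ = _ := by rw [lintegral_add_left (by fun_prop), h1, h2]; ring

/-- The bound for the kernel of the localized propagator, as a function of the time. -/
def dispKernel (ρ τ : ℝ) : ℝ := 160 ^ (1 / 5 : ℝ) * (Real.pi / ‖kerParam ρ τ‖) ^ (3 / 2 : ℝ)

lemma measurable_dispKernel (ρ : ℝ) : Measurable (dispKernel ρ) := by
  unfold dispKernel kerParam; fun_prop

/-- Since $4π^2\ge 1$, $|ρ^{-2}+4π^2iτ|\geρ^{-2}(1+(ρ^2τ)^2)^{1/2}$. The resulting decay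
$|τ|^{-3/2}$ is integrable, so no endpoint Strichartz argument is required. -/
lemma dispKernel_le {ρ : ℝ} (hρ : 0 < ρ) (τ : ℝ) :
    dispKernel ρ τ ≤ 160 ^ (1 / 5 : ℝ) * Real.pi ^ (3 / 2 : ℝ) * ρ ^ 3 *
      (1 + ‖ρ ^ 2 * τ‖ ^ 2) ^ (-(3 / 2) / 2 : ℝ) := by
  have hpi := Real.pi_pos
  have hb : (1 + ‖ρ ^ 2 * τ‖ ^ 2) ^ (1 / 2 : ℝ) / ρ ^ 2 ≤ ‖kerParam ρ τ‖ := by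
    rw [kerParam, Complex.norm_add_mul_I, Real.sqrt_eq_rpow, Real.norm_eq_abs, sq_abs]
    have : ((1 + (ρ ^ 2 * τ) ^ 2) : ℝ) ^ (1 / 2 : ℝ) / ρ ^ 2 =
        ((1 + (ρ ^ 2 * τ) ^ 2) / ρ ^ 4) ^ (1 / 2 : ℝ) := by
      rw [Real.div_rpow (by positivity) (by positivity), ← Real.rpow_natCast ρ 4,
        ← Real.rpow_mul hρ.le]
      norm_num
    rw [this]
    refine Real.rpow_le_rpow (by positivity) ?_ (by norm_num)
    rw [add_div, mul_pow, ← pow_mul]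
    have h4 : ρ ^ (2 * 2) * τ ^ 2 / ρ ^ 4 = τ ^ 2 := by
      rw [div_eq_iff (by positivity)]; ring
    rw [h4]
    have h1 : (1 : ℝ) ≤ (4 * Real.pi ^ 2) ^ 2 := by
      have : (1 : ℝ) ≤ 4 * Real.pi ^ 2 := by nlinarith [Real.pi_gt_three]
      exact one_le_pow₀ this
    have h2 : (1 / ρ ^ 2) ^ 2 = 1 / ρ ^ 4 := by field_simp
    rw [h2]
    nlinarith [sq_nonneg τ]
  have hpos : 0 < (1 + ‖ρ ^ 2 * τ‖ ^ 2) ^ (1 / 2 : ℝ) / ρ ^ 2 := by positivity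
  unfold dispKernel
  calc _ ≤ 160 ^ (1 / 5 : ℝ) *
        (Real.pi / ((1 + ‖ρ ^ 2 * τ‖ ^ 2) ^ (1 / 2 : ℝ) / ρ ^ 2)) ^ (3 / 2 : ℝ) := by gcongr
    _ = _ := by
      have e : Real.pi / ((1 + ‖ρ ^ 2 * τ‖ ^ 2) ^ (1 / 2 : ℝ) / ρ ^ 2) =
          Real.pi * ρ ^ 2 * (1 + ‖ρ ^ 2 * τ‖ ^ 2) ^ (-(1 / 2) : ℝ) := by
        rw [Real.rpow_neg (by positivity)]; field_simp
      rw [e, Real.mul_rpow (by positivity) (by positivity), Real.mul_rpow (by positivity) (by positivity),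
        ← Real.rpow_natCast ρ 2, ← Real.rpow_mul hρ.le, ← Real.rpow_mul (by positivity)]
      norm_num
      ring

/-- The constant in the frequency-localized Strichartz estimate. -/
def strConst : ℝ := 160 ^ (1 / 5 : ℝ) * Real.pi ^ (3 / 2 : ℝ) *
  ∫ τ : ℝ, (1 + ‖τ‖ ^ 2) ^ (-(3 / 2) / 2 : ℝ)

lemma strConst_nonneg : 0 ≤ strConst := by
  have : 0 ≤ ∫ τ : ℝ, (1 + ‖τ‖ ^ 2) ^ (-(3 / 2) / 2 : ℝ) := integral_nonneg fun τ => by positivity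
  have := Real.pi_pos
  unfold strConst
  positivity

/-- Source of the gain: rescaling $τ\mapstoρ^2τ$ leaves $ρ^3\cdotρ^{-2}=ρ$. -/
lemma lintegral_dispKernel_le {ρ : ℝ} (hρ : 0 < ρ) :
    ∫⁻ τ, ENNReal.ofReal (dispKernel ρ τ) ≤ ENNReal.ofReal (strConst * ρ) := by
  have hpi := Real.pi_pos
  have hint : Integrable fun τ : ℝ => (1 + ‖τ‖ ^ 2) ^ (-(3 / 2) / 2 : ℝ) :=
    integrable_rpow_neg_one_add_norm_sq (by norm_num)
  have hint2 : Integrable fun τ : ℝ => (1 + ‖ρ ^ 2 * τ‖ ^ 2) ^ (-(3 / 2) / 2 : ℝ) :=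
    hint.comp_mul_left' (by positivity)
  refine (lintegral_mono fun τ => ENNReal.ofReal_le_ofReal (dispKernel_le hρ τ)).trans_eq ?_
  rw [← ofReal_integral_eq_lintegral_ofReal (hint2.const_mul _)
    (Filter.Eventually.of_forall fun τ => by positivity), integral_const_mul,
    Measure.integral_comp_mul_left (fun τ : ℝ => (1 + ‖τ‖ ^ 2) ^ (-(3 / 2) / 2 : ℝ)), strConst,
    abs_of_pos (by positivity), smul_eq_mul]
  congr 1
  field_simp

lemma measurable_evol_apply {F : R5 → ℂ} (hF : Measurable F) (t : ℝ) : Measurable (evol F t) :=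
  Measurable.of_uncurry_left (measurable_evol hF)

/-- The `L⁵` norm of a solution at time `t`. -/
def normFive (F : R5 → ℂ) (t : ℝ) : ℝ :=
  (∫⁻ x, ‖evol F t x‖ₑ ^ (5 : ℝ)).toReal ^ (1 / 5 : ℝ)

lemma measurable_lintegral_evol {F : R5 → ℂ} (hF : Measurable F) (p : ℝ) :
    Measurable fun t => ∫⁻ x, ‖evol F t x‖ₑ ^ p :=
  ((measurable_evol hF).enorm.pow_const p).lintegral_prod_right'

lemma measurable_normFive {F : R5 → ℂ} (hF : Measurable F) : Measurable (normFive F) :=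
  (measurable_lintegral_evol hF 5).ennreal_toReal.pow_const _

lemma normFive_nonneg (F : R5 → ℂ) (t : ℝ) : 0 ≤ normFive F t := by
  unfold normFive; positivity

/-- Three powers go to the supremum bound and two to conservation of $L^2$ mass. It gives finiteness
here and a Bernstein inequality later. -/
lemma lintegral_evol_five_le {F : R5 → ℂ} (hF : Integrable F) (hF2 : MemLp F 2) (t : ℝ) :
    ∫⁻ x, ‖evol F t x‖ₑ ^ (5 : ℝ) ≤ ENNReal.ofReal (∫ η, ‖F η‖) ^ 3 * ∫⁻ η, ‖F η‖ₑ ^ 2 := by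
  rw [← lintegral_evol_sq hF hF2 t, ← lintegral_const_mul' _ _ (by simp)]
  refine lintegral_mono fun x => ?_
  have h1 : ‖evol F t x‖ₑ ≤ ENNReal.ofReal (∫ η, ‖F η‖) := by
    rw [← ofReal_norm]; exact ENNReal.ofReal_le_ofReal (norm_evol_le F t x)
  calc ‖evol F t x‖ₑ ^ (5 : ℝ) = ‖evol F t x‖ₑ ^ 3 * ‖evol F t x‖ₑ ^ 2 := by
        rw [← pow_add, ← ENNReal.rpow_natCast]; norm_num
    _ ≤ _ := by gcongr

lemma lintegral_sq_ne_top {F : R5 → ℂ} (hF2 : MemLp F 2) : ∫⁻ η, ‖F η‖ₑ ^ 2 ≠ ∞ := by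
  rw [lintegral_enorm_sq_eq]
  exact ENNReal.pow_ne_top hF2.eLpNorm_ne_top

lemma lintegral_evol_five_ne_top {F : R5 → ℂ} (hF : Integrable F) (hF2 : MemLp F 2) (t : ℝ) :
    ∫⁻ x, ‖evol F t x‖ₑ ^ (5 : ℝ) ≠ ∞ :=
  ((lintegral_evol_five_le hF hF2 t).trans_lt
    (ENNReal.mul_lt_top (by simp) (lintegral_sq_ne_top hF2).lt_top)).ne

lemma ofReal_normFive {F : R5 → ℂ} (hF : Integrable F) (hF2 : MemLp F 2) (t : ℝ) :
    ENNReal.ofReal (normFive F t) = (∫⁻ x, ‖evol F t x‖ₑ ^ (5 : ℝ)) ^ (1 / 5 : ℝ) := by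
  rw [normFive, ← ENNReal.ofReal_rpow_of_nonneg ENNReal.toReal_nonneg (by norm_num),
    ENNReal.ofReal_toReal (lintegral_evol_five_ne_top hF hF2 t)]

lemma lintegral_evol_five_eq {F : R5 → ℂ} (hF : Integrable F) (hF2 : MemLp F 2) (t : ℝ) :
    ∫⁻ x, ‖evol F t x‖ₑ ^ (5 : ℝ) = ENNReal.ofReal (normFive F t ^ 5) := by
  rw [ENNReal.ofReal_pow (normFive_nonneg F t), ofReal_normFive hF hF2, ← ENNReal.rpow_natCast,
    ← ENNReal.rpow_mul]
  norm_num

/-- The function dual to a solution in `L²L⁵`, on a set `I` of times. -/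
def dualFun (F : R5 → ℂ) (I : Set ℝ) (t : ℝ) (x : R5) : ℂ :=
  I.indicator (fun t => (((normFive F t ^ 3)⁻¹ * ‖evol F t x‖ ^ 3 : ℝ) : ℂ) *
    (starRingEnd ℂ) (evol F t x)) t

section dual

variable {F : R5 → ℂ} {I : Set ℝ} {ε : ℝ}

lemma measurable_dualFun (hFm : Measurable F) (hI : MeasurableSet I) :
    Measurable (Function.uncurry (dualFun F I)) := by
  have h1 := measurable_evol hFm
  have h2 : Measurable fun z : ℝ × R5 => normFive F z.1 := (measurable_normFive hFm).comp measurable_fst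
  have h3 : Measurable fun z : ℝ × R5 => (((normFive F z.1 ^ 3)⁻¹ * ‖evol F z.1 z.2‖ ^ 3 : ℝ) : ℂ) *
      (starRingEnd ℂ) (evol F z.1 z.2) :=
    (Complex.measurable_ofReal.comp ((h2.pow_const 3).inv.mul (h1.norm.pow_const 3))).mul
      (Complex.continuous_conj.measurable.comp h1)
  convert! h3.indicator (measurable_fst hI) using 1

lemma norm_dualFun {t : ℝ} (ht : t ∈ I) (x : R5) :
    ‖dualFun F I t x‖ = (normFive F t ^ 3)⁻¹ * ‖evol F t x‖ ^ 4 := by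
  have := normFive_nonneg F t
  rw [dualFun, Set.indicator_of_mem ht, norm_mul, RCLike.norm_conj, Complex.norm_real,
    Real.norm_of_nonneg (by positivity), mul_assoc, ← pow_succ]

lemma dualFun_of_notMem {t : ℝ} (ht : t ∉ I) (x : R5) : dualFun F I t x = 0 :=
  Set.indicator_of_notMem ht _

lemma integrable_norm_evol_sq (hFm : Measurable F) (hF : Integrable F) (hF2 : MemLp F 2) (t : ℝ) :
    Integrable fun x => ‖evol F t x‖ ^ 2 := by
  have hm : Measurable (evol F t) := measurable_evol_apply hFm t
  refine ⟨(hm.norm.pow_const 2).aestronglyMeasurable, ?_⟩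
  rw [HasFiniteIntegral]
  simp only [enorm_pow, enorm_norm]
  rw [lintegral_evol_sq hF hF2]
  exact (lintegral_sq_ne_top hF2).lt_top

lemma integral_norm_evol_sq (hFm : Measurable F) (hF : Integrable F) (hF2 : MemLp F 2) (t : ℝ) :
    ∫ x, ‖evol F t x‖ ^ 2 = (∫⁻ η, ‖F η‖ₑ ^ 2).toReal := by
  have hm : Measurable (evol F t) := measurable_evol_apply hFm t
  rw [integral_eq_lintegral_of_nonneg_ae (Filter.Eventually.of_forall fun x => by positivity)
    (hm.norm.pow_const 2).aestronglyMeasurable, ← lintegral_evol_sq hF hF2 t]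
  congr 1
  refine lintegral_congr fun x => ?_
  rw [ENNReal.ofReal_pow (norm_nonneg _), ofReal_norm]

/-- The lower bound `ε` on the $L^5$ norm controls the normalizing factor, so the dual function is
dominated by an integrable one. The use is qualitative: `ε` does not appear in the final Strichartz
estimate. -/
lemma norm_dualFun_le (hε : 0 < ε) (hn : ∀ t ∈ I, ε ≤ normFive F t) (t : ℝ) (x : R5) :
    ‖dualFun F I t x‖ ≤ (ε ^ 3)⁻¹ * (∫ η, ‖F η‖) ^ 2 * ‖evol F t x‖ ^ 2 := by
  by_cases ht : t ∈ I
  · have h1 := hn t ht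
    have h2 := norm_evol_le F t x
    rw [norm_dualFun ht, mul_assoc, show 4 = 2 + 2 from rfl, pow_add]
    gcongr
  · rw [dualFun_of_notMem ht, norm_zero]
    positivity

lemma integrable_dualFun (hFm : Measurable F) (hF : Integrable F) (hF2 : MemLp F 2)
    (hI : MeasurableSet I) (hε : 0 < ε) (hn : ∀ t ∈ I, ε ≤ normFive F t) (t : ℝ) :
    Integrable (dualFun F I t) :=
  ((integrable_norm_evol_sq hFm hF hF2 t).const_mul _).mono'
    ((measurable_dualFun hFm hI).comp measurable_prodMk_left).aestronglyMeasurable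
    (Filter.Eventually.of_forall fun x => norm_dualFun_le hε hn t x)

lemma integral_norm_dualFun_le (hFm : Measurable F) (hF : Integrable F) (hF2 : MemLp F 2)
    (hI : MeasurableSet I) (hε : 0 < ε) (hn : ∀ t ∈ I, ε ≤ normFive F t) (t : ℝ) :
    ∫ x, ‖dualFun F I t x‖ ≤
      (ε ^ 3)⁻¹ * (∫ η, ‖F η‖) ^ 2 * (∫⁻ η, ‖F η‖ₑ ^ 2).toReal := by
  rw [← integral_norm_evol_sq hFm hF hF2 t, ← integral_const_mul]
  exact integral_mono (integrable_dualFun hFm hF hF2 hI hε hn t).norm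
    ((integrable_norm_evol_sq hFm hF hF2 t).const_mul _) fun x => norm_dualFun_le hε hn t x

lemma memLp_dualFun (hFm : Measurable F) (hF : Integrable F) (hF2 : MemLp F 2)
    (hI : MeasurableSet I) (hε : 0 < ε) (hn : ∀ t ∈ I, ε ≤ normFive F t) (t : ℝ) :
    MemLp (dualFun F I t) 2 volume := by
  have hm := ((measurable_dualFun hFm hI).comp (measurable_prodMk_left (x := t))).aestronglyMeasurable
    (μ := (volume : Measure R5))
  have hi := integrable_dualFun hFm hF hF2 hI hε hn t
  refine (memLp_two_iff_integrable_sq_norm hm).2 ?_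
  refine (hi.norm.const_mul ((ε ^ 3)⁻¹ * (∫ η, ‖F η‖) ^ 2 * (∫ η, ‖F η‖) ^ 2)).mono'
    (hi.aestronglyMeasurable.norm.pow 2) (Filter.Eventually.of_forall fun x => ?_)
  show ‖‖dualFun F I t x‖ ^ 2‖ ≤ _
  rw [norm_pow, norm_norm, sq]
  gcongr
  refine (norm_dualFun_le hε hn t x).trans ?_
  gcongr
  exact norm_evol_le F t x

/-- With $n$ the $L^5$ norm, the integrand is $n^{-15/4}|u|^5$, whose integral is
$n^{5-15/4}=n^{5/4}$. Thus the dual function has $L^{5/4}$ norm exactly $n$. -/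
lemma lintegral_dualFun_rpow (hF : Integrable F) (hF2 : MemLp F 2) (hε : 0 < ε)
    (hn : ∀ t ∈ I, ε ≤ normFive F t) {t : ℝ} (ht : t ∈ I) :
    ∫⁻ x, ENNReal.ofReal (‖dualFun F I t x‖ ^ (5 / 4 : ℝ)) =
      ENNReal.ofReal (normFive F t ^ (5 / 4 : ℝ)) := by
  have hn0 : 0 < normFive F t := hε.trans_le (hn t ht)
  have e (x : R5) : ENNReal.ofReal (‖dualFun F I t x‖ ^ (5 / 4 : ℝ)) =
      ENNReal.ofReal (normFive F t ^ (-(15 / 4) : ℝ)) * ‖evol F t x‖ₑ ^ (5 : ℝ) := by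
    rw [norm_dualFun ht, Real.mul_rpow (by positivity) (by positivity),
      ENNReal.ofReal_mul (by positivity)]
    congr 1
    · rw [← Real.rpow_natCast, ← Real.rpow_neg hn0.le, ← Real.rpow_mul hn0.le]
      norm_num
    · rw [← Real.rpow_natCast, ← Real.rpow_mul (norm_nonneg _), ← ofReal_norm,
        ENNReal.ofReal_rpow_of_nonneg (norm_nonneg _) (by norm_num)]
      norm_num
  simp_rw [e]
  rw [lintegral_const_mul' _ _ (by simp), lintegral_evol_five_eq hF hF2,
    ← ENNReal.ofReal_mul (by positivity), ← Real.rpow_natCast, ← Real.rpow_add hn0]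
  norm_num

lemma integral_evol_mul_dualFun (hFm : Measurable F) (hF : Integrable F) (hF2 : MemLp F 2)
    (hε : 0 < ε) (hn : ∀ t ∈ I, ε ≤ normFive F t) {t : ℝ} (ht : t ∈ I) :
    ∫ x, evol F t x * dualFun F I t x = ((normFive F t ^ 2 : ℝ) : ℂ) := by
  have hm : Measurable (evol F t) := measurable_evol_apply hFm t
  have hn0 : 0 < normFive F t := hε.trans_le (hn t ht)
  have e (x : R5) : evol F t x * dualFun F I t x =
      (((normFive F t ^ 3)⁻¹ * ‖evol F t x‖ ^ 5 : ℝ) : ℂ) := by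
    rw [dualFun, Set.indicator_of_mem ht, mul_left_comm, Complex.mul_conj, Complex.normSq_eq_norm_sq,
      ← Complex.ofReal_mul]
    congr 1
    ring
  simp_rw [e]
  rw [integral_complex_ofReal, integral_const_mul, integral_eq_lintegral_of_nonneg_ae
    (Filter.Eventually.of_forall fun x => by positivity) (hm.norm.pow_const 5).aestronglyMeasurable]
  have e2 : ∫⁻ x, ENNReal.ofReal (‖evol F t x‖ ^ 5) = ENNReal.ofReal (normFive F t ^ 5) := by
    rw [← lintegral_evol_five_eq hF hF2]
    refine lintegral_congr fun x => ?_
    rw [ENNReal.ofReal_pow (norm_nonneg _), ofReal_norm, ← ENNReal.rpow_natCast]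
    norm_num
  rw [e2, ENNReal.toReal_ofReal (by positivity)]
  congr 1
  field_simp

/-- The space-time Fourier transform of the dual function at a fixed time. -/
def dualHat (F : R5 → ℂ) (I : Set ℝ) (t : ℝ) (η : R5) : ℂ := schr t η * 𝓕⁻ (dualFun F I t) η

lemma measurable_dualHat (hFm : Measurable F) (hI : MeasurableSet I) :
    Measurable (Function.uncurry (dualHat F I)) :=
  (by fun_prop : Measurable fun z : ℝ × R5 => schr z.1 z.2).mul
    (measurable_fourierInv_param (measurable_dualFun hFm hI))

lemma dualHat_of_notMem {t : ℝ} (ht : t ∉ I) (η : R5) : dualHat F I t η = 0 := by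
  have : dualFun F I t = fun _ => 0 := funext fun x => dualFun_of_notMem ht x
  rw [dualHat, this, Real.fourierInv_eq]
  simp

lemma enorm_integral_dualHat_le (hFm : Measurable F) (hF : Integrable F) (hF2 : MemLp F 2)
    (hI : MeasurableSet I) (hε : 0 < ε) (hn : ∀ t ∈ I, ε ≤ normFive F t) (η₀ : R5) {ρ : ℝ}
    (hρ : 0 < ρ) (t s : ℝ) :
    ‖∫ η, (gaussWeight η₀ ρ η : ℂ) * (dualHat F I t η * (starRingEnd ℂ) (dualHat F I s η))‖ₑ ≤
      ENNReal.ofReal (dispKernel ρ (t - s)) *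
        (I.indicator (fun t => ENNReal.ofReal (normFive F t)) t *
          I.indicator (fun t => ENNReal.ofReal (normFive F t)) s) := by
  by_cases ht : t ∈ I
  swap
  · simp [dualHat_of_notMem ht]
  by_cases hs : s ∈ I
  swap
  · simp [dualHat_of_notMem hs]
  have hnt : 0 < normFive F t := hε.trans_le (hn t ht)
  have hns : 0 < normFive F s := hε.trans_le (hn s hs)
  have hmt (t : ℝ) : Measurable (dualFun F I t) := (measurable_dualFun hFm hI).comp measurable_prodMk_left
  have key := norm_integral_symbol_mul_le η₀ hρ (t - s) (hmt t)
    (integrable_dualFun hFm hF hF2 hI hε hn t) (memLp_dualFun hFm hF hF2 hI hε hn t) (hmt s)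
    (integrable_dualFun hFm hF hF2 hI hε hn s) (by positivity)
    (lintegral_dualFun_rpow hF hF2 hε hn ht) (by positivity)
    (lintegral_dualFun_rpow hF hF2 hε hn hs)
  rw [Set.indicator_of_mem ht, Set.indicator_of_mem hs, ← ENNReal.ofReal_mul hnt.le,
    ← ENNReal.ofReal_mul (by unfold dispKernel; have := Real.pi_pos; positivity), ← ofReal_norm]
  refine ENNReal.ofReal_le_ofReal ?_
  have e : ∀ a : ℝ, 0 ≤ a → (a ^ (5 / 4 : ℝ)) ^ (4 / 5 : ℝ) = a := fun a ha => by
    rw [← Real.rpow_mul ha]; norm_num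
  rw [e _ hnt.le, e _ hns.le] at key
  refine le_of_eq_of_le ?_ (key.trans_eq ?_)
  · congr 2
    ext η
    rw [← schr_mul_conj, dualHat, dualHat, map_mul]
    ring
  · rw [dispKernel]; ring

/-- Duality: at each time in `I` the solution paired with its dual function gives the squared $L^5$
norm. Moving the inverse transform to the dual function and exchanging integrals leaves a pairing of
`F` with one function of frequency. -/
lemma lintegral_normFive_sq_eq (hFm : Measurable F) (hF : Integrable F) (hF2 : MemLp F 2)
    (hI : MeasurableSet I) (hIf : volume I ≠ ∞) (hε : 0 < ε) (hn : ∀ t ∈ I, ε ≤ normFive F t)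
    (hfin : IntegrableOn (fun t => normFive F t ^ 2) I) :
    ∫⁻ t in I, ENNReal.ofReal (normFive F t ^ 2) = ‖∫ η, F η * ∫ t, dualHat F I t η‖ₑ := by
  set B : ℝ := (ε ^ 3)⁻¹ * (∫ η, ‖F η‖) ^ 2 * (∫⁻ η, ‖F η‖ₑ ^ 2).toReal with hB
  have hle : ∀ t η, ‖dualHat F I t η‖ ≤ I.indicator (fun _ => B) t := fun t η => by
    by_cases ht : t ∈ I
    · rw [dualHat, norm_mul, norm_schr, one_mul, Set.indicator_of_mem ht]
      exact (norm_fourierInv_le _ _).trans (integral_norm_dualFun_le hFm hF hF2 hI hε hn t)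
    · simp [dualHat_of_notMem ht, ht]
  have hind : Integrable (I.indicator fun _ => B) := by
    rw [integrable_indicator_iff hI]; exact integrableOn_const hIf
  have hint : Integrable (fun z : ℝ × R5 => F z.2 * dualHat F I z.1 z.2) (volume.prod volume) := by
    refine (hind.mul_prod hF.norm).mono' ?_ (Filter.Eventually.of_forall fun z => ?_)
    · exact ((hFm.comp measurable_snd).mul (measurable_dualHat hFm hI)).aestronglyMeasurable
    · rw [norm_mul, mul_comm]
      gcongr
      exact hle _ _
  have hpair (t : ℝ) : ∫ η, F η * dualHat F I t η =
      ((I.indicator (fun t => normFive F t ^ 2) t : ℝ) : ℂ) := by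
    by_cases ht : t ∈ I
    · rw [Set.indicator_of_mem ht, ← integral_evol_mul_dualFun hFm hF hF2 hε hn ht]
      unfold evol
      rw [integral_fourierInv_mul (integrable_schr_mul hF t) (integrable_dualFun hFm hF hF2 hI hε hn t)]
      refine integral_congr_ae (Filter.Eventually.of_forall fun η => ?_)
      simp only [dualHat]
      ring
    · simp [dualHat_of_notMem ht, ht]
  have e : ∫ η, F η * ∫ t, dualHat F I t η = ((∫ t in I, normFive F t ^ 2 : ℝ) : ℂ) := by
    simp_rw [← integral_const_mul]
    rw [← integral_integral_swap hint]
    simp_rw [hpair]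
    rw [integral_complex_ofReal, integral_indicator hI]
  rw [e, ← ofReal_norm, Complex.norm_real, Real.norm_of_nonneg (integral_nonneg fun t => by positivity),
    ofReal_integral_eq_lintegral_ofReal hfin (Filter.Eventually.of_forall fun t => by positivity)]

end dual

lemma sq_lintegral_mul_le {α : Type*} [MeasurableSpace α] {μ : Measure α} {f g : α → ℝ≥0∞}
    (hf : AEMeasurable f μ) (hg : AEMeasurable g μ) :
    (∫⁻ x, f x * g x ∂μ) ^ 2 ≤ (∫⁻ x, f x ^ 2 ∂μ) * ∫⁻ x, g x ^ 2 ∂μ := by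
  have h := ENNReal.lintegral_mul_le_Lp_mul_Lq μ Real.HolderConjugate.two_two hf hg
  simp only [Pi.mul_apply, ENNReal.rpow_two] at h
  calc _ ≤ ((∫⁻ x, f x ^ 2 ∂μ) ^ (1 / 2 : ℝ) * (∫⁻ x, g x ^ 2 ∂μ) ^ (1 / 2 : ℝ)) ^ 2 := by gcongr
    _ = _ := by
      rw [mul_pow, ← ENNReal.rpow_natCast, ← ENNReal.rpow_natCast, ← ENNReal.rpow_mul,
        ← ENNReal.rpow_mul]
      norm_num

lemma one_le_exp_mul_gaussWeight {η₀ η : R5} {ρ : ℝ} (hρ : 0 < ρ) (h : ‖η - η₀‖ ≤ ρ) :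
    1 ≤ Real.exp 1 * gaussWeight η₀ ρ η := by
  rw [gaussWeight, ← Real.exp_add, Real.one_le_exp_iff]
  have : ‖η - η₀‖ ^ 2 / ρ ^ 2 ≤ 1 := by
    rw [div_le_one (by positivity)]; gcongr
  linarith

/-- The $TT^*$ argument. By duality and Cauchy–Schwarz $X^2\le\|F\|_2^2\cdot e\int w|D|^2$, where
the Gaussian weight $w$ is at least $e^{-1}$ on the support of `F`. The dispersive bound gives $\int
w|D|^2\le 2\,\mathrm{strConst}\,ρ\,X$, and one factor $X$ cancels. -/
lemma setLIntegral_normFive_sq_le {F : R5 → ℂ} (hFm : Measurable F) (hF : Integrable F)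
    (hF2 : MemLp F 2) {η₀ : R5} {ρ : ℝ} (hρ : 0 < ρ) (hsupp : ∀ η, ρ < ‖η - η₀‖ → F η = 0)
    {I : Set ℝ} (hI : MeasurableSet I) (hIf : volume I ≠ ∞) {ε : ℝ} (hε : 0 < ε)
    (hn : ∀ t ∈ I, ε ≤ normFive F t) :
    ∫⁻ t in I, ENNReal.ofReal (normFive F t ^ 2) ≤
      ENNReal.ofReal (2 * Real.exp 1 * strConst * ρ) * ∫⁻ η, ‖F η‖ₑ ^ 2 := by
  have hstr := strConst_nonneg
  obtain ⟨M, hM⟩ : ∃ M : ℝ, ∀ t, normFive F t ≤ M := by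
    refine ⟨((ENNReal.ofReal (∫ η, ‖F η‖) ^ 3 * ∫⁻ η, ‖F η‖ₑ ^ 2).toReal) ^ (1 / 5 : ℝ), fun t => ?_⟩
    unfold normFive
    gcongr
    · exact (ENNReal.mul_lt_top (by simp) (lintegral_sq_ne_top hF2).lt_top).ne
    · exact lintegral_evol_five_le hF hF2 t
  have hfin : IntegrableOn (fun t => normFive F t ^ 2) I := by
    refine Measure.integrableOn_of_bounded hIf
      ((measurable_normFive hFm).pow_const 2).aestronglyMeasurable (M := M ^ 2)
      (Filter.Eventually.of_forall fun t => ?_)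
    rw [Real.norm_of_nonneg (by positivity)]
    have := normFive_nonneg F t
    gcongr
    exact hM t
  set X := ∫⁻ t in I, ENNReal.ofReal (normFive F t ^ 2) with hX
  have hXt : X ≠ ∞ := by
    rw [hX, ← ofReal_integral_eq_lintegral_ofReal hfin (Filter.Eventually.of_forall fun t => by positivity)]
    exact ENNReal.ofReal_ne_top
  set D : R5 → ℂ := fun η => ∫ t, dualHat F I t η with hD
  have hDm : Measurable D :=
    (((measurable_dualHat hFm hI).comp measurable_swap).stronglyMeasurable.integral_prod_right').measurable
  have hwm : Measurable (gaussWeight η₀ ρ) := (continuous_gaussWeight η₀ ρ).measurable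
  set B : ℝ := (ε ^ 3)⁻¹ * (∫ η, ‖F η‖) ^ 2 * (∫⁻ η, ‖F η‖ₑ ^ 2).toReal with hB
  have h1 : X ≤ ∫⁻ η, ‖F η‖ₑ * (ENNReal.ofReal (Real.exp 1 * gaussWeight η₀ ρ η) ^ (1 / 2 : ℝ) * ‖D η‖ₑ) := by
    rw [hX, lintegral_normFive_sq_eq hFm hF hF2 hI hIf hε hn hfin]
    refine (enorm_integral_le_lintegral_enorm _).trans (lintegral_mono fun η => ?_)
    rw [enorm_mul]
    by_cases h : ‖η - η₀‖ ≤ ρ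
    · gcongr
      refine le_mul_of_one_le_left zero_le ?_
      refine ENNReal.one_le_rpow ?_ (by norm_num)
      rw [ENNReal.one_le_ofReal]
      exact one_le_exp_mul_gaussWeight hρ h
    · simp [hsupp η (not_le.1 h)]
  have h2 : ∫⁻ η, ENNReal.ofReal (gaussWeight η₀ ρ η) * ‖D η‖ₑ ^ 2 ≤
      2 * ENNReal.ofReal (strConst * ρ) * X := by
    have hle := lintegral_weight_mul_sq_le (measurable_dualHat hFm hI) hI hIf (B := B)
      (fun t η => by
        rw [dualHat, norm_mul, norm_schr, one_mul]
        exact (norm_fourierInv_le _ _).trans (integral_norm_dualFun_le hFm hF hF2 hI hε hn t))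
      (fun t ht η => dualHat_of_notMem ht η) (integrable_gaussWeight η₀ hρ)
      (fun η => (gaussWeight_pos η₀ ρ η).le)
      (fun t s => enorm_integral_dualHat_le hFm hF hF2 hI hε hn η₀ hρ t s)
    have hnm : Measurable (I.indicator fun t => ENNReal.ofReal (normFive F t)) :=
      (measurable_normFive hFm).ennreal_ofReal.indicator hI
    have hconv := lintegral_convolution_form_le (measurable_dispKernel ρ).ennreal_ofReal hnm
    have e : ∫⁻ t, I.indicator (fun t => ENNReal.ofReal (normFive F t)) t ^ 2 = X := by
      rw [hX, ← lintegral_indicator hI]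
      refine lintegral_congr fun t => ?_
      by_cases ht : t ∈ I
      · simp [ht, ENNReal.ofReal_pow (normFive_nonneg F t)]
      · simp [ht]
    rw [e] at hconv
    refine hle.trans (hconv.trans ?_)
    gcongr
    exact lintegral_dispKernel_le hρ
  have h3 : X ^ 2 ≤ (ENNReal.ofReal (2 * Real.exp 1 * strConst * ρ) * ∫⁻ η, ‖F η‖ₑ ^ 2) * X := by
    calc X ^ 2 ≤ (∫⁻ η, ‖F η‖ₑ *
          (ENNReal.ofReal (Real.exp 1 * gaussWeight η₀ ρ η) ^ (1 / 2 : ℝ) * ‖D η‖ₑ)) ^ 2 := by gcongr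
      _ ≤ _ := sq_lintegral_mul_le (by fun_prop) (by fun_prop)
      _ = (∫⁻ η, ‖F η‖ₑ ^ 2) * (ENNReal.ofReal (Real.exp 1) *
          ∫⁻ η, ENNReal.ofReal (gaussWeight η₀ ρ η) * ‖D η‖ₑ ^ 2) := by
          congr 1
          rw [← lintegral_const_mul' _ _ ENNReal.ofReal_ne_top]
          refine lintegral_congr fun η => ?_
          rw [mul_pow, ← ENNReal.rpow_natCast, ← ENNReal.rpow_mul, ← mul_assoc,
            ENNReal.ofReal_mul (Real.exp_pos 1).le]
          norm_num
      _ ≤ (∫⁻ η, ‖F η‖ₑ ^ 2) * (ENNReal.ofReal (Real.exp 1) *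
          (2 * ENNReal.ofReal (strConst * ρ) * X)) := by gcongr
      _ = _ := by
          rw [show 2 * Real.exp 1 * strConst * ρ = Real.exp 1 * (2 * (strConst * ρ)) by ring,
            ENNReal.ofReal_mul (Real.exp_pos 1).le,
            ENNReal.ofReal_mul (zero_le_two (α := ℝ)), ENNReal.ofReal_ofNat]
          ring
  -- Cancelling $X$ requires $0<X<\infty$; finiteness is why `I` was taken of finite measure.
  by_cases hX0 : X = 0
  · rw [hX0]; exact zero_le
  rw [sq] at h3
  exact (ENNReal.mul_le_mul_iff_left hX0 hXt).1 h3

/-- The frequency-localized Strichartz estimate in `L²L⁵`. -/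
lemma lintegral_evol_five_rpow_le {F : R5 → ℂ} (hFm : Measurable F) (hF : Integrable F)
    (hF2 : MemLp F 2) {η₀ : R5} {ρ : ℝ} (hρ : 0 < ρ) (hsupp : ∀ η, ρ < ‖η - η₀‖ → F η = 0) :
    ∫⁻ t, (∫⁻ x, ‖evol F t x‖ₑ ^ (5 : ℝ)) ^ (2 / 5 : ℝ) ≤
      ENNReal.ofReal (2 * Real.exp 1 * strConst * ρ) * ∫⁻ η, ‖F η‖ₑ ^ 2 := by
  have e (t : ℝ) : (∫⁻ x, ‖evol F t x‖ₑ ^ (5 : ℝ)) ^ (2 / 5 : ℝ) =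
      ENNReal.ofReal (normFive F t ^ 2) := by
    rw [ENNReal.ofReal_pow (normFive_nonneg F t), ofReal_normFive hF hF2, ← ENNReal.rpow_natCast,
      ← ENNReal.rpow_mul]
    norm_num
  simp_rw [e]
  -- These truncations increase to the set where the $L^5$ norm is positive, and the constant of the
  -- truncated estimate does not depend on `k`.
  set I : ℕ → Set ℝ := fun k => Set.Icc (-(k : ℝ)) k ∩ {t | 1 / ((k : ℝ) + 1) ≤ normFive F t} with hIdef
  have hI (k : ℕ) : MeasurableSet (I k) :=
    measurableSet_Icc.inter (measurableSet_le measurable_const (measurable_normFive hFm))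
  have hmono : Monotone I := by
    intro j k hjk
    have : (j : ℝ) ≤ k := by exact_mod_cast hjk
    refine Set.inter_subset_inter (Set.Icc_subset_Icc (by linarith) this) fun t ht => ?_
    refine le_trans ?_ (show 1 / ((j : ℝ) + 1) ≤ normFive F t from ht)
    gcongr
  have hU : ∫⁻ t, ENNReal.ofReal (normFive F t ^ 2) =
      ∫⁻ t in ⋃ k, I k, ENNReal.ofReal (normFive F t ^ 2) := by
    rw [← lintegral_indicator (MeasurableSet.iUnion hI)]
    refine lintegral_congr fun t => ?_
    by_cases ht : t ∈ ⋃ k, I k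
    · rw [Set.indicator_of_mem ht]
    · rw [Set.indicator_of_notMem ht]
      rcases (normFive_nonneg F t).eq_or_lt with h0 | h0
      · simp [← h0]
      · exfalso
        obtain ⟨k₁, hk₁⟩ := exists_nat_ge |t|
        obtain ⟨k₂, hk₂⟩ := exists_nat_one_div_lt h0
        refine ht (Set.mem_iUnion.2 ⟨max k₁ k₂, ⟨?_, ?_⟩⟩)
        · have : |t| ≤ (max k₁ k₂ : ℕ) := hk₁.trans (by exact_mod_cast le_max_left _ _)
          exact abs_le.1 this
        · refine le_trans ?_ hk₂.le
          have : (k₂ : ℝ) ≤ (max k₁ k₂ : ℕ) := by exact_mod_cast le_max_right _ _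
          gcongr
  rw [hU, setLIntegral_iUnion_of_directed _ hmono.directed_le]
  refine iSup_le fun k => setLIntegral_normFive_sq_le hFm hF hF2 hρ hsupp (hI k) ?_
    (ε := 1 / ((k : ℝ) + 1)) (by positivity) fun t ht => ht.2
  exact ((measure_mono Set.inter_subset_left).trans_lt measure_Icc_lt_top).ne

/-! ### The localized estimates for all four exponent pairs. -/

/-- The pairs of exponents of the norm of `Y(ℝ)`. -/
def IsExponent (q r : ℝ) : Prop :=
  (q = 2 ∧ r = 5) ∨ (q = 4 ∧ r = 5) ∨ (q = 4 ∧ r = 4) ∨ (q = 6 ∧ r = 3)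

/-- Cauchy–Schwarz on a ball of volume proportional to $ρ^5$. -/
lemma integral_norm_le_of_support {F : R5 → ℂ} (hFm : Measurable F) (hF : Integrable F)
    {η₀ : R5} {ρ : ℝ} (hρ : 0 < ρ) (hsupp : ∀ η, ρ < ‖η - η₀‖ → F η = 0) :
    ENNReal.ofReal (∫ η, ‖F η‖) ≤ (ENNReal.ofReal (ρ ^ 5) * volume (Metric.ball (0 : R5) 1) *
      ∫⁻ η, ‖F η‖ₑ ^ 2) ^ (1 / 2 : ℝ) := by
  have hb : MeasurableSet (Metric.closedBall η₀ ρ) := Metric.isClosed_closedBall.measurableSet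
  have hv : volume (Metric.closedBall η₀ ρ) = ENNReal.ofReal (ρ ^ 5) * volume (Metric.ball (0 : R5) 1) := by
    rw [Measure.addHaar_closedBall _ _ hρ.le]; simp
  rw [ofReal_integral_norm_eq_lintegral_enorm hF, ← hv]
  have h := sq_lintegral_mul_le (μ := (volume : Measure R5))
    (f := (Metric.closedBall η₀ ρ).indicator fun _ => 1) (g := fun η => ‖F η‖ₑ)
    (measurable_const.indicator hb).aemeasurable hFm.enorm.aemeasurable
  have e1 : ∀ η, (Metric.closedBall η₀ ρ).indicator (fun _ => (1 : ℝ≥0∞)) η * ‖F η‖ₑ = ‖F η‖ₑ := by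
    intro η
    by_cases hη : η ∈ Metric.closedBall η₀ ρ
    · simp [hη]
    · rw [hsupp η (by rw [Metric.mem_closedBall, dist_eq_norm] at hη; exact not_le.1 hη)]; simp
  have e2 : ∀ η, (Metric.closedBall η₀ ρ).indicator (fun _ => (1 : ℝ≥0∞)) η ^ 2 =
      (Metric.closedBall η₀ ρ).indicator (fun _ => (1 : ℝ≥0∞)) η := by
    intro η
    by_cases hη : η ∈ Metric.closedBall η₀ ρ <;> simp [hη]
  simp_rw [e1, e2] at h
  rw [lintegral_indicator_const hb, one_mul] at h
  calc ∫⁻ η, ‖F η‖ₑ = ((∫⁻ η, ‖F η‖ₑ) ^ 2) ^ (1 / 2 : ℝ) := by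
        rw [← ENNReal.rpow_natCast, ← ENNReal.rpow_mul]; norm_num
    _ ≤ _ := by gcongr

lemma lintegral_rpow_interpolate {α : Type*} [MeasurableSpace α] {μ : Measure α} {u : α → ℝ≥0∞}
    (hu : AEMeasurable u μ) {r a b : ℝ} (ha : 0 ≤ a) (hb : 0 ≤ b) (hab : a + b = 1)
    (hr : 2 * a + 5 * b = r) :
    ∫⁻ x, u x ^ r ∂μ ≤ (∫⁻ x, u x ^ 2 ∂μ) ^ a * (∫⁻ x, u x ^ (5 : ℝ) ∂μ) ^ b := by
  refine le_of_eq_of_le ?_ (ENNReal.lintegral_mul_norm_pow_le (f := fun x => u x ^ 2)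
    (g := fun x => u x ^ (5 : ℝ)) (by fun_prop) (by fun_prop) ha hb hab)
  refine lintegral_congr fun x => ?_
  rw [← ENNReal.rpow_natCast, ← ENNReal.rpow_mul, ← ENNReal.rpow_mul,
    ← ENNReal.rpow_add_of_nonneg _ _ (by positivity) (by positivity), ← hr]
  norm_num

/-- Bernstein's inequality: the supremum is at most of order $ρ^{5/2}\|F\|_2$, and interpolation
with $L^2$ gives $\|u\|_5^2\lesssimρ^{5/2\cdot 3\cdot 2/5}\|F\|_2^2=ρ^3\|F\|_2^2$. -/
lemma rpow_lintegral_evol_five_le {F : R5 → ℂ} (hFm : Measurable F) (hF : Integrable F)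
    (hF2 : MemLp F 2) {η₀ : R5} {ρ : ℝ} (hρ : 0 < ρ) (hsupp : ∀ η, ρ < ‖η - η₀‖ → F η = 0)
    (t : ℝ) :
    (∫⁻ x, ‖evol F t x‖ₑ ^ (5 : ℝ)) ^ (2 / 5 : ℝ) ≤
      volume (Metric.ball (0 : R5) 1) ^ (3 / 5 : ℝ) * ENNReal.ofReal ρ ^ 3 * ∫⁻ η, ‖F η‖ₑ ^ 2 := by
  set E := ∫⁻ η, ‖F η‖ₑ ^ 2 with hE
  set v := volume (Metric.ball (0 : R5) 1) with hv
  calc _ ≤ ((((ENNReal.ofReal (ρ ^ 5) * v * E) ^ (1 / 2 : ℝ)) ^ 3) * E) ^ (2 / 5 : ℝ) := by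
        refine ENNReal.rpow_le_rpow ((lintegral_evol_five_le hF hF2 t).trans ?_) (by norm_num)
        gcongr
        exact integral_norm_le_of_support hFm hF hρ hsupp
    _ = _ := by
        rw [ENNReal.ofReal_pow hρ.le, ← ENNReal.rpow_natCast, ← ENNReal.rpow_mul,
          ENNReal.mul_rpow_of_nonneg _ _ (by norm_num), ← ENNReal.rpow_mul,
          ENNReal.mul_rpow_of_nonneg _ _ (by norm_num), ENNReal.mul_rpow_of_nonneg _ _ (by norm_num),
          ← ENNReal.rpow_natCast, ← ENNReal.rpow_natCast, ← ENNReal.rpow_mul, mul_assoc,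
          ← ENNReal.rpow_add_of_nonneg _ _ (by norm_num) (by norm_num)]
        norm_num
        ring

/-- All the frequency-localized estimates for the norm of `Y(ℝ)`. -/
lemma exists_mixedPow_evol_le : ∃ C : ℝ≥0∞, C ≠ ∞ ∧ ∀ {F : R5 → ℂ}, Measurable F → Integrable F →
    MemLp F 2 → ∀ {η₀ : R5} {ρ : ℝ}, 0 < ρ → ρ ≤ 1 → (∀ η, ρ < ‖η - η₀‖ → F η = 0) →
    ∀ {q r : ℝ}, IsExponent q r →
    mixedPow volume volume q r (fun t x => ‖evol F t x‖ₑ) ≤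
      C * (ENNReal.ofReal ρ * ∫⁻ η, ‖F η‖ₑ ^ 2) ^ (q / 2) := by
  set v := volume (Metric.ball (0 : R5) 1) with hv
  have hvt : v ≠ ∞ := measure_ball_lt_top.ne
  set c := ENNReal.ofReal (2 * Real.exp 1 * strConst) with hc
  set b := v ^ (3 / 5 : ℝ) with hb
  have hbt : b ≠ ∞ := ENNReal.rpow_ne_top_of_nonneg (by norm_num) hvt
  have hbt' : b ^ (2 / 3 : ℝ) ≠ ∞ := ENNReal.rpow_ne_top_of_nonneg (by norm_num) hbt
  have hct : c ≠ ∞ := ENNReal.ofReal_ne_top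
  -- The summands serve the pairs $(2,5)$, $(4,5)$, and both $(4,4)$ and $(6,3)$, respectively.
  refine ⟨c + b * c + b ^ (2 / 3 : ℝ) * c, ENNReal.add_ne_top.2 ⟨ENNReal.add_ne_top.2
    ⟨hct, ENNReal.mul_ne_top hbt hct⟩, ENNReal.mul_ne_top hbt' hct⟩, ?_⟩
  intro F hFm hF hF2 η₀ ρ hρ hρ1 hsupp q r hqr
  have hstr := strConst_nonneg
  set E := ∫⁻ η, ‖F η‖ₑ ^ 2 with hE
  set R := ENNReal.ofReal ρ with hR
  have hR1 : R ≤ 1 := by rw [hR, ENNReal.ofReal_le_one]; exact hρ1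
  have hS : ∫⁻ t, (∫⁻ x, ‖evol F t x‖ₑ ^ (5 : ℝ)) ^ (2 / 5 : ℝ) ≤ c * (R * E) := by
    refine (lintegral_evol_five_rpow_le hFm hF hF2 hρ hsupp).trans_eq ?_
    rw [ENNReal.ofReal_mul (by positivity), mul_assoc]
  have hB (t : ℝ) : (∫⁻ x, ‖evol F t x‖ₑ ^ (5 : ℝ)) ^ (2 / 5 : ℝ) ≤ b * R ^ 3 * E :=
    rpow_lintegral_evol_five_le hFm hF hF2 hρ hsupp t
  have hR32 : (R ^ 3) ^ (2 / 3 : ℝ) = R ^ 2 := by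
    rw [← ENNReal.rpow_natCast, ← ENNReal.rpow_mul, ← ENNReal.rpow_natCast]; norm_num
  -- Here $2/3=4/15+2/5$: Bernstein is spent on the first part and the second is kept for
  -- Strichartz. Both $(4,4)$ and $(6,3)$ interpolate to this power.
  have hB' (t : ℝ) : (∫⁻ x, ‖evol F t x‖ₑ ^ (5 : ℝ)) ^ (2 / 3 : ℝ) ≤
      b ^ (2 / 3 : ℝ) * R ^ 2 * E ^ (2 / 3 : ℝ) *
        (∫⁻ x, ‖evol F t x‖ₑ ^ (5 : ℝ)) ^ (2 / 5 : ℝ) := by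
    calc _ = ((∫⁻ x, ‖evol F t x‖ₑ ^ (5 : ℝ)) ^ (2 / 5 : ℝ)) ^ (2 / 3 : ℝ) *
          (∫⁻ x, ‖evol F t x‖ₑ ^ (5 : ℝ)) ^ (2 / 5 : ℝ) := by
          rw [← ENNReal.rpow_mul, ← ENNReal.rpow_add_of_nonneg _ _ (by norm_num) (by norm_num)]
          norm_num
      _ ≤ (b * R ^ 3 * E) ^ (2 / 3 : ℝ) * _ := by gcongr; exact hB t
      _ = _ := by
          rw [ENNReal.mul_rpow_of_nonneg _ _ (by norm_num), ENNReal.mul_rpow_of_nonneg _ _ (by norm_num),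
            hR32]
  have hm (t : ℝ) : AEMeasurable (fun x => ‖evol F t x‖ₑ) :=
    (measurable_evol_apply hFm t).enorm.aemeasurable
  have hE23 : E ^ (1 / 3 : ℝ) * E ^ (2 / 3 : ℝ) = E := by
    rw [← ENNReal.rpow_add_of_nonneg _ _ (by norm_num) (by norm_num)]; norm_num
  have hE43 : E ^ (4 / 3 : ℝ) * E ^ (2 / 3 : ℝ) = E ^ 2 := by
    rw [← ENNReal.rpow_add_of_nonneg _ _ (by norm_num) (by norm_num), ← ENNReal.rpow_natCast]
    norm_num
  have hm5 := measurable_lintegral_evol hFm 5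
  unfold mixedPow
  rcases hqr with ⟨rfl, rfl⟩ | ⟨rfl, rfl⟩ | ⟨rfl, rfl⟩ | ⟨rfl, rfl⟩
  · refine hS.trans ?_
    rw [div_self two_ne_zero, ENNReal.rpow_one]
    gcongr
    exact le_self_add.trans le_self_add
  · calc _ ≤ ∫⁻ t, b * R ^ 3 * E * (∫⁻ x, ‖evol F t x‖ₑ ^ (5 : ℝ)) ^ (2 / 5 : ℝ) := by
          refine lintegral_mono fun t => ?_
          have : (4 / 5 : ℝ) = 2 / 5 + 2 / 5 := by norm_num
          rw [this, ENNReal.rpow_add_of_nonneg _ _ (by norm_num) (by norm_num)]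
          gcongr
          exact hB t
      _ ≤ b * R ^ 3 * E * (c * (R * E)) := by
          rw [lintegral_const_mul _ (by fun_prop)]; gcongr
      -- The pair $(4,5)$ gains more than is needed; the surplus power of `R` is dropped because `R
      -- ≤ 1`. The same happens for $(4,4)$, while $(6,3)$ fits exactly.
      _ = R ^ 2 * (b * c * (R * E) ^ 2) := by ring
      _ ≤ b * c * (R * E) ^ 2 := mul_le_of_le_one_left zero_le (pow_le_one₀ zero_le hR1)
      _ ≤ (c + b * c + b ^ (2 / 3 : ℝ) * c) * (R * E) ^ 2 := by
          gcongr
          exact le_add_self.trans le_self_add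
      _ = _ := by rw [← ENNReal.rpow_natCast]; norm_num
  · calc _ ≤ ∫⁻ t, E ^ (1 / 3 : ℝ) * (b ^ (2 / 3 : ℝ) * R ^ 2 * E ^ (2 / 3 : ℝ)) *
            (∫⁻ x, ‖evol F t x‖ₑ ^ (5 : ℝ)) ^ (2 / 5 : ℝ) := by
          refine lintegral_mono fun t => ?_
          rw [div_self four_ne_zero, ENNReal.rpow_one]
          refine (lintegral_rpow_interpolate (hm t) (a := 1 / 3) (b := 2 / 3) (by norm_num)
            (by norm_num) (by norm_num) (by norm_num)).trans ?_
          rw [lintegral_evol_sq hF hF2, mul_assoc]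
          gcongr
          exact hB' t
      _ ≤ E ^ (1 / 3 : ℝ) * (b ^ (2 / 3 : ℝ) * R ^ 2 * E ^ (2 / 3 : ℝ)) * (c * (R * E)) := by
          rw [lintegral_const_mul _ (by fun_prop)]; gcongr
      _ = R * (b ^ (2 / 3 : ℝ) * c * (R ^ 2 * (E ^ (1 / 3 : ℝ) * E ^ (2 / 3 : ℝ)) * E)) := by ring
      _ ≤ b ^ (2 / 3 : ℝ) * c * (R ^ 2 * (E ^ (1 / 3 : ℝ) * E ^ (2 / 3 : ℝ)) * E) :=
          mul_le_of_le_one_left zero_le hR1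
      _ = b ^ (2 / 3 : ℝ) * c * (R * E) ^ 2 := by rw [hE23]; ring
      _ ≤ (c + b * c + b ^ (2 / 3 : ℝ) * c) * (R * E) ^ 2 := by
          gcongr
          exact le_add_self
      _ = _ := by rw [← ENNReal.rpow_natCast]; norm_num
  · calc _ ≤ ∫⁻ t, E ^ (4 / 3 : ℝ) * (b ^ (2 / 3 : ℝ) * R ^ 2 * E ^ (2 / 3 : ℝ)) *
            (∫⁻ x, ‖evol F t x‖ₑ ^ (5 : ℝ)) ^ (2 / 5 : ℝ) := by
          refine lintegral_mono fun t => ?_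
          have := ENNReal.rpow_le_rpow (lintegral_rpow_interpolate (hm t) (r := 3) (a := 2 / 3)
            (b := 1 / 3) (by norm_num) (by norm_num) (by norm_num) (by norm_num))
            (show (0 : ℝ) ≤ 6 / 3 by norm_num)
          refine this.trans ?_
          rw [lintegral_evol_sq hF hF2, ENNReal.mul_rpow_of_nonneg _ _ (by norm_num),
            ← ENNReal.rpow_mul, ← ENNReal.rpow_mul, mul_assoc,
            show (2 / 3 * (6 / 3) : ℝ) = 4 / 3 by norm_num,
            show (1 / 3 * (6 / 3) : ℝ) = 2 / 3 by norm_num]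
          gcongr
          exact hB' t
      _ ≤ E ^ (4 / 3 : ℝ) * (b ^ (2 / 3 : ℝ) * R ^ 2 * E ^ (2 / 3 : ℝ)) * (c * (R * E)) := by
          rw [lintegral_const_mul _ (by fun_prop)]; gcongr
      _ = b ^ (2 / 3 : ℝ) * c * (R ^ 3 * (E ^ (4 / 3 : ℝ) * E ^ (2 / 3 : ℝ)) * E) := by ring
      _ = b ^ (2 / 3 : ℝ) * c * (R * E) ^ 3 := by rw [hE43]; ring
      _ ≤ (c + b * c + b ^ (2 / 3 : ℝ) * c) * (R * E) ^ 3 := by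
          gcongr
          exact le_add_self
      _ = _ := by rw [← ENNReal.rpow_natCast]; norm_num

/-! ### Moments and tails of Gaussian sums. -/

section Gaussian

variable {Ω : Type*} [MeasurableSpace Ω] {P : Measure Ω}

/-- Stated for real-linear functionals because real and imaginary parts of a complex Gaussian may be
correlated or of different size. The functional has a centred real Gaussian law of variance at most
$b^2V$. -/
lemma hasSubgaussianMGF_clm {X : Ω → ℂ} (h : HasGaussianLaw X P) (h0 : ∫ ω, X ω ∂P = 0) {V : ℝ}
    (hV : ∫ ω, ‖X ω‖ ^ 2 ∂P ≤ V) (L : ℂ →L[ℝ] ℝ) {b : ℝ} (hL : ∀ w, |L w| ≤ b * ‖w‖) :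
    HasSubgaussianMGF (fun ω => L (X ω)) (b ^ 2 * V).toNNReal P := by
  have hg := h.map_fun L
  have hmap := hg.map_eq_gaussianReal
  have hmean : ∫ ω, L (X ω) ∂P = 0 := by
    rw [L.integral_comp_comm h.integrable, h0, map_zero]
  have hvar : Var[fun ω => L (X ω); P] ≤ b ^ 2 * V := by
    rw [variance_of_integral_eq_zero hg.aemeasurable hmean]
    calc ∫ ω, L (X ω) ^ 2 ∂P ≤ ∫ ω, b ^ 2 * ‖X ω‖ ^ 2 ∂P := by
          refine integral_mono hg.memLp_two.integrable_sq
            (h.memLp_two.norm.integrable_sq.const_mul _) fun ω => ?_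
          show L (X ω) ^ 2 ≤ b ^ 2 * ‖X ω‖ ^ 2
          rw [← sq_abs, ← mul_pow]
          gcongr
          exact hL _
      _ ≤ b ^ 2 * V := by rw [integral_const_mul]; gcongr
  constructor
  · intro t
    have := integrable_exp_mul_gaussianReal (μ := ∫ ω, L (X ω) ∂P)
      (v := Var[fun ω => L (X ω); P].toNNReal) t
    rw [← hmap, integrable_map_measure (by fun_prop) hg.aemeasurable] at this
    exact this
  · intro t
    rw [mgf_gaussianReal hmap, hmean, Real.coe_toNNReal _ (variance_nonneg _ _), zero_mul, zero_add]
    gcongr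
    exact hvar.trans (Real.le_coe_toNNReal _)

lemma pow_le_factorial_mul_exp_add (y : ℝ) (n : ℕ) :
    y ^ (2 * n) ≤ (2 * n).factorial * (Real.exp y + Real.exp (-y)) := by
  have h1 := Real.pow_div_factorial_le_exp |y| (abs_nonneg y) (2 * n)
  rw [div_le_iff₀ (by positivity)] at h1
  have h2 : y ^ (2 * n) = |y| ^ (2 * n) := by rw [pow_mul, pow_mul, sq_abs]
  have h3 : Real.exp |y| ≤ Real.exp y + Real.exp (-y) := by
    rcases abs_cases y with ⟨h, _⟩ | ⟨h, _⟩ <;> rw [h]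
    · linarith [Real.exp_pos (-y)]
    · linarith [Real.exp_pos y]
  rw [h2]
  calc _ ≤ Real.exp |y| * (2 * n).factorial := h1
    _ ≤ (Real.exp y + Real.exp (-y)) * (2 * n).factorial := by gcongr
    _ = _ := mul_comm _ _

lemma exp_half_le_two : Real.exp (1 / 2) ≤ 2 := by
  have h := Real.exp_one_lt_d9
  have : Real.exp (1 / 2) ^ 2 = Real.exp 1 := by rw [← Real.exp_nat_mul]; norm_num
  nlinarith [Real.exp_pos (1 / 2)]

/-- The exponential moment is used at $θ^2=n/c$, where it is at most $e^{n/2}\le 2^n$. The $n^n$ in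
$(2n)!\le 4^n\,n!\,n^n$ cancels against $θ^{-2n}=(c/n)^n$, leaving a single factorial, as Gaussian
tails require. -/
lemma integral_pow_le_of_subgaussian {X : Ω → ℝ} {c : NNReal} (h : HasSubgaussianMGF X c P)
    (hc : 0 < c) {n : ℕ} (hn : 0 < n) :
    ∫⁻ ω, ENNReal.ofReal (X ω ^ (2 * n)) ∂P ≤ ENNReal.ofReal (2 * n.factorial * (8 * c) ^ n) := by
  have hc' : (0 : ℝ) < c := hc
  have hn' : (0 : ℝ) < n := by exact_mod_cast hn
  set θ : ℝ := Real.sqrt (n / c) with hθ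
  have hθ2 : θ ^ 2 = n / c := Real.sq_sqrt (by positivity)
  have hθ0 : 0 < θ := Real.sqrt_pos.2 (by positivity)
  have hi1 := h.integrable_exp_mul θ
  have hi2 := h.integrable_exp_mul (-θ)
  have hi3 : Integrable (fun ω => (2 * n).factorial * (c / n : ℝ) ^ n *
      (Real.exp (θ * X ω) + Real.exp (-θ * X ω))) P := (hi1.add hi2).const_mul _
  have hpt (ω : Ω) : X ω ^ (2 * n) ≤ (2 * n).factorial * (c / n) ^ n *
      (Real.exp (θ * X ω) + Real.exp (-θ * X ω)) := by
    have := pow_le_factorial_mul_exp_add (θ * X ω) n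
    rw [mul_pow, pow_mul θ, hθ2, ← neg_mul] at this
    calc X ω ^ (2 * n) = (c / n) ^ n * ((n / c) ^ n * X ω ^ (2 * n)) := by
          rw [← mul_assoc, ← mul_pow, div_mul_div_cancel₀ hn'.ne', div_self hc'.ne', one_pow, one_mul]
      _ ≤ (c / n) ^ n * ((2 * n).factorial * (Real.exp (θ * X ω) + Real.exp (-θ * X ω))) := by
          gcongr
      _ = _ := by ring
  have hexp (t : ℝ) (ht : t ^ 2 = n / c) : ∫ ω, Real.exp (t * X ω) ∂P ≤ Real.exp (1 / 2) ^ n := by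
    refine (h.mgf_le t).trans_eq ?_
    rw [ht, ← Real.exp_nat_mul]
    congr 1
    field_simp
  have hfac : ((2 * n).factorial : ℝ) ≤ 4 ^ n * n.factorial * n ^ n := by
    have h1 : (2 * n).factorial = Nat.centralBinom n * n.factorial * n.factorial := by
      rw [Nat.centralBinom_eq_two_mul_choose, Nat.two_mul, ← Nat.add_choose_mul_factorial_mul_factorial]
    have h2 : Nat.centralBinom n ≤ 4 ^ n := by
      rw [Nat.centralBinom_eq_two_mul_choose, show 4 = 2 ^ 2 by rfl, ← pow_mul]
      exact Nat.choose_le_two_pow _ _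
    have h3 : n.factorial ≤ n ^ n := Nat.factorial_le_pow n
    rw [h1]
    exact_mod_cast Nat.mul_le_mul (Nat.mul_le_mul_right _ h2) h3
  calc ∫⁻ ω, ENNReal.ofReal (X ω ^ (2 * n)) ∂P
      ≤ ∫⁻ ω, ENNReal.ofReal ((2 * n).factorial * (c / n) ^ n *
          (Real.exp (θ * X ω) + Real.exp (-θ * X ω))) ∂P :=
        lintegral_mono fun ω => ENNReal.ofReal_le_ofReal (hpt ω)
    _ = ENNReal.ofReal ((2 * n).factorial * (c / n) ^ n *
          (∫ ω, Real.exp (θ * X ω) ∂P + ∫ ω, Real.exp (-θ * X ω) ∂P)) := by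
        rw [← integral_add hi1 hi2, ← integral_const_mul,
          ofReal_integral_eq_lintegral_ofReal hi3
            (Filter.Eventually.of_forall fun ω => by positivity)]
    _ ≤ _ := by
        refine ENNReal.ofReal_le_ofReal ?_
        calc _ ≤ (4 ^ n * n.factorial * n ^ n) * (c / n : ℝ) ^ n * (2 ^ n + 2 ^ n) := by
              gcongr
              · exact (hexp θ hθ2).trans (pow_le_pow_left₀ (Real.exp_pos _).le exp_half_le_two n)
              · exact (hexp (-θ) (by rw [neg_sq, hθ2])).trans (pow_le_pow_left₀ (Real.exp_pos _).le exp_half_le_two n)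
          _ = 2 * n.factorial * (8 * c : ℝ) ^ n := by
              rw [div_pow, mul_pow, show (8 : ℝ) = 4 * 2 by norm_num, mul_pow]
              field_simp
              ring

variable [IsProbabilityMeasure P]

variable {J : Type*}

/-- Real and imaginary parts are separately sub-Gaussian with parameter $V\sum|z_j|^2$; their joint
law is not needed. Recombining them costs $2^n$, whence $16=2\cdot 8$. -/
lemma lintegral_gaussian_sum_pow_le {g : J → Ω → ℂ} (hg : ∀ j, HasGaussianLaw (g j) P)
    (hg0 : ∀ j, ∫ ω, g j ω ∂P = 0) {V : ℝ} (hV1 : 1 ≤ V) (hV : ∀ j, ∫ ω, ‖g j ω‖ ^ 2 ∂P ≤ V)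
    (hind : iIndepFun g P) (B : Finset J) (z : J → ℂ) {n : ℕ} (hn : 0 < n) :
    ∫⁻ ω, ‖∑ j ∈ B, g j ω * z j‖ₑ ^ (2 * n) ∂P ≤
      ENNReal.ofReal (4 * n.factorial * (16 * V) ^ n) * (∑ j ∈ B, ‖z j‖ₑ ^ 2) ^ n := by
  have hV0 : 0 < V := by linarith
  set c : NNReal := ∑ j ∈ B, (‖z j‖ ^ 2 * V).toNNReal with hc
  have hcr : (c : ℝ) = V * ∑ j ∈ B, ‖z j‖ ^ 2 := by
    rw [hc, NNReal.coe_sum, Finset.mul_sum]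
    refine Finset.sum_congr rfl fun j _ => ?_
    rw [Real.coe_toNNReal _ (by positivity), mul_comm]
  have hsum : ∑ j ∈ B, ‖z j‖ₑ ^ 2 = ENNReal.ofReal (∑ j ∈ B, ‖z j‖ ^ 2) := by
    rw [ENNReal.ofReal_sum_of_nonneg fun j _ => by positivity]
    refine Finset.sum_congr rfl fun j _ => ?_
    rw [ENNReal.ofReal_pow (norm_nonneg _), ofReal_norm]
  -- The choice $θ^2=n/c$ needs a positive parameter; if it is zero, all coefficients vanish.
  rcases eq_or_lt_of_le (zero_le (a := c)) with hc0 | hc0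
  · have hz : ∀ j ∈ B, z j = 0 := by
      have h1 : ∑ j ∈ B, ‖z j‖ ^ 2 = 0 := by
        rw [← hc0] at hcr
        simpa [hV0.ne'] using hcr
      rw [Finset.sum_eq_zero_iff_of_nonneg fun j _ => by positivity] at h1
      intro j hj
      simpa using h1 j hj
    have : ∀ ω, ∑ j ∈ B, g j ω * z j = 0 := fun ω =>
      Finset.sum_eq_zero fun j hj => by rw [hz j hj, mul_zero]
    simp [this, hn.ne']
  have hsub (M : ℂ →L[ℝ] ℝ) (hM : ∀ w, |M w| ≤ ‖w‖) :
      HasSubgaussianMGF (fun ω => ∑ j ∈ B, M (g j ω * z j)) c P := by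
    have hL (j : J) : HasSubgaussianMGF (fun ω => M (g j ω * z j)) (‖z j‖ ^ 2 * V).toNNReal P := by
      refine hasSubgaussianMGF_clm (hg j) (hg0 j) (hV j)
        (M.comp ((ContinuousLinearMap.mul ℝ ℂ).flip (z j))) fun w => ?_
      refine (hM _).trans_eq ?_
      simp [mul_comm]
    have hi : iIndepFun (fun j ω => M (g j ω * z j)) P :=
      hind.comp (fun j w => M (w * z j)) fun j => by fun_prop
    exact HasSubgaussianMGF.sum_of_iIndepFun hi fun j _ => hL j
  have hre := integral_pow_le_of_subgaussian (hsub Complex.reCLM Complex.abs_re_le_norm) hc0 hn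
  have him := integral_pow_le_of_subgaussian (hsub Complex.imCLM Complex.abs_im_le_norm) hc0 hn
  have hpt (ω : Ω) : ‖∑ j ∈ B, g j ω * z j‖ₑ ^ (2 * n) ≤
      ENNReal.ofReal (2 ^ n) * (ENNReal.ofReal ((∑ j ∈ B, Complex.reCLM (g j ω * z j)) ^ (2 * n)) +
        ENNReal.ofReal ((∑ j ∈ B, Complex.imCLM (g j ω * z j)) ^ (2 * n))) := by
    rw [← map_sum, ← map_sum, Complex.reCLM_apply, Complex.imCLM_apply]
    set w := ∑ j ∈ B, g j ω * z j
    rw [← ofReal_norm, ← ENNReal.ofReal_pow (norm_nonneg _),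
      ← ENNReal.ofReal_add (by rw [pow_mul]; positivity) (by rw [pow_mul]; positivity),
      ← ENNReal.ofReal_mul (by positivity)]
    refine ENNReal.ofReal_le_ofReal ?_
    rw [pow_mul, pow_mul, pow_mul, Complex.sq_norm, Complex.normSq_apply, ← sq, ← sq]
    have h1 : w.re ^ 2 + w.im ^ 2 ≤ 2 * max (w.re ^ 2) (w.im ^ 2) := by
      linarith [le_max_left (w.re ^ 2) (w.im ^ 2), le_max_right (w.re ^ 2) (w.im ^ 2)]
    calc (w.re ^ 2 + w.im ^ 2) ^ n ≤ (2 * max (w.re ^ 2) (w.im ^ 2)) ^ n := by gcongr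
      _ = 2 ^ n * max (w.re ^ 2) (w.im ^ 2) ^ n := mul_pow _ _ _
      _ ≤ _ := by
        gcongr
        rcases max_cases (w.re ^ 2) (w.im ^ 2) with ⟨h, _⟩ | ⟨h, _⟩ <;> rw [h]
        · exact le_add_of_nonneg_right (by positivity)
        · exact le_add_of_nonneg_left (by positivity)
  have hm1 : AEMeasurable (fun ω => ENNReal.ofReal ((∑ j ∈ B, Complex.reCLM (g j ω * z j)) ^ (2 * n))) P :=
    ((hsub Complex.reCLM Complex.abs_re_le_norm).aemeasurable.pow_const _).ennreal_ofReal
  calc _ ≤ _ := lintegral_mono hpt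
    _ ≤ ENNReal.ofReal (2 ^ n) * (ENNReal.ofReal (2 * n.factorial * (8 * c) ^ n) +
          ENNReal.ofReal (2 * n.factorial * (8 * c) ^ n)) := by
        rw [lintegral_const_mul' _ _ ENNReal.ofReal_ne_top, lintegral_add_left' hm1]
        gcongr
    _ = _ := by
        rw [hsum, ← ENNReal.ofReal_add (by positivity) (by positivity),
          ← ENNReal.ofReal_mul (by positivity), ← ENNReal.ofReal_pow (Finset.sum_nonneg fun j _ => by positivity),
          ← ENNReal.ofReal_mul (by positivity), hcr]
        congr 1
        rw [mul_pow, mul_pow V, mul_pow 16, show (16 : ℝ) ^ n = 2 ^ n * 8 ^ n by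
          rw [← mul_pow]; norm_num]
        ring

end Gaussian

/-- Factorial moments give Gaussian tails. -/
lemma measure_gt_le_of_moments {Ω : Type*} [MeasurableSpace Ω] {P : Measure Ω}
    [IsProbabilityMeasure P] {Y : Ω → ℝ≥0∞} (hY : AEMeasurable Y P) {Q : ℝ} (hQ : 0 < Q)
    (h : ∀ n : ℕ, 3 ≤ n → ∫⁻ ω, Y ω ^ (2 * n) ∂P ≤ ENNReal.ofReal (4 * n.factorial * Q ^ n))
    {l : ℝ} (hl : 0 < l) :
    P {ω | ENNReal.ofReal l < Y ω} ≤ ENNReal.ofReal (Real.exp 6 * Real.exp (-(l ^ 2 / (4 * Q)))) := by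
  set y : ℝ := l ^ 2 / Q with hy
  have hy0 : 0 < y := by positivity
  have hyQ : l ^ 2 / (4 * Q) = y / 4 := by rw [hy]; field_simp
  rw [hyQ, ← Real.exp_add]
  -- Below this threshold the asserted bound exceeds one. Above it the moment order is at least
  -- three, where the hypothesis applies.
  by_cases hy6 : y < 6
  · refine prob_le_one.trans ?_
    rw [ENNReal.one_le_ofReal, Real.one_le_exp_iff]
    linarith
  -- With $n\approx y/2$, Chebyshev gives $4\,n!\,y^{-n}\le 4\cdot 2^{-n}\le 4e^{-n/2}$. The factor
  -- $e^6$ absorbs the 4 and the rounding $n>y/2-1$.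
  set n := ⌊y / 2⌋₊ with hn
  have hn3 : 3 ≤ n := Nat.le_floor (by push_cast; linarith)
  have hny : (n : ℝ) ≤ y / 2 := Nat.floor_le (by positivity)
  have hny' : y / 2 < n + 1 := Nat.lt_floor_add_one _
  have hm := mul_meas_ge_le_lintegral₀ (μ := P) (f := fun ω => Y ω ^ (2 * n)) (by fun_prop)
    (ENNReal.ofReal (l ^ (2 * n)))
  have hsub : {ω | ENNReal.ofReal l < Y ω} ⊆ {ω | ENNReal.ofReal (l ^ (2 * n)) ≤ Y ω ^ (2 * n)} := by
    intro ω (hω : ENNReal.ofReal l < Y ω)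
    show ENNReal.ofReal (l ^ (2 * n)) ≤ Y ω ^ (2 * n)
    rw [ENNReal.ofReal_pow hl.le]
    gcongr
  have h1 : P {ω | ENNReal.ofReal l < Y ω} ≤
      ENNReal.ofReal ((l ^ (2 * n))⁻¹) * ENNReal.ofReal (4 * n.factorial * Q ^ n) := by
    calc _ ≤ P {ω | ENNReal.ofReal (l ^ (2 * n)) ≤ Y ω ^ (2 * n)} := measure_mono hsub
      _ = ENNReal.ofReal ((l ^ (2 * n))⁻¹) * (ENNReal.ofReal (l ^ (2 * n)) *
          P {ω | ENNReal.ofReal (l ^ (2 * n)) ≤ Y ω ^ (2 * n)}) := by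
          rw [← mul_assoc, ← ENNReal.ofReal_mul (by positivity), inv_mul_cancel₀ (by positivity)]
          simp
      _ ≤ _ := by gcongr; exact hm.trans (h n hn3)
  refine h1.trans ?_
  rw [← ENNReal.ofReal_mul (by positivity)]
  refine ENNReal.ofReal_le_ofReal ?_
  have hfac : (n.factorial : ℝ) ≤ (y / 2) ^ n := by
    calc (n.factorial : ℝ) ≤ (n : ℝ) ^ n := by exact_mod_cast Nat.factorial_le_pow n
      _ ≤ _ := by gcongr
  have hexp : Real.exp (1 / 2) ^ n ≤ 2 ^ n := by gcongr; exact exp_half_le_two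
  calc (l ^ (2 * n))⁻¹ * (4 * n.factorial * Q ^ n) = 4 * n.factorial * (y ^ n)⁻¹ := by
        rw [hy, div_pow, pow_mul]; field_simp
    _ ≤ 4 * (y / 2) ^ n * (y ^ n)⁻¹ := by gcongr
    _ = 4 * (2 ^ n)⁻¹ := by rw [div_pow]; field_simp
    _ ≤ 4 * (Real.exp (1 / 2) ^ n)⁻¹ := by gcongr
    _ = 4 * Real.exp (-(n / 2)) := by
        rw [← Real.exp_nat_mul, ← Real.exp_neg]; congr 2; ring
    _ ≤ Real.exp 5 * Real.exp (-(n / 2)) := by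
        gcongr
        linarith [Real.add_one_le_exp 5]
    _ ≤ _ := by
        rw [← Real.exp_add]
        refine Real.exp_le_exp.2 ?_
        linarith

/-! ### Random series in mixed norms -/

section RandomSeries

/-- A summable family can be exhausted by finite sets with geometrically decreasing tails. -/
lemma exists_exhaustion {J : Type*} [Countable J] [Nonempty J] [DecidableEq J] {e : J → ℝ≥0∞}
    {m : ℝ≥0∞} (hm : m ≠ 0) (hm' : m ≠ ∞) (he : ∑' j, e j ≤ m) :
    ∃ A : ℕ → Finset J, Monotone A ∧ A 0 = ∅ ∧ (∀ j, ∃ k, j ∈ A k) ∧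
      ∀ k, ∑ j ∈ A (k + 1) \ A k, e j ≤ (4⁻¹ : ℝ≥0∞) ^ k * m := by
  have hlim := ENNReal.tendsto_tsum_compl_atTop_zero (ne_top_of_le_ne_top hm' he)
  have hpos (k : ℕ) : (0 : ℝ≥0∞) < (4⁻¹ : ℝ≥0∞) ^ k * m :=
    ENNReal.mul_pos (pow_ne_zero _ (by simp)) hm
  have hev (k : ℕ) := ((tendsto_order.1 hlim).2 _ (hpos k)).exists_forall_of_atTop
  choose s hs using hev
  obtain ⟨σ, hσ⟩ := exists_surjective_nat J
  -- The points `σ i` ensure exhaustion. The sets `s (i + 1)` ensure that `A (k + 1)` contains `s (k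
  -- + 1)`, so every later block has small mass; block zero uses only the total mass.
  refine ⟨fun k => (Finset.range k).biUnion fun i => insert (σ i) (s (i + 1)),
    fun k l hkl => Finset.biUnion_subset_biUnion_of_subset_left _ (Finset.range_mono hkl), by simp,
    fun j => ?_, fun k => ?_⟩
  · obtain ⟨i, rfl⟩ := hσ j
    exact ⟨i + 1, Finset.mem_biUnion.2 ⟨i, by simp, by simp⟩⟩
  · rcases k with _ | k
    · simpa using (ENNReal.sum_le_tsum _).trans he
    · set A := fun k : ℕ => (Finset.range k).biUnion fun i => insert (σ i) (s (i + 1)) with hA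
      have hsub : s (k + 1) ⊆ A (k + 1) := fun j hj =>
        Finset.mem_biUnion.2 ⟨k, by simp, by simp [hj]⟩
      refine le_trans ?_ (hs (k + 1) _ hsub).le
      have e1 : ∑ j ∈ A (k + 1 + 1) \ A (k + 1), e j =
          ∑ j ∈ A (k + 1 + 1) \ A (k + 1), {j | j ∉ A (k + 1)}.indicator e j := by
        refine Finset.sum_congr rfl fun j hj => ?_
        rw [Set.indicator_of_mem]
        exact (Finset.mem_sdiff.1 hj).2
      calc _ = _ := e1
        _ ≤ ∑' j, {j | j ∉ A (k + 1)}.indicator e j := ENNReal.sum_le_tsum _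
        _ = _ := (tsum_subtype _ _).symm

/-- Cauchy–Schwarz against the weights $2^{-k}$, of total mass 2. The cost $2^k$ is affordable since
block masses decay like $4^{-k}$. -/
lemma tsum_sqrt_le (y : ℕ → ℝ≥0∞) :
    ∑' k, y k ^ (1 / 2 : ℝ) ≤ (∑' k, 2 * 2 ^ k * y k) ^ (1 / 2 : ℝ) := by
  have h := sq_lintegral_mul_le (μ := (Measure.count : Measure ℕ))
    (f := fun k => (2⁻¹ ^ k : ℝ≥0∞) ^ (1 / 2 : ℝ)) (g := fun k => (2 ^ k * y k) ^ (1 / 2 : ℝ))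
    (measurable_of_countable _).aemeasurable (measurable_of_countable _).aemeasurable
  have e1 (k : ℕ) : (2⁻¹ ^ k : ℝ≥0∞) ^ (1 / 2 : ℝ) * (2 ^ k * y k) ^ (1 / 2 : ℝ) =
      y k ^ (1 / 2 : ℝ) := by
    rw [← ENNReal.mul_rpow_of_nonneg _ _ (by norm_num), ← mul_assoc, ← mul_pow,
      ENNReal.inv_mul_cancel (by simp) (by simp)]
    simp
  have e2 (z : ℝ≥0∞) : (z ^ (1 / 2 : ℝ)) ^ 2 = z := by
    rw [← ENNReal.rpow_natCast, ← ENNReal.rpow_mul]; norm_num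
  simp only [lintegral_count, e1, e2, ENNReal.tsum_geometric, ENNReal.one_sub_inv_two, inv_inv,
    ← ENNReal.tsum_mul_left, ← mul_assoc] at h
  calc _ = ((∑' k, y k ^ (1 / 2 : ℝ)) ^ 2) ^ (1 / 2 : ℝ) := by
        rw [← ENNReal.rpow_natCast, ← ENNReal.rpow_mul]; norm_num
    _ ≤ _ := by gcongr

section Blocks

variable {J : Type*} (B : ℕ → Finset J)

open Classical in
/-- The weight `2 ^ (k + 1)` on the elements of the `k`-th block. -/
def blockWeight (i : ℕ × J) : ℝ≥0∞ := if i.2 ∈ B i.1 then 2 * 2 ^ i.1 else 0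

lemma tsum_blockWeight_mul (y : J → ℝ≥0∞) :
    ∑' i : ℕ × J, blockWeight B i * y i.2 = ∑' k, 2 * 2 ^ k * ∑ j ∈ B k, y j := by
  rw [ENNReal.tsum_prod']
  refine tsum_congr fun k => ?_
  rw [tsum_eq_sum (s := B k) (fun j hj => by simp [blockWeight, hj]), Finset.mul_sum]
  exact Finset.sum_congr rfl fun j hj => by simp [blockWeight, hj]

/-- The square function of a family, weighted along the blocks. -/
def blockSquare {α β : Type*} (u : J → α → β → ℂ) (t : α) (x : β) : ℝ≥0∞ :=
  (∑' i : ℕ × J, blockWeight B i * ‖u i.2 t x‖ₑ ^ (2 : ℝ)) ^ (1 / 2 : ℝ)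

variable {B}

lemma tsum_blockWeight_mul_le {e : J → ℝ≥0∞} {G : ℝ}
    (hB : ∀ k, ∑ j ∈ B k, e j ≤ (4⁻¹ : ℝ≥0∞) ^ k * ENNReal.ofReal G) :
    ∑' i : ℕ × J, blockWeight B i * e i.2 ≤ ENNReal.ofReal (4 * G) := by
  calc _ = ∑' k, 2 * 2 ^ k * ∑ j ∈ B k, e j := tsum_blockWeight_mul B e
    _ ≤ ∑' k : ℕ, 2 * 2 ^ k * ((4⁻¹ : ℝ≥0∞) ^ k * ENNReal.ofReal G) := by
        refine ENNReal.tsum_le_tsum fun k => ?_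
        gcongr
        exact hB k
    _ = ∑' k : ℕ, (2 * ENNReal.ofReal G) * (2⁻¹ : ℝ≥0∞) ^ k := by
        refine tsum_congr fun k => ?_
        have : (4⁻¹ : ℝ≥0∞) = 2⁻¹ * 2⁻¹ := by
          rw [← ENNReal.mul_inv (by simp) (by simp)]; norm_num
        rw [this, mul_pow]
        have h1 : (2 : ℝ≥0∞) ^ k * 2⁻¹ ^ k = 1 := by
          rw [← mul_pow, ENNReal.mul_inv_cancel (by simp) (by simp), one_pow]
        calc _ = 2 * ENNReal.ofReal G * (2⁻¹ : ℝ≥0∞) ^ k * ((2 : ℝ≥0∞) ^ k * 2⁻¹ ^ k) := by ring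
          _ = _ := by rw [h1, mul_one]
    _ = ENNReal.ofReal (4 * G) := by
        rw [ENNReal.tsum_mul_left, ENNReal.tsum_geometric, ENNReal.one_sub_inv_two, inv_inv,
          ENNReal.ofReal_mul (by norm_num), mul_right_comm]
        norm_num

lemma mixedPow_blockSquare_le {α β : Type*} [MeasurableSpace α] [MeasurableSpace β] {μ : Measure α}
    {ν : Measure β} [SFinite μ] [SFinite ν] [Countable J] {u : J → α → β → ℂ}
    (hu : ∀ j, Measurable (Function.uncurry (u j))) {q r : ℝ} (hq2 : 2 ≤ q) (hr2 : 2 ≤ r)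
    {e : J → ℝ≥0∞} (hue : ∀ j, mixedPow μ ν q r (fun t x => ‖u j t x‖ₑ) ≤ e j ^ (q / 2)) {G : ℝ}
    (hB : ∀ k, ∑ j ∈ B k, e j ≤ (4⁻¹ : ℝ≥0∞) ^ k * ENNReal.ofReal G) :
    mixedPow μ ν q r (blockSquare B u) ≤ ENNReal.ofReal (4 * G) ^ (q / 2) := by
  refine (mixedPow_sqrt_tsum_le (u := fun i : ℕ × J => fun t x => ‖u i.2 t x‖ₑ)
    (fun i => (hu i.2).enorm) hq2 hr2 (blockWeight B)).trans ?_
  refine ENNReal.rpow_le_rpow ((ENNReal.tsum_le_tsum fun i => ?_).trans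
    (tsum_blockWeight_mul_le hB)) (by linarith)
  refine mul_le_mul_right ((ENNReal.rpow_le_rpow (hue i.2) (by positivity)).trans_eq ?_) _
  have hq0 : q ≠ 0 := by linarith
  rw [← ENNReal.rpow_mul, div_mul_div_cancel₀ two_ne_zero, div_self hq0, ENNReal.rpow_one]

/-- Minkowski in $L^{2n}(Ω)$ separates the blocks, each finite block gets the Gaussian moment bound,
and weighted Cauchy–Schwarz recombines them into one square function. -/
lemma lintegral_block_sum_rpow_le {Ω α β : Type*} [MeasurableSpace Ω] {P : Measure Ω}
    [IsProbabilityMeasure P] {g : J → Ω → ℂ} (hgm : ∀ j, Measurable (g j))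
    (hg : ∀ j, HasGaussianLaw (g j) P)
    (hg0 : ∀ j, ∫ ω, g j ω ∂P = 0) {V : ℝ} (hV1 : 1 ≤ V) (hV : ∀ j, ∫ ω, ‖g j ω‖ ^ 2 ∂P ≤ V)
    (hind : iIndepFun g P) (u : J → α → β → ℂ) {n : ℕ} (hn : 0 < n) (t : α) (x : β) :
    ∫⁻ ω, (∑' k, ‖∑ j ∈ B k, g j ω * u j t x‖ₑ) ^ ((2 * n : ℕ) : ℝ) ∂P ≤
      ENNReal.ofReal (4 * n.factorial * (16 * V) ^ n) *
        blockSquare B u t x ^ ((2 * n : ℕ) : ℝ) := by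
  have hD : ENNReal.ofReal (4 * n.factorial * (16 * V) ^ n) ≠ 0 := by
    rw [Ne, ENNReal.ofReal_eq_zero, not_le]; positivity
  have hn1 : (1 : ℝ) ≤ (2 * n : ℕ) := by
    have : (1 : ℝ) ≤ n := by exact_mod_cast hn
    push_cast; linarith
  refine (lintegral_tsum_rpow_le (f := fun k ω => ‖∑ j ∈ B k, g j ω * u j t x‖ₑ)
    (w := fun k => (∑ j ∈ B k, ‖u j t x‖ₑ ^ 2) ^ (1 / 2 : ℝ)) (fun k => ?_) hn1 hD
    (fun k => ?_)).trans ?_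
  · exact (Finset.measurable_sum _ fun j _ => (hgm j).mul_const _).enorm
  · rw [← ENNReal.rpow_mul]
    have : (1 / 2 : ℝ) * ((2 * n : ℕ) : ℝ) = n := by push_cast; ring
    rw [this]
    simp only [ENNReal.rpow_natCast]
    exact lintegral_gaussian_sum_pow_le hg hg0 hV1 hV hind (B k) (fun j => u j t x) hn
  · refine mul_le_mul_right (ENNReal.rpow_le_rpow ((tsum_sqrt_le _).trans_eq ?_) (by positivity)) _
    rw [blockSquare, ← tsum_blockWeight_mul]
    simp only [ENNReal.rpow_two]

end Blocks

/-- Gaussian tail bound for the mixed norm of a random series, summed in blocks. -/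
theorem measure_mixedPow_block_gt_le {Ω α β J : Type*} [MeasurableSpace Ω] {P : Measure Ω}
    [IsProbabilityMeasure P] [MeasurableSpace α] [MeasurableSpace β] {μ : Measure α}
    {ν : Measure β} [SFinite μ] [SFinite ν] [Countable J] {g : J → Ω → ℂ}
    (hgm : ∀ j, Measurable (g j)) (hg : ∀ j, HasGaussianLaw (g j) P)
    (hg0 : ∀ j, ∫ ω, g j ω ∂P = 0) {V : ℝ} (hV1 : 1 ≤ V) (hV : ∀ j, ∫ ω, ‖g j ω‖ ^ 2 ∂P ≤ V)
    (hind : iIndepFun g P) {u : J → α → β → ℂ} (hu : ∀ j, Measurable (Function.uncurry (u j)))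
    {q r : ℝ} (hq2 : 2 ≤ q) (hq6 : q ≤ 6) (hr2 : 2 ≤ r) (hr6 : r ≤ 6) {e : J → ℝ≥0∞}
    (hue : ∀ j, mixedPow μ ν q r (fun t x => ‖u j t x‖ₑ) ≤ e j ^ (q / 2)) {G : ℝ} (hG : 0 < G)
    (B : ℕ → Finset J) (hB : ∀ k, ∑ j ∈ B k, e j ≤ (4⁻¹ : ℝ≥0∞) ^ k * ENNReal.ofReal G)
    {l : ℝ} (hl : 0 < l) :
    P {ω | ENNReal.ofReal l <
        mixedPow μ ν q r (fun t x => ∑' k, ‖∑ j ∈ B k, g j ω * u j t x‖ₑ) ^ (1 / q)} ≤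
      ENNReal.ofReal (Real.exp 6 * Real.exp (-(l ^ 2 / (4 * (64 * V * G))))) := by
  have hq0 : 0 < q := by linarith
  have hr0 : 0 < r := by linarith
  set S : Ω → α → β → ℝ≥0∞ := fun ω t x => ∑' k, ‖∑ j ∈ B k, g j ω * u j t x‖ₑ with hSdef
  have hterm (k : ℕ) : Measurable fun z : Ω × α × β =>
      ‖∑ j ∈ B k, g j z.1 * u j z.2.1 z.2.2‖ₑ := by
    refine (Finset.measurable_sum _ fun j _ => Measurable.mul ?_ ?_).enorm
    · exact (hgm j).comp measurable_fst
    · exact (hu j).comp measurable_snd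
  have hS : Measurable fun z : Ω × α × β => S z.1 z.2.1 z.2.2 := Measurable.tsum hterm
  have hWm : Measurable (Function.uncurry (blockSquare B u)) := by
    refine (Measurable.tsum fun i => ?_).pow_const _
    exact ((hu i.2).enorm.pow_const _).const_mul _
  -- Here $64=16\cdot 4$: 16 from the Gaussian moments and 4 from the weighted sum over blocks.
  refine measure_gt_le_of_moments (Q := 64 * V * G) ?_ (by positivity) (fun n hn => ?_) hl
  · have h1 : Measurable fun z : (Ω × α) × β => S z.1.1 z.1.2 z.2 ^ r :=
      (hS.comp (by fun_prop : Measurable fun z : (Ω × α) × β => (z.1.1, z.1.2, z.2))).pow_const r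
    have h2 : Measurable fun z : Ω × α => (∫⁻ x, S z.1 z.2 x ^ r ∂ν) ^ (q / r) :=
      h1.lintegral_prod_right'.pow_const _
    exact (h2.lintegral_prod_right'.pow_const _).aemeasurable
  -- The restriction `3 ≤ n` on the moments is there so that `2 * n` dominates both exponents in
  -- Minkowski's inequality.
  · have hn' : (6 : ℝ) ≤ (2 * n : ℕ) := by
      have : (3 : ℝ) ≤ n := by exact_mod_cast hn
      push_cast; linarith
    have hD : ENNReal.ofReal (4 * n.factorial * (16 * V) ^ n) ≠ 0 := by
      rw [Ne, ENNReal.ofReal_eq_zero, not_le]; positivity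
    have key := lintegral_mixedPow_rpow_le (μ := μ) (ν := ν) hS hWm hq0 hr0 (hq6.trans hn')
      (hr6.trans hn') hD
      (lintegral_block_sum_rpow_le hgm hg hg0 hV1 hV hind u (by omega))
    calc _ = ∫⁻ ω, mixedPow μ ν q r (S ω) ^ (((2 * n : ℕ) : ℝ) / q) ∂P := by
          refine lintegral_congr fun ω => ?_
          rw [← ENNReal.rpow_natCast, ← ENNReal.rpow_mul, one_div_mul_eq_div]
      _ ≤ _ := key
      _ ≤ ENNReal.ofReal (4 * n.factorial * (16 * V) ^ n) * ENNReal.ofReal (4 * G) ^ n := by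
          gcongr
          refine (ENNReal.rpow_le_rpow (mixedPow_blockSquare_le hu hq2 hr2 hue hB) (by positivity)).trans_eq ?_
          rw [← ENNReal.rpow_mul, ← ENNReal.rpow_natCast]
          congr 1
          push_cast
          field_simp
      _ = _ := by
          rw [← ENNReal.ofReal_pow (by positivity), ← ENNReal.ofReal_mul (by positivity)]
          congr 1
          rw [mul_assoc, ← mul_pow]
          congr 2
          ring

end RandomSeries

/-! ### Geometry of the cubes -/

section Cubes

variable {a : ℕ}

lemma side_pos (a k : ℕ) : 0 < side a k := by unfold side; positivity

lemma side_le_one (a k : ℕ) : side a k ≤ 1 :=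
  inv_le_one_of_one_le₀ (one_le_pow₀ (one_le_pow₀ one_le_two))

/-- The scale of a cube: its side length, or `1` for the central cube. -/
def scale : CubeIndex a → ℝ
  | none => 1
  | some p => side a p.1.1

lemma scale_pos (j : CubeIndex a) : 0 < scale j := by
  rcases j with _ | p
  · exact one_pos
  · exact side_pos _ _

lemma scale_le_one (j : CubeIndex a) : scale j ≤ 1 := by
  rcases j with _ | p
  · exact le_rfl
  · exact side_le_one _ _

lemma abs_le_of_mem_doubleCube_none {ξ : R5} (h : ξ ∈ doubleCube (none : CubeIndex a)) (i : Fin 5) :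
    |ξ i| ≤ 2 := by
  have := h i
  simp only [cubeCenter, PiLp.smul_apply,
    smul_eq_mul, zero_add, sub_zero, abs_le] at this
  rw [abs_le]
  constructor <;> linarith [this.1, this.2]

lemma abs_sub_lt_of_mem_doubleCube_some {p : ShellCubes a} {ξ : R5}
    (h : ξ ∈ doubleCube (some p)) (i : Fin 5) :
    |ξ i - ((p.1.2 i : ℝ) + 1 / 2) * side a p.1.1| < side a p.1.1 := by
  have := h i
  simp only [cubeCenter, PiLp.add_apply, PiLp.smul_apply, PiLp.sub_apply, smul_eq_mul] at this
  rw [abs_lt]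
  constructor <;> linarith [this.1, this.2]

lemma norm_sq_le_of_abs_le {x : R5} {b : ℝ} (h : ∀ i, |x i| ≤ b) : ‖x‖ ^ 2 ≤ 5 * b ^ 2 := by
  rw [EuclideanSpace.real_norm_sq_eq]
  calc ∑ i, x i ^ 2 ≤ ∑ _i : Fin 5, b ^ 2 := Finset.sum_le_sum fun i _ => sq_le_sq' (abs_le.1 (h i)).1 (abs_le.1 (h i)).2
    _ = _ := by simp

lemma abs_apply_le_norm (x : R5) (i : Fin 5) : |x i| ≤ ‖x‖ := by
  simpa using PiLp.norm_apply_le x i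

/-- A doubled cube has radius at most $\sqrt{20}<2π$ times its scale. The $2π$ disappears in the
variable $η=ξ/2π$, where the support lies in a ball of radius `scale j`. -/
lemma norm_sub_cubeCenter_le {j : CubeIndex a} {ξ : R5} (h : ξ ∈ doubleCube j) :
    ‖ξ - cubeCenter j‖ ≤ 2 * Real.pi * scale j := by
  have key : ∀ b : ℝ, 0 ≤ b → (∀ i, |(ξ - cubeCenter j) i| ≤ 2 * b) →
      ‖ξ - cubeCenter j‖ ≤ 2 * Real.pi * b := by
    intro b hb hi
    refine abs_le_of_sq_le_sq' ?_ (by positivity) |>.2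
    refine (norm_sq_le_of_abs_le hi).trans ?_
    have := Real.pi_gt_three
    nlinarith [mul_nonneg (sq_nonneg b) (sub_nonneg.2 this.le), sq_nonneg b]
  refine key _ (scale_pos j).le fun i => ?_
  rcases j with _ | p
  · simpa [cubeCenter, scale] using abs_le_of_mem_doubleCube_none h i
  · have := (abs_sub_lt_of_mem_doubleCube_some h i).le
    simp only [cubeCenter, scale, PiLp.sub_apply]
    linarith [side_pos a p.1.1]

lemma center_mem_shell (p : ShellCubes a) :
    cubeCenter (some p) ∈ shell ((2 : ℝ) ^ p.1.1) := by
  refine p.2 fun i => ?_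
  have := side_pos a p.1.1
  simp only [cubeCenter]
  constructor <;> nlinarith

lemma abs_center_le (p : ShellCubes a) (i : Fin 5) :
    |((p.1.2 i : ℝ) + 1 / 2) * side a p.1.1| ≤ 2 * 2 ^ p.1.1 := (center_mem_shell p).1 i

/-- On a cube in the shell `Q_N` the weight `⟨ξ⟩ ^ a` is at most a multiple of `N ^ a`. -/
lemma scale_mul_bracket_le {j : CubeIndex a} {ξ : R5} (h : ξ ∈ doubleCube j) :
    scale j * (1 + ‖ξ‖ ^ 2) ^ ((a : ℝ) / 2) ≤ (46 : ℝ) ^ ((a : ℝ) / 2) := by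
  rcases j with _ | p
  · have := norm_sq_le_of_abs_le (abs_le_of_mem_doubleCube_none h)
    simp only [scale, one_mul]
    gcongr
    linarith
  · set N : ℝ := 2 ^ p.1.1 with hN
    have hN1 : 1 ≤ N := one_le_pow₀ one_le_two
    have hb : ∀ i, |ξ i| ≤ 3 * N := fun i => by
      have h1 := abs_sub_lt_of_mem_doubleCube_some h i
      have h2 := abs_center_le p i
      have h3 := abs_sub_abs_le_abs_sub (ξ i) (((p.1.2 i : ℝ) + 1 / 2) * side a p.1.1)
      linarith [side_le_one a p.1.1]
    -- $46=1+5\cdot 3^2$: the centre has coordinates at most $2N$ and the doubled cube adds less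
    -- than $1\le N$.
    have hle : 1 + ‖ξ‖ ^ 2 ≤ 46 * N ^ 2 := by
      have := norm_sq_le_of_abs_le hb
      nlinarith
    have hpow : (N ^ 2) ^ ((a : ℝ) / 2) = N ^ a := by
      rw [← Real.rpow_natCast N 2, ← Real.rpow_mul (by positivity), ← Real.rpow_natCast N a]
      congr 1
      push_cast
      ring
    calc _ ≤ scale (some p) * (46 * N ^ 2) ^ ((a : ℝ) / 2) := by
          gcongr
          exact (scale_pos _).le
      _ = (46 : ℝ) ^ ((a : ℝ) / 2) * ((N ^ a)⁻¹ * N ^ a) := by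
          rw [Real.mul_rpow (by norm_num) (by positivity), hpow]
          simp only [scale, side, ← hN]
          ring
      _ = _ := by rw [inv_mul_cancel₀ (by positivity), mul_one]

/-- Only finitely many doubled cubes meet a bounded set. -/
lemma finite_doubleCube (R : ℝ) :
    {j : CubeIndex a | ∃ ξ ∈ doubleCube j, ‖ξ‖ ≤ R}.Finite := by
  obtain ⟨K, hK⟩ := pow_unbounded_of_one_lt (R + 1) (one_lt_two : (1 : ℝ) < 2)
  obtain ⟨M, hM⟩ := exists_int_gt ((|R| + 2) * (2 ^ K) ^ a)
  have hfin : (Set.Iic K ×ˢ Set.Icc (fun _ : Fin 5 => -M) (fun _ => M)).Finite :=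
    (Set.finite_Iic K).prod (Set.finite_Icc _ _)
  have hsub : {j : CubeIndex a | ∃ ξ ∈ doubleCube j, ‖ξ‖ ≤ R} ⊆
      insert none (some '' (Subtype.val ⁻¹' (Set.Iic K ×ˢ Set.Icc (fun _ : Fin 5 => -M)
        (fun _ => M)) : Set (ShellCubes a))) := by
    rintro j ⟨ξ, hξ, hR⟩
    rcases j with _ | p
    · exact Set.mem_insert _ _
    refine Set.mem_insert_of_mem _ ⟨p, ?_, rfl⟩
    have hR0 : 0 ≤ R := (norm_nonneg _).trans hR
    have hs := side_pos a p.1.1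
    have hs1 := side_le_one a p.1.1
    have hd (i : Fin 5) : |((p.1.2 i : ℝ) + 1 / 2) * side a p.1.1| < R + side a p.1.1 := by
      have h1 := abs_sub_lt_of_mem_doubleCube_some hξ i
      have h2 := (abs_apply_le_norm ξ i).trans hR
      have h3 := abs_sub_abs_le_abs_sub (((p.1.2 i : ℝ) + 1 / 2) * side a p.1.1) (ξ i)
      rw [abs_sub_comm] at h3
      linarith
    have hk : p.1.1 ≤ K := by
      have hc := (center_mem_shell p).2
      simp only [boxO, Set.mem_ofPred_eq, not_forall, not_le, cubeCenter] at hc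
      obtain ⟨i, hi⟩ := hc
      have h4 : (2 : ℝ) ^ p.1.1 < 2 ^ K := by linarith [hd i]
      exact ((pow_lt_pow_iff_right₀ one_lt_two).1 h4).le
    have hsK : ((2 ^ K : ℝ) ^ a)⁻¹ ≤ side a p.1.1 := by
      unfold side
      gcongr
      exact one_le_two
    have hm (i : Fin 5) : |(p.1.2 i : ℝ)| < M := by
      refine lt_of_le_of_lt ?_ hM
      rw [← div_le_iff₀ (by positivity), div_eq_mul_inv]
      have h5 : |(p.1.2 i : ℝ)| * side a p.1.1 ≤ |R| + 2 := by
        have h6 := hd i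
        have h7 : (p.1.2 i : ℝ) * side a p.1.1 =
          ((p.1.2 i : ℝ) + 1 / 2) * side a p.1.1 - 1 / 2 * side a p.1.1 := by ring
        have h8 : |(p.1.2 i : ℝ)| * side a p.1.1 = |(p.1.2 i : ℝ) * side a p.1.1| := by
          rw [abs_mul, abs_of_pos hs]
        rw [h8, h7]
        refine (abs_sub _ _).trans ?_
        rw [abs_of_pos (by positivity : 0 < 1 / 2 * side a p.1.1)]
        linarith [le_abs_self R]
      exact (mul_le_mul_of_nonneg_left hsK (abs_nonneg _)).trans h5
    refine ⟨hk, fun i => ?_, fun i => ?_⟩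
    · have := (abs_lt.1 (hm i)).1
      show -M ≤ p.1.2 i
      exact_mod_cast this.le
    · have := (abs_lt.1 (hm i)).2
      show p.1.2 i ≤ M
      exact_mod_cast this.le
  exact (((hfin.preimage Subtype.val_injective.injOn).image _).insert _).subset hsub

/-- The closed cube is contained in the closure of the open one. -/
lemma mem_closure_gridCube {h : ℝ} (hh : 0 < h) {m : Fin 5 → ℤ} {ξ : R5}
    (hξ : ∀ i, (m i : ℝ) * h ≤ ξ i ∧ ξ i ≤ ((m i : ℝ) + 1) * h) : ξ ∈ closure (gridCube h m) := by
  set c : R5 := WithLp.toLp 2 fun i => ((m i : ℝ) + 1 / 2) * h with hc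
  have hlim : Filter.Tendsto (fun ε : ℝ => ξ + ε • (c - ξ)) (nhdsWithin 0 (Set.Ioo 0 1)) (nhds ξ) := by
    have : Continuous fun ε : ℝ => ξ + ε • (c - ξ) := by fun_prop
    simpa using (this.tendsto 0).mono_left nhdsWithin_le_nhds
  have : (nhdsWithin (0 : ℝ) (Set.Ioo 0 1)).NeBot := by
    rw [nhdsWithin_Ioo_eq_nhdsGT one_pos]; infer_instance
  refine mem_closure_of_tendsto hlim ?_
  filter_upwards [self_mem_nhdsWithin] with ε hε i
  obtain ⟨h0, h1⟩ := hε
  obtain ⟨h2, h3⟩ := hξ i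
  simp only [hc, PiLp.add_apply, PiLp.smul_apply, PiLp.sub_apply, smul_eq_mul]
  constructor <;> nlinarith [mul_pos h0 hh]

/-- The closed dyadic interval of length `h` containing `x`, on the side of the origin. -/
lemma exists_int_interval {h N x : ℝ} (hh : 0 < h) {L : ℤ} (hL : (L : ℝ) * h = N) (hL1 : 1 ≤ L)
    (hx : |x| ≤ 2 * N) :
    ∃ m : ℤ, (m : ℝ) * h ≤ x ∧ x ≤ ((m : ℝ) + 1) * h ∧ -(2 * N) ≤ (m : ℝ) * h ∧
      ((m : ℝ) + 1) * h ≤ 2 * N ∧ (N < |x| → N ≤ (m : ℝ) * h ∨ ((m : ℝ) + 1) * h ≤ -N) := by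
  have hL1' : (1 : ℝ) ≤ L := by exact_mod_cast hL1
  have hN : h ≤ N := by nlinarith
  obtain ⟨hx1, hx2⟩ := abs_le.1 hx
  -- Floor on the left and ceiling on the right choose the interval toward the origin, so the
  -- endpoints $\pm 2N$ still get intervals inside $[-2N,2N]$. A point with $|x|>N$ cannot get one
  -- that enters $(-N,N)$.
  rcases le_or_gt x 0 with hx0 | hx0
  · set m := ⌊x / h⌋ with hm
    have h1 : (m : ℝ) * h ≤ x := (le_div_iff₀ hh).1 (Int.floor_le _)
    have h2 : x < ((m : ℝ) + 1) * h := (div_lt_iff₀ hh).1 (Int.lt_floor_add_one _)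
    have h3 : -(2 * L) ≤ m := Int.le_floor.2 (by
      rw [le_div_iff₀ hh]; push_cast; nlinarith)
    have h3' : (-(2 * L) : ℝ) ≤ m := by exact_mod_cast h3
    have h4 : m ≤ 0 := by
      have : (m : ℝ) ≤ 0 := by
        by_contra hc
        nlinarith [mul_pos (not_le.1 hc) hh]
      exact_mod_cast this
    have h4' : (m : ℝ) ≤ 0 := by exact_mod_cast h4
    refine ⟨m, h1, h2.le, by nlinarith, by nlinarith, fun hlt => Or.inr ?_⟩
    rw [abs_of_nonpos hx0] at hlt
    have h5 : m < -L := Int.floor_lt.2 (by rw [div_lt_iff₀ hh]; push_cast; nlinarith)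
    have h6 : m + 1 ≤ -L := by omega
    have h6' : (m : ℝ) + 1 ≤ -L := by exact_mod_cast h6
    nlinarith
  · set m := ⌈x / h⌉ - 1 with hm
    have hm' : (m : ℝ) + 1 = ⌈x / h⌉ := by rw [hm]; push_cast; ring
    have h1 : (m : ℝ) * h < x := by
      rw [← lt_div_iff₀ hh]
      have := Int.ceil_lt_add_one (x / h)
      linarith
    have h2 : x ≤ ((m : ℝ) + 1) * h := by
      rw [← div_le_iff₀ hh, hm']
      exact Int.le_ceil _
    have h3 : ⌈x / h⌉ ≤ 2 * L := Int.ceil_le.2 (by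
      rw [div_le_iff₀ hh]; push_cast; nlinarith)
    have h3' : ((m : ℝ) + 1) ≤ 2 * L := by rw [hm']; exact_mod_cast h3
    have h4 : 0 < ⌈x / h⌉ := Int.ceil_pos.2 (by positivity)
    have h4' : (0 : ℝ) ≤ m := by
      have : 0 ≤ m := by omega
      exact_mod_cast this
    refine ⟨m, h1.le, h2, by nlinarith, by nlinarith, fun hlt => Or.inl ?_⟩
    rw [abs_of_pos hx0] at hlt
    have h5 : L < ⌈x / h⌉ := Int.lt_ceil.2 (by rw [lt_div_iff₀ hh]; nlinarith)
    have h6 : L ≤ m := by omega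
    have h6' : (L : ℝ) ≤ m := by exact_mod_cast h6
    nlinarith

/-- The closures of the cubes cover the whole space. -/
lemma exists_mem_closure_cube (ξ : R5) : ∃ j : CubeIndex a, ξ ∈ closure (cube j) := by
  by_cases h1 : ξ ∈ boxO 1
  · exact ⟨none, subset_closure h1⟩
  have hex : ∃ k : ℕ, ξ ∈ boxO (2 ^ k) := by
    obtain ⟨k, hk⟩ := pow_unbounded_of_one_lt ‖ξ‖ (one_lt_two : (1 : ℝ) < 2)
    exact ⟨k, fun i => (abs_apply_le_norm ξ i).trans hk.le⟩
  classical
  set k := Nat.find hex with hk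
  have hk0 : k ≠ 0 := fun h0 => h1 (by simpa [← hk, h0] using Nat.find_spec hex)
  obtain ⟨l, hl⟩ := Nat.exists_eq_succ_of_ne_zero hk0
  have hout : ξ ∉ boxO (2 ^ l) := Nat.find_min hex (by omega)
  have hin : ξ ∈ boxO (2 * 2 ^ l) := by
    have := Nat.find_spec hex
    rw [← hk, hl] at this
    rwa [pow_succ, mul_comm] at this
  have hs := side_pos a l
  -- The faces of the shell lie on the grid, because $N$ is an integer multiple of $N^{-a}$.
  have hL : (((2 ^ l * (2 ^ l) ^ a : ℤ) : ℤ) : ℝ) * side a l = 2 ^ l := by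
    unfold side
    push_cast
    field_simp
  have hL1 : (1 : ℤ) ≤ 2 ^ l * (2 ^ l) ^ a :=
    one_le_mul_of_one_le_of_one_le (one_le_pow₀ one_le_two) (one_le_pow₀ (one_le_pow₀ one_le_two))
  choose m hm1 hm2 hm3 hm4 hm5 using fun i => exists_int_interval hs hL hL1 (hin i)
  have hsub : gridCube (side a l) m ⊆ shell (2 ^ l) := by
    intro η hη
    refine ⟨fun i => abs_le.2 ⟨by linarith [(hη i).1, hm3 i], by linarith [(hη i).2, hm4 i]⟩, ?_⟩
    intro hη'
    simp only [boxO, Set.mem_ofPred_eq, not_forall, not_le] at hout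
    obtain ⟨i, hi⟩ := hout
    have := abs_le.1 (hη' i)
    rcases hm5 i hi with h | h
    · linarith [(hη i).1, this.2]
    · linarith [(hη i).2, this.1]
  exact ⟨some ⟨(l, m), hsub⟩, mem_closure_gridCube hs fun i => ⟨hm1 i, hm2 i⟩⟩

end Cubes

/-! ### The partition of unity -/

section Partition

variable {a : ℕ} {φ : CubeIndex a → R5 → ℝ}

lemma finite_support_bump (hφ : IsBumpFamily a φ) (ξ : R5) :
    (Function.support fun j => φ j ξ).Finite := by
  refine (finite_doubleCube ‖ξ‖).subset fun j hj => ⟨ξ, ?_, le_rfl⟩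
  by_contra h
  exact hj (hφ.eq_zero j ξ h)

/-- The open cubes miss their common faces, but a bump equal to one on a cube is one on its closure
by continuity, and the closures cover. The denominator of `psi` therefore never vanishes. -/
lemma one_le_tsum_bump (hφ : IsBumpFamily a φ) (ξ : R5) : 1 ≤ ∑' j, φ j ξ := by
  obtain ⟨j, hj⟩ := exists_mem_closure_cube (a := a) ξ
  have h1 : φ j ξ = 1 := by
    have : Set.EqOn (φ j) (fun _ => 1) (cube j) := hφ.eq_one j
    exact this.closure (hφ.smooth j).continuous continuous_const hj
  rw [← h1]
  exact (summable_of_hasFiniteSupport (finite_support_bump hφ ξ)).le_tsum j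
    fun i _ => hφ.nonneg i ξ

lemma contDiff_tsum_bump (hφ : IsBumpFamily a φ) :
    ContDiff ℝ (⊤ : ℕ∞) fun ξ => ∑' j, φ j ξ := by
  rw [contDiff_iff_contDiffAt]
  intro ξ₀
  set T := (finite_doubleCube (a := a) (‖ξ₀‖ + 1)).toFinset with hT
  have : (fun ξ => ∑ j ∈ T, φ j ξ) =ᶠ[nhds ξ₀] fun ξ => ∑' j, φ j ξ := by
    filter_upwards [Metric.ball_mem_nhds ξ₀ one_pos] with ξ hξ
    rw [tsum_eq_sum]
    intro j hj
    refine hφ.eq_zero j ξ fun hmem => hj ?_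
    rw [hT, Set.Finite.mem_toFinset]
    refine ⟨ξ, hmem, ?_⟩
    have h1 := norm_sub_norm_le ξ ξ₀
    have h2 := mem_ball_iff_norm.1 hξ
    linarith
  exact (ContDiffAt.congr_of_eventuallyEq (ContDiff.contDiffAt
    (ContDiff.sum fun j _ => hφ.smooth j)) this.symm)

lemma contDiff_psi (hφ : IsBumpFamily a φ) (j : CubeIndex a) :
    ContDiff ℝ (⊤ : ℕ∞) (psi φ j) :=
  (hφ.smooth j).div (contDiff_tsum_bump hφ) fun ξ => (one_pos.trans_le (one_le_tsum_bump hφ ξ)).ne'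

lemma psi_nonneg (hφ : IsBumpFamily a φ) (j : CubeIndex a) (ξ : R5) : 0 ≤ psi φ j ξ :=
  div_nonneg (hφ.nonneg j ξ) (tsum_nonneg fun i => hφ.nonneg i ξ)

lemma psi_eq_zero (hφ : IsBumpFamily a φ) {j : CubeIndex a} {ξ : R5} (h : ξ ∉ doubleCube j) :
    psi φ j ξ = 0 := by
  rw [psi, hφ.eq_zero j ξ h, zero_div]

lemma tsum_ofReal_psi (hφ : IsBumpFamily a φ) (ξ : R5) :
    ∑' j, ENNReal.ofReal (psi φ j ξ) = 1 := by
  have hs : Summable fun j => φ j ξ := summable_of_hasFiniteSupport (finite_support_bump hφ ξ)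
  rw [← ENNReal.ofReal_tsum_of_nonneg (fun j => psi_nonneg hφ j ξ) (hs.div_const _)]
  simp only [psi]
  rw [tsum_div_const, div_self (one_pos.trans_le (one_le_tsum_bump hφ ξ)).ne', ENNReal.ofReal_one]

lemma psi_le_one (hφ : IsBumpFamily a φ) (j : CubeIndex a) (ξ : R5) : psi φ j ξ ≤ 1 := by
  rw [← ENNReal.ofReal_le_one, ← tsum_ofReal_psi hφ ξ]
  exact ENNReal.le_tsum j

lemma hasCompactSupport_psi (hφ : IsBumpFamily a φ) (j : CubeIndex a) :
    HasCompactSupport (psi φ j) := by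
  refine HasCompactSupport.of_support_subset_isCompact
    (isCompact_closedBall (cubeCenter j) (2 * Real.pi * scale j)) fun ξ hξ => ?_
  rw [mem_closedBall_iff_norm]
  refine norm_sub_cubeCenter_le ?_
  by_contra h
  exact hξ (psi_eq_zero hφ h)

end Partition

/-! ### Symbols of temperate growth -/

section Symbols

lemma hasTemperateGrowth_two_pi_smul :
    (fun η : R5 => (2 * Real.pi) • η).HasTemperateGrowth :=
  ((2 * Real.pi) • ContinuousLinearMap.id ℝ R5).hasTemperateGrowth

lemma hasTemperateGrowth_bracketPow (σ : ℝ) :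
    (fun η : R5 => bracketPow σ ((2 * Real.pi) • η)).HasTemperateGrowth :=
  (Function.Complex.hasTemperateGrowth_ofReal.comp
    (Function.hasTemperateGrowth_one_add_norm_sq_rpow R5 (σ / 2))).comp
    hasTemperateGrowth_two_pi_smul

lemma iteratedDeriv_cexp_mul_ofReal (c : ℂ) (n : ℕ) :
    iteratedDeriv n (fun y : ℝ => Complex.exp (c * y)) =
      fun y : ℝ => c ^ n * Complex.exp (c * y) := by
  induction n with
  | zero => simp
  | succ n ih =>
    rw [iteratedDeriv_succ, ih]
    funext y
    have h1 : HasDerivAt (fun y : ℝ => c * (y : ℂ)) c y := by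
      simpa using (Complex.ofRealCLM.hasDerivAt (x := y)).const_mul c
    have h2 := (h1.cexp.const_mul (c ^ n)).deriv
    rw [h2]
    ring

/-- The derivatives of $y\mapsto e^{-ity}$ are bounded by powers of $|t|$; composing with the
polynomial $|2πη|^2$ preserves temperate growth. -/
lemma hasTemperateGrowth_schr (t : ℝ) : (schr t).HasTemperateGrowth := by
  have h1 : (fun y : ℝ => Complex.exp (-Complex.I * t * y)).HasTemperateGrowth := by
    refine ⟨(contDiff_const.mul Complex.ofRealCLM.contDiff).cexp, fun n => ⟨0, |t| ^ n, fun y => ?_⟩⟩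
    rw [norm_iteratedFDeriv_eq_norm_iteratedDeriv, iteratedDeriv_cexp_mul_ofReal, norm_mul,
      norm_pow, Complex.norm_exp]
    simp
  exact h1.comp ((Function.hasTemperateGrowth_norm_sq R5).comp hasTemperateGrowth_two_pi_smul)

lemma hasTemperateGrowth_psi {a : ℕ} {φ : CubeIndex a → R5 → ℝ} (hφ : IsBumpFamily a φ)
    (j : CubeIndex a) :
    (fun η : R5 => (psi φ j ((2 * Real.pi) • η) : ℂ)).HasTemperateGrowth :=
  (Function.Complex.hasTemperateGrowth_ofReal.comp
    ((hasCompactSupport_psi hφ j).hasTemperateGrowth (contDiff_psi hφ j))).comp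
    hasTemperateGrowth_two_pi_smul

lemma bracketPow_mul (σ τ : ℝ) (ξ : R5) :
    bracketPow σ ξ * bracketPow τ ξ = bracketPow (σ + τ) ξ := by
  unfold bracketPow
  rw [← Complex.ofReal_mul, ← Real.rpow_add (by positivity), add_div]

lemma norm_bracketPow (σ : ℝ) (ξ : R5) : ‖bracketPow σ ξ‖ = (1 + ‖ξ‖ ^ 2) ^ (σ / 2) := by
  rw [bracketPow, Complex.norm_real, Real.norm_of_nonneg (by positivity)]

lemma japanese_zero : japanese 0 = ContinuousLinearMap.id ℂ _ := by
  have : (fun η : R5 => bracketPow 0 ((2 * Real.pi) • η)) = fun _ => 1 := by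
    funext η; simp [bracketPow]
  rw [japanese, multiplier, this, TemperedDistribution.fourierMultiplierCLM_const, one_smul]

/-- Its square decays like $\langleξ\rangle^{-6}$, and $6>5$. This weight turns the $L^2$ datum into
an integrable one, which makes the family of projections absolutely summable. -/
lemma memLp_bracketPow_neg_three :
    MemLp (fun η : R5 => bracketPow (-3) ((2 * Real.pi) • η)) 2 := by
  have hc : Continuous fun η : R5 => bracketPow (-3) ((2 * Real.pi) • η) :=
    (hasTemperateGrowth_bracketPow (-3)).1.continuous
  rw [memLp_two_iff_integrable_sq_norm hc.aestronglyMeasurable]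
  have hi : Integrable fun η : R5 => ((1 : ℝ) + ‖η‖ ^ 2) ^ (-(6 : ℝ) / 2) :=
    integrable_rpow_neg_one_add_norm_sq (by simp; norm_num)
  refine hi.mono' (hc.norm.pow 2).aestronglyMeasurable (Filter.Eventually.of_forall fun η => ?_)
  rw [norm_bracketPow, Real.norm_of_nonneg (by positivity), ← Real.rpow_natCast,
    ← Real.rpow_mul (by positivity)]
  have h1 : ((-3 : ℝ) / 2) * ((2 : ℕ) : ℝ) = -(6 : ℝ) / 2 := by norm_num
  rw [h1]
  refine Real.rpow_le_rpow_of_nonpos (by positivity) ?_ (by norm_num)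
  rw [norm_smul, Real.norm_of_nonneg (by positivity)]
  have : 1 ≤ 2 * Real.pi := by linarith [Real.pi_gt_three]
  gcongr
  exact le_mul_of_one_le_left (norm_nonneg _) this

end Symbols

/-! ### Representation by functions -/

section Represents

/-- The tempered distribution `T` is integration against the function `h`. -/
def Represents (T : 𝓢'(R5, ℂ)) (h : R5 → ℂ) : Prop := ∀ θ : 𝓢(R5, ℂ), T θ = ∫ x, θ x * h x

lemma Represents.congr {T : 𝓢'(R5, ℂ)} {h h' : R5 → ℂ} (hT : Represents T h)
    (hh : h =ᵐ[volume] h') : Represents T h' := fun θ => by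
  rw [hT θ]
  exact integral_congr_ae (hh.mono fun x hx => by simp only [hx])

lemma Represents.smulLeft {T : 𝓢'(R5, ℂ)} {h : R5 → ℂ} (hT : Represents T h) {m : R5 → ℂ}
    (hm : m.HasTemperateGrowth) :
    Represents (TemperedDistribution.smulLeftCLM ℂ m T) fun η => m η * h η := fun θ => by
  rw [TemperedDistribution.smulLeftCLM_apply_apply, hT]
  refine integral_congr_ae (Filter.Eventually.of_forall fun η => ?_)
  simp only [SchwartzMap.smulLeftCLM_apply_apply hm, smul_eq_mul]
  ring

lemma Represents.fourierInv {T : 𝓢'(R5, ℂ)} {h : R5 → ℂ} (hT : Represents T h)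
    (hh : Integrable h) : Represents (𝓕⁻ T) (𝓕⁻ h) := fun θ => by
  rw [TemperedDistribution.fourierInv_apply, hT, ← integral_fourierInv_mul θ.integrable hh,
    SchwartzMap.fourierInv_coe]

variable {s : ℝ} {a : ℕ} {φ : CubeIndex a → R5 → ℝ} {f : 𝓢'(R5, ℂ)} {h : R5 → ℂ}

/-- The function `⟨ξ⟩ ^ τ ψ_j(ξ) h` on the frequency side, at `ξ = 2 π η`. -/
def blockHat (τ : ℝ) (φ : CubeIndex a → R5 → ℝ) (h : R5 → ℂ) (j : CubeIndex a) (η : R5) : ℂ :=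
  bracketPow τ ((2 * Real.pi) • η) * psi φ j ((2 * Real.pi) • η) * h η

lemma measurable_blockHat (hφ : IsBumpFamily a φ) (hh : Measurable h) (τ : ℝ) (j : CubeIndex a) :
    Measurable (blockHat τ φ h j) :=
  (((hasTemperateGrowth_bracketPow τ).1.continuous.measurable).mul
    (hasTemperateGrowth_psi hφ j).1.continuous.measurable).mul hh

lemma blockHat_eq_zero (hφ : IsBumpFamily a φ) {τ : ℝ} {j : CubeIndex a} {η : R5}
    (hη : (2 * Real.pi) • η ∉ doubleCube j) : blockHat τ φ h j η = 0 := by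
  simp [blockHat, psi_eq_zero hφ hη]

lemma blockHat_eq_zero_of_scale_lt (hφ : IsBumpFamily a φ) {τ : ℝ} {j : CubeIndex a} {η : R5}
    (hη : scale j < ‖η - (2 * Real.pi)⁻¹ • cubeCenter j‖) : blockHat τ φ h j η = 0 := by
  refine blockHat_eq_zero hφ fun hmem => ?_
  have h1 := norm_sub_cubeCenter_le hmem
  have h2 : (2 * Real.pi) • η - cubeCenter j =
      (2 * Real.pi) • (η - (2 * Real.pi)⁻¹ • cubeCenter j) := by
    rw [smul_sub, smul_inv_smul₀ (by positivity)]
  rw [h2, norm_smul, Real.norm_of_nonneg (by positivity)] at h1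
  exact absurd (le_of_mul_le_mul_left h1 (by positivity)) (not_le.2 hη)

lemma memLp_blockSymbol (hφ : IsBumpFamily a φ) (τ : ℝ) (j : CubeIndex a) (p : ℝ≥0∞) :
    MemLp (fun η : R5 => bracketPow τ ((2 * Real.pi) • η) * psi φ j ((2 * Real.pi) • η)) p := by
  refine Continuous.memLp_of_hasCompactSupport
    ((hasTemperateGrowth_bracketPow τ).1.continuous.mul
      (hasTemperateGrowth_psi hφ j).1.continuous) ?_
  refine HasCompactSupport.of_support_subset_isCompact
    (isCompact_closedBall ((2 * Real.pi)⁻¹ • cubeCenter j) (scale j)) fun η hη => ?_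
  rw [mem_closedBall_iff_norm]
  by_contra hc
  refine hη ?_
  simpa [blockHat] using blockHat_eq_zero_of_scale_lt (h := fun _ => 1) hφ (not_le.1 hc)

lemma memLp_blockHat (hφ : IsBumpFamily a φ) (hh : MemLp h 2) (τ : ℝ) (j : CubeIndex a) :
    MemLp (blockHat τ φ h j) 2 :=
  hh.mul (memLp_blockSymbol hφ τ j ∞)

lemma integrable_blockHat (hφ : IsBumpFamily a φ) (hh : MemLp h 2) (τ : ℝ) (j : CubeIndex a) :
    Integrable (blockHat τ φ h j) :=
  MemLp.integrable_mul (memLp_blockSymbol hφ τ j 2) hh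

/-- The evolution of a frequency projection is represented by an oscillatory integral. -/
lemma represents_evolution_boxProj (hφ : IsBumpFamily a φ)
    (hf : Represents (TemperedDistribution.smulLeftCLM ℂ
      (fun η : R5 => bracketPow s ((2 * Real.pi) • η)) (𝓕 f)) h) (hh : MemLp h 2)
    (σ t : ℝ) (j : CubeIndex a) :
    Represents (japanese σ (freeEvolution t (boxProj φ j f))) (evol (blockHat (σ - s) φ h j) t) := by
  have g1 := hasTemperateGrowth_psi hφ j
  have g2 := hasTemperateGrowth_schr t
  have g3 := hasTemperateGrowth_bracketPow σ
  have g4 := hasTemperateGrowth_bracketPow (σ - s)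
  have g5 := hasTemperateGrowth_bracketPow s
  have g6 : (fun η : R5 => schr t η * (bracketPow (σ - s) ((2 * Real.pi) • η) *
      psi φ j ((2 * Real.pi) • η))).HasTemperateGrowth := g2.mul (g4.mul g1)
  have hcomp : japanese σ (freeEvolution t (boxProj φ j f)) = 𝓕⁻ (TemperedDistribution.smulLeftCLM ℂ
      (fun η : R5 => schr t η * (bracketPow (σ - s) ((2 * Real.pi) • η) *
        psi φ j ((2 * Real.pi) • η))) (TemperedDistribution.smulLeftCLM ℂ
      (fun η : R5 => bracketPow s ((2 * Real.pi) • η)) (𝓕 f))) := by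
    have e1 := TemperedDistribution.fourierMultiplierCLM_fourierMultiplierCLM_apply (F := ℂ)
      g1 g2 f
    have e2 := TemperedDistribution.fourierMultiplierCLM_fourierMultiplierCLM_apply (F := ℂ)
      (g1.mul g2) g3 f
    rw [← e1] at e2
    refine e2.trans ?_
    rw [TemperedDistribution.fourierMultiplierCLM_apply,
      TemperedDistribution.smulLeftCLM_smulLeftCLM_apply g5 g6]
    congr 3
    funext η
    simp only [Pi.mul_apply]
    rw [show σ = s + (σ - s) by ring, ← bracketPow_mul]
    ring_nf
  rw [hcomp]
  have hint := integrable_blockHat hφ hh (σ - s) j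
  have e : (fun η => schr t η * (bracketPow (σ - s) ((2 * Real.pi) • η) *
      psi φ j ((2 * Real.pi) • η)) * h η) = fun η => schr t η * blockHat (σ - s) φ h j η := by
    funext η; simp only [blockHat]; ring
  refine Represents.fourierInv (h := fun η => schr t η * blockHat (σ - s) φ h j η) ?_
    (integrable_schr_mul hint t)
  rw [← e]
  exact hf.smulLeft g6

/-- The frequency projections of `f` are the images of an absolutely summable family in `L¹` under
a continuous linear map. -/
lemma exists_summable_boxProj (hφ : IsBumpFamily a φ)
    (hf : Represents (TemperedDistribution.smulLeftCLM ℂ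
      (fun η : R5 => bracketPow s ((2 * Real.pi) • η)) (𝓕 f)) h) (hh : MemLp h 2) :
    ∃ (Λ : Lp ℂ 1 (volume : Measure R5) →L[ℂ] 𝓢'(R5, ℂ)) (L : CubeIndex a → Lp ℂ 1 volume),
      (∀ j, boxProj φ j f = Λ (L j)) ∧ ∑' j, ‖L j‖ₑ ≠ ∞ := by
  have g5 := hasTemperateGrowth_bracketPow s
  have hint (j : CubeIndex a) := integrable_blockHat hφ hh (-3) j
  refine ⟨fourierInvCLM ℂ 𝓢'(R5, ℂ) ∘L TemperedDistribution.smulLeftCLM ℂ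
      (fun η : R5 => bracketPow (3 - s) ((2 * Real.pi) • η)) ∘L
      Lp.toTemperedDistributionCLM ℂ volume 1, fun j => (memLp_one_iff_integrable.2 (hint j)).toLp,
    fun j => ?_, ?_⟩
  · have g1 := hasTemperateGrowth_psi hφ j
    have g3 := hasTemperateGrowth_bracketPow (-3)
    have g6 : (fun η : R5 => bracketPow (-3) ((2 * Real.pi) • η) *
        psi φ j ((2 * Real.pi) • η)).HasTemperateGrowth := g3.mul g1
    have e1 : TemperedDistribution.smulLeftCLM ℂ (fun η : R5 =>
        bracketPow (-3) ((2 * Real.pi) • η) * psi φ j ((2 * Real.pi) • η))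
        (TemperedDistribution.smulLeftCLM ℂ
          (fun η : R5 => bracketPow s ((2 * Real.pi) • η)) (𝓕 f)) =
        Lp.toTemperedDistributionCLM ℂ volume 1 ((memLp_one_iff_integrable.2 (hint j)).toLp) := by
      ext θ
      rw [hf.smulLeft g6 θ, Lp.toTemperedDistributionCLM_apply,
        Lp.toTemperedDistribution_apply]
      refine integral_congr_ae ?_
      filter_upwards [(memLp_one_iff_integrable.2 (hint j)).coeFn_toLp] with η hη
      rw [hη, smul_eq_mul]
      simp only [blockHat]
    show _ = 𝓕⁻ (TemperedDistribution.smulLeftCLM ℂ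
      (fun η : R5 => bracketPow (3 - s) ((2 * Real.pi) • η))
      (Lp.toTemperedDistributionCLM ℂ volume 1 ((memLp_one_iff_integrable.2 (hint j)).toLp)))
    rw [← e1, TemperedDistribution.smulLeftCLM_smulLeftCLM_apply g5 g6,
      TemperedDistribution.smulLeftCLM_smulLeftCLM_apply (g5.mul g6)
        (hasTemperateGrowth_bracketPow (3 - s))]
    refine (TemperedDistribution.fourierMultiplierCLM_apply _ _).trans ?_
    congr 3
    funext η
    simp only [Pi.mul_apply]
    have : bracketPow s ((2 * Real.pi) • η) * bracketPow (-3) ((2 * Real.pi) • η) *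
        bracketPow (3 - s) ((2 * Real.pi) • η) = 1 := by
      rw [bracketPow_mul, bracketPow_mul, show s + -3 + (3 - s) = 0 by ring]
      simp [bracketPow]
    linear_combination (-(psi φ j ((2 * Real.pi) • η) : ℂ)) * this
  · have h1 : Integrable fun η : R5 => bracketPow (-3) ((2 * Real.pi) • η) * h η :=
      MemLp.integrable_mul memLp_bracketPow_neg_three hh
    have h2 (j : CubeIndex a) : ‖(memLp_one_iff_integrable.2 (hint j)).toLp‖ₑ =
        ∫⁻ η, ENNReal.ofReal (psi φ j ((2 * Real.pi) • η)) *
          ‖bracketPow (-3) ((2 * Real.pi) • η) * h η‖ₑ := by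
      rw [Lp.enorm_toLp, eLpNorm_one_eq_lintegral_enorm]
      refine lintegral_congr fun η => ?_
      rw [blockHat, mul_right_comm, mul_comm, enorm_mul]
      congr 1
      rw [← ofReal_norm, Complex.norm_real, Real.norm_of_nonneg (psi_nonneg hφ _ _)]
    simp only [h2]
    -- Since $\sumψ_j=1$, the $L^1$ norms of the pieces add up to the norm of the whole.
    rw [← lintegral_tsum fun j => ?_]
    · simp only [ENNReal.tsum_mul_right, tsum_ofReal_psi hφ, one_mul]
      exact h1.2.ne
    · have := (hasTemperateGrowth_psi hφ j).1.continuous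
      refine AEMeasurable.mul ?_ h1.1.enorm
      have hc : Continuous fun η : R5 => psi φ j ((2 * Real.pi) • η) :=
        (contDiff_psi hφ j).continuous.comp (by fun_prop)
      exact hc.measurable.ennreal_ofReal.aemeasurable

end Represents

/-! ### Norms of block sums of distributions -/

section BlockSums

variable {J : Type*} [DecidableEq J] {T : 𝓢'(R5, ℂ)} {Tj : J → 𝓢'(R5, ℂ)} {v : J → R5 → ℂ}
  {z : J → ℂ} {A : ℕ → Finset J}

lemma sum_range_blocks (hA : Monotone A) (hA0 : A 0 = ∅) (y : J → ℂ) (k : ℕ) :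
    ∑ i ∈ Finset.range k, ∑ j ∈ A (i + 1) \ A i, y j = ∑ j ∈ A k, y j := by
  induction k with
  | zero => simp [hA0]
  | succ k ih => rw [Finset.sum_range_succ, ih, add_comm, Finset.sum_sdiff (hA k.le_succ)]

/-- A sum of distributions is controlled by the sum of the absolute values of its blocks. -/
lemma distNorm_le_blocks (hv : ∀ j, Measurable (v j))
    (hvi : ∀ (θ : 𝓢(R5, ℂ)) (j : J), Integrable fun x => θ x * v j x)
    (hrep : ∀ j, Represents (Tj j) (v j)) (hT : HasSum (fun j => z j • Tj j) T) (hA : Monotone A)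
    (hA0 : A 0 = ∅) (hAex : ∀ j, ∃ k, j ∈ A k) {r : ℝ} (hr : 1 ≤ r) :
    distNorm (ENNReal.ofReal r) T ≤
      (∫⁻ x, (∑' k, ‖∑ j ∈ A (k + 1) \ A k, z j * v j x‖ₑ) ^ r) ^ (1 / r) := by
  have hr0 : 0 < r := by linarith
  have hrr : (ENNReal.ofReal r).toReal = r := ENNReal.toReal_ofReal hr0.le
  have hrne : ENNReal.ofReal r ≠ 0 := by simpa using hr0
  set U : ℕ → R5 → ℂ := fun k x => ∑ j ∈ A (k + 1) \ A k, z j * v j x with hU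
  set S : R5 → ℝ≥0∞ := fun x => ∑' k, ‖U k x‖ₑ with hS
  have hUm (k : ℕ) : Measurable (U k) := Finset.measurable_sum _ fun j _ => (hv j).const_mul _
  have hSm : Measurable S := Measurable.tsum fun k => (hUm k).enorm
  by_cases hfin : ∫⁻ x, S x ^ r = ∞
  · rw [hfin, ENNReal.top_rpow_of_pos (by positivity)]
    exact le_top
  have hSfin : ∀ᵐ x, S x ≠ ∞ := by
    filter_upwards [ae_lt_top (hSm.pow_const r) hfin] with x hx h
    rw [h, ENNReal.top_rpow_of_pos hr0] at hx
    exact lt_irrefl _ hx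
  have hnorm : eLpNorm (fun x => (S x).toReal) (ENNReal.ofReal r) volume =
      (∫⁻ x, S x ^ r) ^ (1 / r) := by
    rw [eLpNorm_eq_lintegral_rpow_enorm_toReal hrne ENNReal.ofReal_ne_top, hrr]
    congr 1
    refine lintegral_congr_ae ?_
    filter_upwards [hSfin] with x hx
    rw [← ofReal_norm, Real.norm_of_nonneg ENNReal.toReal_nonneg, ENNReal.ofReal_toReal hx]
  have hSmem : MemLp (fun x => (S x).toReal) (ENNReal.ofReal r) volume := by
    refine ⟨hSm.ennreal_toReal.aestronglyMeasurable, ?_⟩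
    rw [hnorm]
    exact ENNReal.rpow_lt_top_of_nonneg (by positivity) hfin
  have hsum : ∀ᵐ x, Summable fun k => ‖U k x‖ := by
    filter_upwards [hSfin] with x hx
    exact summable_norm_iff.2 (Summable.of_enorm hx)
  have hle : ∀ᵐ x, ∀ k, ‖∑ i ∈ Finset.range k, U i x‖ ≤ (S x).toReal := by
    filter_upwards [hSfin] with x hx k
    rw [← toReal_enorm]
    refine ENNReal.toReal_mono hx ((enorm_sum_le _ _).trans (ENNReal.sum_le_tsum _))
  have hlim : ∀ᵐ x, Filter.Tendsto (fun k => ∑ i ∈ Finset.range k, U i x) Filter.atTop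
      (nhds (∑' k, U k x)) := by
    filter_upwards [hsum] with x hx
    exact hx.of_norm.hasSum.tendsto_sum_nat
  have hPm (k : ℕ) : Measurable fun x => ∑ i ∈ Finset.range k, U i x :=
    Finset.measurable_sum _ fun i _ => hUm i
  have hsm : AEStronglyMeasurable (fun x => ∑' k, U k x) volume :=
    aestronglyMeasurable_of_tendsto_ae Filter.atTop (fun k => (hPm k).aestronglyMeasurable) hlim
  have hbound : ∀ᵐ x, ‖∑' k, U k x‖ ≤ ‖(S x).toReal‖ := by
    filter_upwards [hlim, hle] with x h1 h2
    rw [Real.norm_of_nonneg ENNReal.toReal_nonneg]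
    exact le_of_tendsto' h1.norm h2
  have hmem : MemLp (fun x => ∑' k, U k x) (ENNReal.ofReal r) volume := hSmem.mono hsm hbound
  refine iInf₂_le_of_le _ hmem (iInf_le_of_le (fun θ => ?_) ?_)
  · have h1 : Filter.Tendsto (fun k => ∑ j ∈ A k, (z j • Tj j) θ) Filter.atTop (nhds (T θ)) := by
      have := (hT.mapL (PointwiseConvergenceCLM.evalCLM _ ℂ θ)).comp
        (Filter.tendsto_atTop_finset_of_monotone hA hAex)
      exact this
    have h2 (k : ℕ) : ∑ j ∈ A k, (z j • Tj j) θ =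
        ∫ x, θ x * ∑ i ∈ Finset.range k, U i x := by
      have e (x : R5) : θ x * ∑ i ∈ Finset.range k, U i x = ∑ j ∈ A k, z j * (θ x * v j x) := by
        rw [hU, sum_range_blocks hA hA0 (fun j => z j * v j x), Finset.mul_sum]
        exact Finset.sum_congr rfl fun j _ => by ring
      simp only [e]
      rw [integral_finsetSum _ fun j _ => (hvi θ j).const_mul _]
      refine Finset.sum_congr rfl fun j _ => ?_
      rw [integral_const_mul, ← hrep j θ]
      rfl
    simp only [h2] at h1
    refine tendsto_nhds_unique h1 ?_
    -- The majorant is $|θ|S$, integrable by Hölder because a Schwartz function lies in the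
    -- conjugate space.
    refine tendsto_integral_of_dominated_convergence (fun x => ‖θ x‖ * (S x).toReal) (fun k => ?_)
      ?_ (fun k => ?_) ?_
    · exact (θ.continuous.measurable.mul (hPm k)).aestronglyMeasurable
    · have hr1 : 1 ≤ ENNReal.ofReal r := ENNReal.one_le_ofReal.2 hr
      have := ENNReal.HolderConjugate.inv_one_sub_inv' hr1
      have := this.symm
      exact MemLp.integrable_mul (θ.memLp (1 - (ENNReal.ofReal r)⁻¹)⁻¹).norm hSmem
    · filter_upwards [hle] with x hx
      rw [norm_mul]
      gcongr
      exact hx k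
    · filter_upwards [hlim] with x hx
      exact hx.const_mul _
  · rw [← hnorm]
    exact eLpNorm_mono_ae hbound

end BlockSums

/-! ### The random bound for a single norm -/

section SingleNorm

lemma IsExponent.bounds {q r : ℝ} (h : IsExponent q r) : 2 ≤ q ∧ q ≤ 6 ∧ 2 ≤ r ∧ r ≤ 6 := by
  rcases h with ⟨rfl, rfl⟩ | ⟨rfl, rfl⟩ | ⟨rfl, rfl⟩ | ⟨rfl, rfl⟩ <;> norm_num

variable {a : ℕ} {φ : CubeIndex a → R5 → ℝ} {h : R5 → ℂ}

/-- The part of the mass of `h` in one of the cubes. -/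
def blockMass (φ : CubeIndex a → R5 → ℝ) (h : R5 → ℂ) (j : CubeIndex a) : ℝ≥0∞ :=
  ∫⁻ η, ENNReal.ofReal (psi φ j ((2 * Real.pi) • η)) * ‖h η‖ₑ ^ 2

lemma tsum_blockMass (hφ : IsBumpFamily a φ) (hh : Measurable h) :
    ∑' j, blockMass φ h j = ∫⁻ η, ‖h η‖ₑ ^ 2 := by
  unfold blockMass
  rw [← lintegral_tsum fun j => ?_]
  · simp only [ENNReal.tsum_mul_right, tsum_ofReal_psi hφ, one_mul]
  · have hc : Continuous fun η : R5 => psi φ j ((2 * Real.pi) • η) :=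
      (contDiff_psi hφ j).continuous.comp (by fun_prop)
    exact (hc.measurable.ennreal_ofReal.mul (hh.enorm.pow_const 2)).aemeasurable

/-- The gain meets the loss here: on the doubled cube, scale times
$\langleξ\rangle^{2τ}\le\langleξ\rangle^a$ is bounded. Also $ψ_j^2\leψ_j$, so the masses can be
summed against the partition of unity. -/
lemma scale_mul_lintegral_blockHat_le (hφ : IsBumpFamily a φ) {τ : ℝ}
    (hτ : τ ≤ (a : ℝ) / 2) (j : CubeIndex a) :
    ENNReal.ofReal (scale j) * ∫⁻ η, ‖blockHat τ φ h j η‖ₑ ^ 2 ≤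
      ENNReal.ofReal ((46 : ℝ) ^ ((a : ℝ) / 2)) * blockMass φ h j := by
  rw [blockMass, ← lintegral_const_mul' _ _ ENNReal.ofReal_ne_top,
    ← lintegral_const_mul' _ _ ENNReal.ofReal_ne_top]
  refine lintegral_mono fun η => ?_
  by_cases hη : (2 * Real.pi) • η ∈ doubleCube j
  · set ξ : R5 := (2 * Real.pi) • η with hξ
    have h1 : ‖blockHat τ φ h j η‖ₑ ^ 2 =
        ENNReal.ofReal ((1 + ‖ξ‖ ^ 2) ^ τ * psi φ j ξ ^ 2) * ‖h η‖ₑ ^ 2 := by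
      rw [blockHat, enorm_mul, mul_pow, ← ofReal_norm, ← ENNReal.ofReal_pow (norm_nonneg _),
        norm_mul, norm_bracketPow, Complex.norm_real, Real.norm_of_nonneg (psi_nonneg hφ _ _),
        mul_pow, ← Real.rpow_natCast _ 2, ← Real.rpow_mul (by positivity)]
      congr 4
      push_cast
      ring
    show _ * ‖blockHat τ φ h j η‖ₑ ^ 2 ≤ _
    rw [h1, ← mul_assoc, ← mul_assoc, ← ENNReal.ofReal_mul (scale_pos j).le,
      ← ENNReal.ofReal_mul (by positivity)]
    gcongr ENNReal.ofReal ?_ * _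
    have h2 := psi_nonneg hφ j ξ
    have h3 := psi_le_one hφ j ξ
    have h4 : psi φ j ξ ^ 2 ≤ psi φ j ξ := by nlinarith
    have h5 : (1 + ‖ξ‖ ^ 2) ^ τ ≤ (1 + ‖ξ‖ ^ 2) ^ ((a : ℝ) / 2) :=
      Real.rpow_le_rpow_of_exponent_le (by nlinarith [sq_nonneg ‖ξ‖]) hτ
    have h6 := scale_pos j
    calc scale j * ((1 + ‖ξ‖ ^ 2) ^ τ * psi φ j ξ ^ 2)
        ≤ scale j * ((1 + ‖ξ‖ ^ 2) ^ ((a : ℝ) / 2) * psi φ j ξ) := by gcongr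
      _ = scale j * (1 + ‖ξ‖ ^ 2) ^ ((a : ℝ) / 2) * psi φ j ξ := by ring
      _ ≤ _ := by
        gcongr
        exact scale_mul_bracket_le hη
  · simp [blockHat_eq_zero hφ hη]

/-- The deterministic bound for the evolution of one frequency projection. -/
lemma exists_mixedPow_blockHat_le (a : ℕ) : ∃ K : ℝ, 0 < K ∧
    ∀ {φ : CubeIndex a → R5 → ℝ} {h : R5 → ℂ}, IsBumpFamily a φ → Measurable h → MemLp h 2 →
    ∀ {τ : ℝ}, τ ≤ (a : ℝ) / 2 → ∀ (j : CubeIndex a) {q r : ℝ}, IsExponent q r →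
      mixedPow volume volume q r (fun t x => ‖evol (blockHat τ φ h j) t x‖ₑ) ≤
        (ENNReal.ofReal K * blockMass φ h j) ^ (q / 2) := by
  obtain ⟨C, hC, hbd⟩ := exists_mixedPow_evol_le
  set C' : ℝ := max C.toReal 1 with hC'
  have hC1 : 1 ≤ C' := le_max_right _ _
  refine ⟨C' * (46 : ℝ) ^ ((a : ℝ) / 2), by positivity, ?_⟩
  intro φ h hφ hhm hh τ hτ j q r hqr
  obtain ⟨hq2, -, -, -⟩ := hqr.bounds
  -- As $C'\ge 1$ and $q/2\ge 1$, the constant can go inside the power, and one `K` serves every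
  -- pair.
  have hCC : C ≤ ENNReal.ofReal C' ^ (q / 2) := by
    calc C = ENNReal.ofReal C.toReal := (ENNReal.ofReal_toReal hC).symm
      _ ≤ ENNReal.ofReal C' := ENNReal.ofReal_le_ofReal (le_max_left _ _)
      _ = ENNReal.ofReal C' ^ (1 : ℝ) := (ENNReal.rpow_one _).symm
      _ ≤ _ := ENNReal.rpow_le_rpow_of_exponent_le (ENNReal.one_le_ofReal.2 hC1) (by linarith)
  refine (hbd (measurable_blockHat hφ hhm τ j) (integrable_blockHat hφ hh τ j)
    (memLp_blockHat hφ hh τ j) (scale_pos j) (scale_le_one j)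
    (fun η hη => blockHat_eq_zero_of_scale_lt hφ hη) hqr).trans ?_
  calc _ ≤ ENNReal.ofReal C' ^ (q / 2) * (ENNReal.ofReal ((46 : ℝ) ^ ((a : ℝ) / 2)) *
        blockMass φ h j) ^ (q / 2) := by
        exact mul_le_mul' hCC (ENNReal.rpow_le_rpow (scale_mul_lintegral_blockHat_le hφ hτ j)
          (by linarith))
    _ = _ := by
        rw [← ENNReal.mul_rpow_of_nonneg _ _ (by linarith), ← mul_assoc,
          ← ENNReal.ofReal_mul (by positivity)]

variable {Ω : Type*} [MeasurableSpace Ω] {P : Measure Ω} [IsProbabilityMeasure P]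
  {g : CubeIndex a → Ω → ℂ} {s V : ℝ} {f : 𝓢'(R5, ℂ)}

lemma lintegral_enorm_gaussian_le {X : Ω → ℂ} (hX : HasGaussianLaw X P)
    (hV : ∫ ω, ‖X ω‖ ^ 2 ∂P ≤ V) : ∫⁻ ω, ‖X ω‖ₑ ∂P ≤ 1 + ENNReal.ofReal V := by
  have hi : Integrable (fun ω => ‖X ω‖ ^ 2) P := hX.memLp_two.norm.integrable_sq
  calc ∫⁻ ω, ‖X ω‖ₑ ∂P ≤ ∫⁻ ω, (1 + ENNReal.ofReal (‖X ω‖ ^ 2)) ∂P := by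
        refine lintegral_mono fun ω => ?_
        rw [← ofReal_norm, ← ENNReal.ofReal_one, ← ENNReal.ofReal_add zero_le_one (by positivity)]
        refine ENNReal.ofReal_le_ofReal ?_
        nlinarith [sq_nonneg (‖X ω‖ - 1), norm_nonneg (X ω)]
    _ = 1 + ENNReal.ofReal (∫ ω, ‖X ω‖ ^ 2 ∂P) := by
        rw [lintegral_add_left measurable_const,
          ofReal_integral_eq_lintegral_ofReal hi (Filter.Eventually.of_forall fun _ => sq_nonneg _)]
        simp
    _ ≤ _ := by gcongr

/-- The series defining the randomization converges almost surely. -/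
lemma ae_summable_boxProj (hφ : IsBumpFamily a φ) (hgm : ∀ j, Measurable (g j))
    (hg : ∀ j, HasGaussianLaw (g j) P) (hV : ∀ j, ∫ ω, ‖g j ω‖ ^ 2 ∂P ≤ V)
    (hf : Represents (TemperedDistribution.smulLeftCLM ℂ
      (fun η : R5 => bracketPow s ((2 * Real.pi) • η)) (𝓕 f)) h) (hh : MemLp h 2) :
    ∀ᵐ ω ∂P, Summable fun j => g j ω • boxProj φ j f := by
  obtain ⟨Λ, L, hΛ, hL⟩ := exists_summable_boxProj hφ hf hh
  have hm (j : CubeIndex a) : Measurable fun ω => ‖g j ω‖ₑ * ‖L j‖ₑ := (hgm j).enorm.mul_const _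
  -- The expected sum of norms is finite, so the series converges absolutely in $L^1$ almost surely;
  -- this requires no cancellation.
  have hfin : ∫⁻ ω, ∑' j, ‖g j ω‖ₑ * ‖L j‖ₑ ∂P ≠ ∞ := by
    rw [lintegral_tsum fun j => (hm j).aemeasurable]
    refine ne_top_of_le_ne_top (ENNReal.mul_ne_top (a := 1 + ENNReal.ofReal V) (by simp) hL) ?_
    rw [← ENNReal.tsum_mul_left]
    refine ENNReal.tsum_le_tsum fun j => ?_
    rw [lintegral_mul_const _ (hgm j).enorm]
    gcongr
    exact lintegral_enorm_gaussian_le (hg j) (hV j)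
  filter_upwards [ae_lt_top (Measurable.tsum hm) hfin] with ω hω
  have h1 : Summable fun j => g j ω • L j := by
    refine Summable.of_enorm ?_
    simpa only [enorm_smul] using hω.ne
  have h2 := Λ.summable h1
  simp only [map_smul, ← hΛ] at h2
  exact h2

/-- Gaussian tails for one of the norms of the evolution of the randomization. -/
lemma measure_mixedNorm_gt_le {K : ℝ} (hK : 0 < K) (hφ : IsBumpFamily a φ)
    (hgm : ∀ j, Measurable (g j)) (hg : ∀ j, HasGaussianLaw (g j) P)
    (hg0 : ∀ j, ∫ ω, g j ω ∂P = 0) (hV1 : 1 ≤ V) (hV : ∀ j, ∫ ω, ‖g j ω‖ ^ 2 ∂P ≤ V)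
    (hind : iIndepFun g P)
    (hf : Represents (TemperedDistribution.smulLeftCLM ℂ
      (fun η : R5 => bracketPow s ((2 * Real.pi) • η)) (𝓕 f)) h) (hhm : Measurable h)
    (hh : MemLp h 2) {M : ℝ} (hM : 0 < M) (hhM : eLpNorm h 2 volume ≤ ENNReal.ofReal M)
    {σ q r : ℝ} (hqr : IsExponent q r)
    (hbd : ∀ j, mixedPow volume volume q r (fun t x => ‖evol (blockHat (σ - s) φ h j) t x‖ₑ) ≤
        (ENNReal.ofReal K * blockMass φ h j) ^ (q / 2)) {l : ℝ} (hl : 0 < l) :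
    P {ω | ENNReal.ofReal l < mixedNorm q (ENNReal.ofReal r) fun t =>
        japanese σ (freeEvolution t (randomize φ (fun j => g j ω) f))} ≤
      ENNReal.ofReal (Real.exp 6 * Real.exp (-(l ^ 2 / (4 * (64 * V * (K * M ^ 2)))))) := by
  classical
  obtain ⟨hq2, hq6, hr2, hr6⟩ := hqr.bounds
  have hG : 0 < K * M ^ 2 := by positivity
  have hsum : ∑' j, ENNReal.ofReal K * blockMass φ h j ≤ ENNReal.ofReal (K * M ^ 2) := by
    rw [ENNReal.tsum_mul_left, tsum_blockMass hφ hhm, lintegral_enorm_sq_eq,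
      ENNReal.ofReal_mul hK.le, ENNReal.ofReal_pow hM.le]
    gcongr
  obtain ⟨A, hA, hA0, hAex, hAsum⟩ := exists_exhaustion (by simpa using hG) ENNReal.ofReal_ne_top hsum
  -- The event is enlarged, up to a null set, to one for the measurable block majorant.
  refine le_trans (measure_mono_ae ?_) (measure_mixedPow_block_gt_le (μ := volume) (ν := volume)
    hgm hg hg0 hV1 hV hind (fun j => measurable_evol (measurable_blockHat hφ hhm (σ - s) j))
    hq2 hq6 hr2 hr6 hbd hG (fun k => A (k + 1) \ A k) hAsum hl)
  filter_upwards [ae_summable_boxProj hφ hgm hg hV hf hh] with ω hω (hlt : ENNReal.ofReal l < _)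
  show ENNReal.ofReal l < _
  refine hlt.trans_le ?_
  unfold mixedNorm mixedPow
  refine ENNReal.rpow_le_rpow (lintegral_mono fun t => ?_) (by positivity)
  have hsum' : HasSum (fun j => g j ω • japanese σ (freeEvolution t (boxProj φ j f)))
      (japanese σ (freeEvolution t (randomize φ (fun j => g j ω) f))) := by
    have := hω.hasSum.mapL (japanese σ ∘L freeEvolution t)
    simp only [map_smul, ContinuousLinearMap.comp_apply] at this
    exact this
  have key := distNorm_le_blocks (z := fun j => g j ω)
    (fun j => measurable_evol_apply (measurable_blockHat hφ hhm (σ - s) j) t)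
    (fun θ j => θ.integrable.mul_bdd
      (measurable_evol_apply (measurable_blockHat hφ hhm (σ - s) j) t).aestronglyMeasurable
      (Filter.Eventually.of_forall fun x => norm_evol_le (blockHat (σ - s) φ h j) t x))
    (fun j => represents_evolution_boxProj hφ hf hh σ t j) hsum' hA hA0 hAex (r := r) (by linarith)
  refine (ENNReal.rpow_le_rpow key (by linarith)).trans_eq ?_
  rw [← ENNReal.rpow_mul, one_div_mul_eq_div]

end SingleNorm

/-! ### The random bound for the norm of `Y(ℝ)` -/

section RandomBound

variable {a : ℕ} {φ : CubeIndex a → R5 → ℝ} {s : ℝ} {f : 𝓢'(R5, ℂ)}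

/-- A distribution of finite Sobolev norm is represented on the frequency side by a measurable
function whose norm is as close to the Sobolev norm as one likes. -/
lemma exists_represents_of_sobolevNorm_lt {M : ℝ≥0∞} (h : sobolevNorm s f < M) :
    ∃ h : R5 → ℂ, Measurable h ∧ MemLp h 2 ∧ eLpNorm h 2 volume ≤ M ∧
      Represents (TemperedDistribution.smulLeftCLM ℂ
        (fun η : R5 => bracketPow s ((2 * Real.pi) • η)) (𝓕 f)) h := by
  simp only [sobolevNorm, distNorm, iInf_lt_iff] at h
  obtain ⟨h, hh, hrep, hlt⟩ := h
  have hae := hh.1.ae_eq_mk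
  exact ⟨hh.1.mk h, hh.1.stronglyMeasurable_mk.measurable, (memLp_congr_ae hae).1 hh,
    (eLpNorm_congr_ae hae.symm).trans_le hlt.le, Represents.congr hrep hae⟩

/-- Gaussian tails imply finiteness almost everywhere. -/
lemma ae_lt_top_of_tail {Ω : Type*} [MeasurableSpace Ω] {P : Measure Ω}
    {Y : Ω → ℝ≥0∞} {C c : ℝ} (hc : 0 < c)
    (h : ∀ r : ℝ, 0 < r →
      P {ω | ENNReal.ofReal r < Y ω} ≤ ENNReal.ofReal (C * Real.exp (-(c * r ^ 2)))) :
    ∀ᵐ ω ∂P, Y ω < ∞ := by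
  have hlim : Filter.Tendsto (fun r : ℝ => ENNReal.ofReal (C * Real.exp (-(c * r ^ 2))))
      Filter.atTop (nhds (ENNReal.ofReal (C * 0))) := by
    refine ENNReal.tendsto_ofReal (Filter.Tendsto.const_mul _ ?_)
    refine Real.tendsto_exp_neg_atTop_nhds_zero.comp ?_
    exact (Filter.tendsto_pow_atTop two_ne_zero).const_mul_atTop hc
  have hzero : P {ω | ¬ Y ω < ∞} ≤ ENNReal.ofReal (C * 0) := by
    refine ge_of_tendsto hlim ?_
    filter_upwards [Filter.eventually_gt_atTop 0] with r hr
    refine (measure_mono fun ω hω => ?_).trans (h r hr)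
    have : Y ω = ∞ := by simpa using hω
    show ENNReal.ofReal r < Y ω
    rw [this]
    exact ENNReal.ofReal_lt_top
  rw [ae_iff]
  simpa using hzero

lemma lt_or_lt_of_lt_add {r : ℝ} (hr : 0 < r) {x y z w : ℝ≥0∞}
    (h : ENNReal.ofReal r < x + y + z + w) :
    ENNReal.ofReal (r / 4) < x ∨ ENNReal.ofReal (r / 4) < y ∨ ENNReal.ofReal (r / 4) < z ∨
      ENNReal.ofReal (r / 4) < w := by
  by_contra! hc
  obtain ⟨h1, h2, h3, h4⟩ := hc
  refine absurd h (not_lt.2 ?_)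
  calc x + y + z + w ≤ ENNReal.ofReal (r / 4) + ENNReal.ofReal (r / 4) + ENNReal.ofReal (r / 4) +
        ENNReal.ofReal (r / 4) := by gcongr
    _ = ENNReal.ofReal r := by
        rw [← ENNReal.ofReal_add (by positivity) (by positivity),
          ← ENNReal.ofReal_add (by positivity) (by positivity),
          ← ENNReal.ofReal_add (by positivity) (by positivity)]
        congr 1
        ring

variable {Ω : Type*} [MeasurableSpace Ω] {P : Measure Ω} [IsProbabilityMeasure P]
  {g : CubeIndex a → Ω → ℂ} {V : ℝ}

/-- Gaussian tails for the norm of `Y(ℝ)`, with a constant `M` in place of the Sobolev norm. -/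
lemma measure_normY_gt_le {K : ℝ} (hK : 0 < K)
    (hbd : ∀ {φ : CubeIndex a → R5 → ℝ} {h : R5 → ℂ}, IsBumpFamily a φ → Measurable h → MemLp h 2 →
      ∀ {τ : ℝ}, τ ≤ (a : ℝ) / 2 → ∀ (j : CubeIndex a) {q r : ℝ}, IsExponent q r →
      mixedPow volume volume q r (fun t x => ‖evol (blockHat τ φ h j) t x‖ₑ) ≤
        (ENNReal.ofReal K * blockMass φ h j) ^ (q / 2)) (hs : 0 ≤ s + (a : ℝ) / 2)
    (hφ : IsBumpFamily a φ) (hgm : ∀ j, Measurable (g j)) (hg : ∀ j, HasGaussianLaw (g j) P)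
    (hg0 : ∀ j, ∫ ω, g j ω ∂P = 0) (hV1 : 1 ≤ V) (hV : ∀ j, ∫ ω, ‖g j ω‖ ^ 2 ∂P ≤ V)
    (hind : iIndepFun g P) {M : ℝ} (hM : 0 < M) (hfM : sobolevNorm s f < ENNReal.ofReal M)
    {r : ℝ} (hr : 0 < r) :
    P {ω | ENNReal.ofReal r < normY s a fun t => freeEvolution t
        (randomize φ (fun j => g j ω) f)} ≤
      ENNReal.ofReal (4 * Real.exp 6 *
        Real.exp (-((4096 * V * K)⁻¹ * r ^ 2 / M ^ 2))) := by
  obtain ⟨h, hhm, hh, hhM, hf⟩ := exists_represents_of_sobolevNorm_lt hfM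
  have single {σ : ℝ} (hσ : σ ≤ s + (a : ℝ) / 2) {q p : ℝ} (hqp : IsExponent q p) :
      P {ω | ENNReal.ofReal (r / 4) < mixedNorm q (ENNReal.ofReal p) fun t =>
        japanese σ (freeEvolution t (randomize φ (fun j => g j ω) f))} ≤
      ENNReal.ofReal (Real.exp 6 * Real.exp (-((4096 * V * K)⁻¹ * r ^ 2 / M ^ 2))) := by
    refine (measure_mixedNorm_gt_le hK hφ hgm hg hg0 hV1 hV hind hf hhm hh hM hhM hqp
      (fun j => hbd hφ hhm hh (by linarith) j hqp) (by positivity : 0 < r / 4)).trans_eq ?_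
    -- $4096=4\cdot 64\cdot 4^2$, the last factor from splitting `r` equally among the four norms.
    congr 4
    field_simp
    norm_num
  have e1 := single le_rfl (q := 2) (p := 5) (by simp [IsExponent])
  have e2 := single hs (q := 4) (p := 5) (by simp [IsExponent])
  have e3 := single hs (q := 4) (p := 4) (by simp [IsExponent])
  have e4 := single hs (q := 6) (p := 3) (by simp [IsExponent])
  simp only [japanese_zero, ContinuousLinearMap.id_apply, ENNReal.ofReal_ofNat] at e1 e2 e3 e4
  refine (measure_mono (fun ω hω => ?_)).trans ((measure_union_le _ _).trans
    (add_le_add ((measure_union_le _ _).trans (add_le_add ((measure_union_le _ _).trans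
      (add_le_add e1 e2)) e3)) e4) |>.trans_eq ?_)
  · rcases lt_or_lt_of_lt_add hr hω with h | h | h | h
    · exact Or.inl (Or.inl (Or.inl h))
    · exact Or.inl (Or.inl (Or.inr h))
    · exact Or.inl (Or.inr h)
    · exact Or.inr h
  · rw [← ENNReal.ofReal_add (by positivity) (by positivity),
      ← ENNReal.ofReal_add (by positivity) (by positivity),
      ← ENNReal.ofReal_add (by positivity) (by positivity)]
    congr 1
    ring

lemma exp_neg_div_eq {M y : ℝ} (hM : 0 < M) (hy : 0 ≤ y) :
    EReal.exp (-((ENNReal.ofReal y / ENNReal.ofReal M ^ 2 : ℝ≥0∞) : EReal)) =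
      ENNReal.ofReal (Real.exp (-(y / M ^ 2))) := by
  rw [← ENNReal.ofReal_pow hM.le, ← ENNReal.ofReal_div_of_pos (by positivity),
    EReal.coe_ennreal_ofReal, max_eq_left (by positivity), ← EReal.coe_neg, EReal.exp_coe]

/-- A Gaussian bound that holds for all constants above `N` holds for `N` itself. -/
lemma le_exp_of_forall_gt {N : ℝ≥0∞} (hN : N < ∞) {C y : ℝ} (hC : 0 ≤ C) (hy : 0 ≤ y) {b : ℝ≥0∞}
    (h : ∀ M : ℝ, 0 < M → N < ENNReal.ofReal M →
      b ≤ ENNReal.ofReal (C * Real.exp (-(y / M ^ 2)))) :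
    b ≤ ENNReal.ofReal C * EReal.exp (-((ENNReal.ofReal y / N ^ 2 : ℝ≥0∞) : EReal)) := by
  set M : ℕ → ℝ := fun n => N.toReal + 1 / ((n : ℝ) + 1) with hMdef
  have hMpos (n : ℕ) : 0 < M n := by
    have : 0 ≤ N.toReal := ENNReal.toReal_nonneg
    positivity
  have hlim : Filter.Tendsto (fun n => ENNReal.ofReal (M n)) Filter.atTop (nhds N) := by
    have h1 : Filter.Tendsto M Filter.atTop (nhds (N.toReal + 0)) :=
      tendsto_const_nhds.add tendsto_one_div_add_atTop_nhds_zero_nat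
    have h2 := ENNReal.tendsto_ofReal h1
    rwa [add_zero, ENNReal.ofReal_toReal hN.ne] at h2
  have hdiv : Filter.Tendsto (fun n => ENNReal.ofReal y / ENNReal.ofReal (M n) ^ 2) Filter.atTop
      (nhds (ENNReal.ofReal y / N ^ 2)) :=
    ENNReal.Tendsto.const_div (((ENNReal.continuous_pow 2).tendsto N).comp hlim)
      (Or.inr ENNReal.ofReal_ne_top)
  -- Passing to the limit in the extended reals includes `N = 0`: for `y > 0` the quotient is then
  -- infinite and its exponential bound is zero.
  have hexp := ENNReal.Tendsto.const_mul (a := ENNReal.ofReal C)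
    ((ENNReal.continuous_exp.tendsto _).comp ((continuous_neg.tendsto _).comp
      ((continuous_coe_ennreal_ereal.tendsto _).comp hdiv))) (Or.inr ENNReal.ofReal_ne_top)
  refine ge_of_tendsto' hexp fun n => ?_
  have hlt : N < ENNReal.ofReal (M n) := by
    conv_lhs => rw [← ENNReal.ofReal_toReal hN.ne]
    refine (ENNReal.ofReal_lt_ofReal_iff (hMpos n)).2 ?_
    have : (0 : ℝ) < 1 / ((n : ℝ) + 1) := by positivity
    simpa [hMdef] using this
  refine (h _ (hMpos n) hlt).trans_eq ?_
  simp only [Function.comp_apply]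
  rw [exp_neg_div_eq (hMpos n) hy, ENNReal.ofReal_mul hC]

end RandomBound

end NarrowedWiener

end

/-! ### Conclusion, with constants uniform in the randomization. -/

theorem proposition6p1 (s : ℝ) (a : ℕ)
    (ha : max (max (4 - 2 * s) (5 - 4 * s)) (max (-(1 / 2) * s) 3) < (a : ℝ)) (V : ℝ) :
    ∃ C : ℝ, 0 < C ∧ ∃ c : ℝ, 0 < c ∧
      ∀ (φ : NarrowedWiener.CubeIndex a → NarrowedWiener.R5 → ℝ),
      NarrowedWiener.IsBumpFamily a φ →
      ∀ {Ω : Type*} [MeasurableSpace Ω] (P : Measure Ω) [IsProbabilityMeasure P]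
        (g : NarrowedWiener.CubeIndex a → Ω → ℂ),
      (∀ j, HasGaussianLaw (g j) P) → (∀ j, ∫ ω, g j ω ∂P = 0) →
      (∀ j, ∫ ω, ‖g j ω‖ ^ 2 ∂P ≤ V) → iIndepFun g P →
      ∀ f : 𝓢'(NarrowedWiener.R5, ℂ), NarrowedWiener.sobolevNorm s f < ∞ →
        (∀ᵐ ω ∂P, Summable fun j => g j ω • NarrowedWiener.boxProj φ j f) ∧
        (∀ r : ℝ, 0 < r →
          P {ω | ENNReal.ofReal r < NarrowedWiener.normY s a fun t =>
              NarrowedWiener.freeEvolution t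
                (NarrowedWiener.randomize φ (fun j => g j ω) f)} ≤
            ENNReal.ofReal C * EReal.exp
              (-((ENNReal.ofReal (c * r ^ 2) / NarrowedWiener.sobolevNorm s f ^ 2 : ℝ≥0∞) :
                EReal))) ∧
        (∀ᵐ ω ∂P, NarrowedWiener.normY s a (fun t =>
            NarrowedWiener.freeEvolution t
              (NarrowedWiener.randomize φ (fun j => g j ω) f)) < ∞) := by
  open NarrowedWiener in
  obtain ⟨K, hK, hbd⟩ := exists_mixedPow_blockHat_le a
  -- From `4 - 2 * s < a`. It allows the three norms without derivatives to be treated as the case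
  -- $σ=0\le s+a/2$.
  have hs : 0 ≤ s + (a : ℝ) / 2 := by
    have := (le_max_left (4 - 2 * s) (5 - 4 * s)).trans (le_max_left _ _) |>.trans_lt ha
    linarith
  -- Enlarging the variance bound keeps the constants positive for every real `V`.
  have hW1 : 1 ≤ max V 1 := le_max_right _ _
  refine ⟨4 * Real.exp 6, by positivity, (4096 * max V 1 * K)⁻¹, by positivity, ?_⟩
  intro φ hφ Ω _ P _ g hg hg0 hV hind f hfin
  have hae (j : CubeIndex a) : g j =ᵐ[P] (hg j).aemeasurable.mk (g j) :=
    (hg j).aemeasurable.ae_eq_mk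
  -- Measurable versions are needed for Tonelli on $Ω\times\mathbb R\times\mathbb R^5$. The index
  -- set is countable, so they agree with the `g j` simultaneously outside one null set.
  set γ : CubeIndex a → Ω → ℂ := fun j => (hg j).aemeasurable.mk (g j) with hγ
  have hγm (j : CubeIndex a) : Measurable (γ j) := (hg j).aemeasurable.measurable_mk
  have hγg (j : CubeIndex a) : HasGaussianLaw (γ j) P := (hg j).congr (hae j)
  have hγ0 (j : CubeIndex a) : ∫ ω, γ j ω ∂P = 0 := by
    rw [← hg0 j]
    exact integral_congr_ae (hae j).symm
  have hγV (j : CubeIndex a) : ∫ ω, ‖γ j ω‖ ^ 2 ∂P ≤ max V 1 := by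
    refine le_trans (le_of_eq ?_) ((hV j).trans (le_max_left _ _))
    exact integral_congr_ae ((hae j).symm.mono fun ω hω => by
      simp only [show γ j ω = g j ω from hω])
  have hγind : iIndepFun γ P := hind.congr hae
  have hall : ∀ᵐ ω ∂P, (fun j => g j ω) = fun j => γ j ω := by
    filter_upwards [ae_all_iff.2 hae] with ω hω
    exact funext hω
  have htail (M : ℝ) (hM : 0 < M) (hfM : sobolevNorm s f < ENNReal.ofReal M) (r : ℝ) (hr : 0 < r) :
      P {ω | ENNReal.ofReal r < normY s a fun t => freeEvolution t
        (randomize φ (fun j => g j ω) f)} ≤ ENNReal.ofReal (4 * Real.exp 6 *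
        Real.exp (-((4096 * max V 1 * K)⁻¹ * r ^ 2 / M ^ 2))) := by
    refine le_trans (measure_mono_ae ?_)
      (measure_normY_gt_le hK hbd hs hφ hγm hγg hγ0 hW1 hγV hγind hM hfM hr)
    filter_upwards [hall] with ω hω (hlt : _ < _)
    show _ < _
    rwa [hω] at hlt
  have hM0 : 0 < (sobolevNorm s f).toReal + 1 := by positivity
  have hfM0 : sobolevNorm s f < ENNReal.ofReal ((sobolevNorm s f).toReal + 1) := by
    rw [ENNReal.lt_ofReal_iff_toReal_lt hfin.ne]
    exact lt_add_one _
  refine ⟨?_, fun r hr => ?_, ?_⟩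
  · obtain ⟨h, -, hh, -, hf⟩ := exists_represents_of_sobolevNorm_lt hfM0
    filter_upwards [ae_summable_boxProj hφ hγm hγg hγV hf hh, hall] with ω h1 h2
    have h3 (j : CubeIndex a) : g j ω = γ j ω := congrFun h2 j
    simpa only [h3] using h1
  · exact le_exp_of_forall_gt hfin (by positivity) (by positivity)
      fun M hM hfM => htail M hM hfM r hr
  · refine ae_lt_top_of_tail (C := 4 * Real.exp 6)
      (c := (4096 * max V 1 * K)⁻¹ / ((sobolevNorm s f).toReal + 1) ^ 2) (by positivity)
      fun r hr => ?_
    refine (htail _ hM0 hfM0 r hr).trans_eq ?_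
    congr 4
    ring
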